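/- Let $P$ be the law of $(X,T,R,S(0),S(1),Y(0),Y(1))$, where $X$ are covariates and $S(0),S(1)$ potential surrogates with values in standard Borel spaces $\mathcal X,\mathcal S$ (e.g. Borel subsets of Euclidean spaces), $T,R\in\{0,1\}$ are the treatment and the indicator that the primary outcome is observed, and $Y(0),Y(1)$ are real potential outcomes with finite second moments; put $S=S(T)$, $Y=Y(T)$ and $\delta^*=\mathbb E[Y(1)]-\mathbb E[Y(0)]$. Write $e^*(x)=\mathbb P(T=1\mid X=x)$, $r^*(t,x,s)=\mathbb P(R=1\mid T=t,X=x,S=s)$, $r^*(t,x)=\mathbb P(R=1\mid T=t,X=x)$, $\tilde\mu^*(t,x,s)=\mathbb E[Y\mid T=t,R=1,X=x,S=s]$ and $\mu^*(t,x)=\mathbb E[Y\mid T=t,R=1,X=x]$. Assume for $t=0,1$ that (i) $(Y(t),S(t))\perp T\mid X$; (ii) $R\perp Y(t)\mid (X,T=t,S(t))$; (iii) $R\perp S(t)\mid (T,X)$; and (iv) for a constant $\epsilon\in(0,1/2)$, almost surely $\epsilon\le e^*(X)\le 1-\epsilon$ and $\epsilon\le r^*(t,X,S(t))\le 1$. Let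 $\mathcal M$ be the model of all such laws (with this $\epsilon$). For a setting in which only a function $W$ of $(X,T,R,S(0),S(1),Y(0),Y(1))$ is observed, a smooth submodel is a family $(Q_\gamma)_{\gamma\in\mathbb R}$ of laws, with $Q_\gamma\in\mathcal M$ for $\gamma$ near $0$, such that the law of $W$ under $Q_0$ is that under $P$ and, for $\gamma$ near $0$, the law of $W$ under $Q_\gamma$ has a density $p_\gamma$ with respect to that under $P$ with $(p_\gamma-1)/\gamma\to g$ in $L^2$ as $\gamma\to0$; $g$ is its score. An influence function is an $h(W)\in L^2$ such that $\frac{d}{d\gamma}\delta(Q_\gamma)|_{\gamma=0}=\mathbb E[h(W)g(W)]$ for every smooth submodel, where $\delta(Q)$ is the average treatment effect under $Q$; it is efficient if it lies in the closed linear span of all scores, and the efficiency lower bound is then $\mathbb E[h(W)^2]$. Let $V^*_{I},V^*_{III},V^*_{IV}$ be the efficiency lower bounds for $\delta^*$ when one observes, respectively: (I) $(X,T,Y)$ if $R=1$ and $(X,T)$ if $R=0$ (and $R$); (III) $(X,T,S,Y)$ if $R=1$ and $(X,T,S)$ if $R=0$ (and $R$); (IV) $(X,T,S,Y)$ for all units.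 Then these bounds exist and are unique, and they are $V_j^*=\mathbb E[\psi_j^2]$ with $$\psi_{I}=\mu^*(1,X)-\mu^*(0,X)+\tfrac{TR}{e^*(X)r^*(1,X)}(Y-\mu^*(1,X))-\tfrac{(1-T)R}{(1-e^*(X))r^*(0,X)}(Y-\mu^*(0,X))-\delta^*,$$ $$\psi_{III}=\mu^*(1,X)-\mu^*(0,X)+\tfrac{TR}{e^*(X)r^*(1,X)}(Y-\tilde\mu^*(1,X,S))-\tfrac{(1-T)R}{(1-e^*(X))r^*(0,X)}(Y-\tilde\mu^*(0,X,S))+\tfrac{T}{e^*(X)}(\tilde\mu^*(1,X,S)-\mu^*(1,X))-\tfrac{1-T}{1-e^*(X)}(\tilde\mu^*(0,X,S)-\mu^*(0,X))-\delta^*,$$ $$\psi_{IV}=\mu^*(1,X)-\mu^*(0,X)+\tfrac{T}{e^*(X)}(Y-\mu^*(1,X))-\tfrac{1-T}{1-e^*(X)}(Y-\mu^*(0,X))-\delta^*.$$ Moreover $$V_{I}^*-V_{III}^*=\mathbb E\Big\{\tfrac{1}{e^*(X)}\tfrac{1-r^*(1,X)}{r^*(1,X)}\operatorname{Var}\{\tilde\mu^*(1,X,S(1))\mid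 X\}+\tfrac{1}{1-e^*(X)}\tfrac{1-r^*(0,X)}{r^*(0,X)}\operatorname{Var}\{\tilde\mu^*(0,X,S(0))\mid X\}\Big\},$$ $$V_{III}^*-V_{IV}^*=\mathbb E\Big\{\tfrac{1}{e^*(X)}\tfrac{1-r^*(1,X)}{r^*(1,X)}\operatorname{Var}\{Y(1)\mid X,S(1)\}+\tfrac{1}{1-e^*(X)}\tfrac{1-r^*(0,X)}{r^*(0,X)}\operatorname{Var}\{Y(0)\mid X,S(0)\}\Big\},$$ where the random variables inside both expectations are integrable. -/

import Mathlib

open MeasureTheory ProbabilityTheory Filter Topology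

noncomputable section

namespace SurrogateATE

/-! ### Semiparametric efficiency bounds

`𝓜` is a model for the law of a variable `ω`, of which only `obs ω` is observed, and `θ` is the
parameter of interest, a functional of the law of `ω`. -/

section Efficiency

/-- `γ ↦ Q γ` is a smooth one-dimensional submodel of `𝓜` through (the observed law of) `P`, with
score `g`: near `γ = 0` the laws `Q γ` belong to `𝓜`, the observed law of `Q 0` is that of `P`, and
the likelihood ratio `p γ` of the observed law of `Q γ` with respect to that of `P` is
differentiable in mean square at `0` with derivative `g`, that is `(p γ - 1) / γ → g` in `L²`. -/
structure IsSmoothSubmodel {Ω O : Type*} [MeasurableSpace Ω] [MeasurableSpace O]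
    (𝓜 : Set (ProbabilityMeasure Ω)) (obs : Ω → O) (P : ProbabilityMeasure Ω)
    (Q : ℝ → ProbabilityMeasure Ω) (g : Lp ℝ 2 ((P : Measure Ω).map obs)) : Prop where
  mem_model : ∀ᶠ γ in 𝓝 (0 : ℝ), Q γ ∈ 𝓜
  base : (Q 0 : Measure Ω).map obs = (P : Measure Ω).map obs
  dominated : ∀ᶠ γ in 𝓝 (0 : ℝ), (Q γ : Measure Ω).map obs ≪ (P : Measure Ω).map obs
  score : Tendsto
    (fun γ : ℝ => eLpNorm
      (fun w => ((((Q γ : Measure Ω).map obs).rnDeriv ((P : Measure Ω).map obs) w).toReal - 1) / γ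
        - g w) 2 ((P : Measure Ω).map obs))
    (𝓝[≠] 0) (𝓝 0)

/-- The tangent set: the scores of all smooth one-dimensional submodels. -/
def tangentSet {Ω O : Type*} [MeasurableSpace Ω] [MeasurableSpace O]
    (𝓜 : Set (ProbabilityMeasure Ω)) (obs : Ω → O) (P : ProbabilityMeasure Ω) :
    Set (Lp ℝ 2 ((P : Measure Ω).map obs)) :=
  {g | ∃ Q : ℝ → ProbabilityMeasure Ω, IsSmoothSubmodel 𝓜 obs P Q g}

/-- `h` is an influence function of `θ`: along every smooth submodel, with score `g`, the parameter
is differentiable with derivative `⟪h, g⟫ = E[h g]`. -/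
def IsInfluenceFunction {Ω O : Type*} [MeasurableSpace Ω] [MeasurableSpace O]
    (𝓜 : Set (ProbabilityMeasure Ω)) (θ : ProbabilityMeasure Ω → ℝ) (obs : Ω → O)
    (P : ProbabilityMeasure Ω) (h : Lp ℝ 2 ((P : Measure Ω).map obs)) : Prop :=
  ∀ (Q : ℝ → ProbabilityMeasure Ω) (g : Lp ℝ 2 ((P : Measure Ω).map obs)),
    IsSmoothSubmodel 𝓜 obs P Q g → HasDerivAt (fun γ => θ (Q γ)) (inner ℝ h g) 0

/-- The efficient influence function: the influence function that lies in the closed linear span of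
the tangent set. -/
def IsEfficientInfluenceFunction {Ω O : Type*} [MeasurableSpace Ω] [MeasurableSpace O]
    (𝓜 : Set (ProbabilityMeasure Ω)) (θ : ProbabilityMeasure Ω → ℝ) (obs : Ω → O)
    (P : ProbabilityMeasure Ω) (h : Lp ℝ 2 ((P : Measure Ω).map obs)) : Prop :=
  IsInfluenceFunction 𝓜 θ obs P h ∧
    h ∈ (Submodule.span ℝ (tangentSet 𝓜 obs P)).topologicalClosure

/-- `v` is the efficiency lower bound for `θ` at `P` when `obs` is observed: the second moment of
the efficient influence function. -/
def IsEfficiencyBound {Ω O : Type*} [MeasurableSpace Ω] [MeasurableSpace O]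
    (𝓜 : Set (ProbabilityMeasure Ω)) (θ : ProbabilityMeasure Ω → ℝ) (obs : Ω → O)
    (P : ProbabilityMeasure Ω) (v : ℝ) : Prop :=
  ∃ h : Lp ℝ 2 ((P : Measure Ω).map obs),
    IsEfficientInfluenceFunction 𝓜 θ obs P h ∧ v = ∫ w, h w ^ 2 ∂((P : Measure Ω).map obs)

end Efficiency

/-! ### Population -/

/-- A subject `(X, T, R, S(·), Y(·))`: covariates, treatment, labelling indicator, potential
surrogates and potential outcomes; `true` stands for `1` and `false` for `0`. -/
abbrev Subject (𝒳 𝒮 : Type*) := 𝒳 × Bool × Bool × (Bool → 𝒮) × (Bool → ℝ)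

section Variables

variable {𝒳 𝒮 : Type*}

/-- Covariates. -/
def X (ω : Subject 𝒳 𝒮) : 𝒳 := ω.1

/-- Treatment. -/
def T (ω : Subject 𝒳 𝒮) : Bool := ω.2.1

/-- Labelling indicator: `R = 1` if the primary outcome is observed. -/
def R (ω : Subject 𝒳 𝒮) : Bool := ω.2.2.1

/-- Potential surrogates `S(t)`. -/
def Spot (t : Bool) (ω : Subject 𝒳 𝒮) : 𝒮 := ω.2.2.2.1 t

/-- Potential outcomes `Y(t)`. -/
def Ypot (t : Bool) (ω : Subject 𝒳 𝒮) : ℝ := ω.2.2.2.2 t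

/-- Actual surrogate `S = S(T)`. -/
def S (ω : Subject 𝒳 𝒮) : 𝒮 := Spot (T ω) ω

/-- Actual primary outcome `Y = Y(T)`. -/
def Y (ω : Subject 𝒳 𝒮) : ℝ := Ypot (T ω) ω

/-- A binary variable as a real number. -/
def ind (b : Bool) : ℝ := if b then 1 else 0

/-- No surrogate: `(X, T, Y)` is observed if `R = 1` and `(X, T)` if `R = 0`
(a missing outcome is coded as `0`; `R` is part of the data). -/
def obsI (ω : Subject 𝒳 𝒮) : 𝒳 × Bool × Bool × ℝ := (X ω, T ω, R ω, ind (R ω) * Y ω)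

/-- Surrogate on all units: `(X, T, S, Y)` is observed if `R = 1` and `(X, T, S)` if `R = 0`. -/
def obsIII (ω : Subject 𝒳 𝒮) : 𝒳 × Bool × 𝒮 × Bool × ℝ := (X ω, T ω, S ω, R ω, ind (R ω) * Y ω)

/-- Fully labelled data: `(X, T, S, Y)` is observed on all units. -/
def obsIV (ω : Subject 𝒳 𝒮) : 𝒳 × Bool × 𝒮 × ℝ := (X ω, T ω, S ω, Y ω)

variable [MeasurableSpace 𝒳] [MeasurableSpace 𝒮]

theorem measurable_X : Measurable (X : Subject 𝒳 𝒮 → 𝒳) := by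
  unfold X; fun_prop

theorem measurable_T : Measurable (T : Subject 𝒳 𝒮 → Bool) := by
  unfold T; fun_prop

theorem measurable_Spot (t : Bool) : Measurable (Spot t : Subject 𝒳 𝒮 → 𝒮) := by
  unfold Spot; fun_prop

/-! ### Nuisance functions -/

/-- Propensity score `e(x) = P(T = 1 | X = x)`. -/
def e (P : Measure (Subject 𝒳 𝒮)) [IsFiniteMeasure P] (x : 𝒳) : ℝ :=
  (condDistrib T X P x).real {true}

/-- Labelling propensity score `P(R = 1 | T = t, X = x, S = s)`. -/
def rS (P : Measure (Subject 𝒳 𝒮)) [IsFiniteMeasure P] (t : Bool) (x : 𝒳) (s : 𝒮) : ℝ :=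
  (condDistrib R (fun ω => (X ω, S ω)) (P[|T ⁻¹' {t}]) (x, s)).real {true}

/-- Labelling propensity score `r(t, x) = P(R = 1 | T = t, X = x)`. -/
def r (P : Measure (Subject 𝒳 𝒮)) [IsFiniteMeasure P] (t : Bool) (x : 𝒳) : ℝ :=
  (condDistrib R X (P[|T ⁻¹' {t}]) x).real {true}

/-- The event `T = t, R = 1`. -/
def labelled (t : Bool) : Set (Subject 𝒳 𝒮) := {ω | T ω = t ∧ R ω = true}

/-- Regression function `μ̃(t, x, s) = E[Y | T = t, R = 1, X = x, S = s]`. -/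
def muS (P : Measure (Subject 𝒳 𝒮)) [IsFiniteMeasure P] (t : Bool) (x : 𝒳) (s : 𝒮) : ℝ :=
  ∫ y, y ∂(condDistrib Y (fun ω => (X ω, S ω)) (P[|labelled t]) (x, s))

/-- Regression function `μ(t, x) = E[Y | T = t, R = 1, X = x]`. -/
def mu (P : Measure (Subject 𝒳 𝒮)) [IsFiniteMeasure P] (t : Bool) (x : 𝒳) : ℝ :=
  ∫ y, y ∂(condDistrib Y X (P[|labelled t]) x)

/-- Average treatment effect `δ = E[Y(1)] - E[Y(0)]`. -/
def ate (P : Measure (Subject 𝒳 𝒮)) : ℝ :=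
  ∫ ω, Ypot true ω ∂P - ∫ ω, Ypot false ω ∂P

end Variables

/-! ### The model -/

section Model

variable {𝒳 𝒮 : Type*} [MeasurableSpace 𝒳] [MeasurableSpace 𝒮]
  [StandardBorelSpace 𝒳] [StandardBorelSpace 𝒮]

/-- Unconfoundedness, strict overlap with constant `ε`, labelling independent of the surrogates,
and square-integrable outcomes. -/
structure Assumptions (ε : ℝ) (P : Measure (Subject 𝒳 𝒮)) [IsFiniteMeasure P] : Prop where
  /-- `(Y(t), S(t)) ⊥ T | X`. -/
  unconfounded_treatment : ∀ t : Bool,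
    CondIndepFun (MeasurableSpace.comap X inferInstance) measurable_X.comap_le
      (fun ω => (Ypot t ω, Spot t ω)) T P
  /-- `R ⊥ Y(t) | (X, T = t, S(t))`. -/
  unconfounded_labelling : ∀ t : Bool,
    CondIndepFun (MeasurableSpace.comap (fun ω => (X ω, Spot t ω)) inferInstance)
      (measurable_X.prodMk (measurable_Spot t)).comap_le
      R (Ypot t) (P[|T ⁻¹' {t}])
  /-- `R ⊥ S(t) | (T, X)`. -/
  labelling_surrogate : ∀ t : Bool,
    CondIndepFun (MeasurableSpace.comap (fun ω => (T ω, X ω)) inferInstance)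
      (measurable_T.prodMk measurable_X).comap_le
      R (Spot t) P
  overlap_treatment : ∀ᵐ ω ∂P, ε ≤ e P (X ω) ∧ e P (X ω) ≤ 1 - ε
  overlap_labelling : ∀ t : Bool, ∀ᵐ ω ∂P,
    ε ≤ rS P t (X ω) (Spot t ω) ∧ rS P t (X ω) (Spot t ω) ≤ 1
  square_integrable : ∀ t : Bool, MemLp (Ypot t) 2 P

/-- The model: all population laws that satisfy the assumptions. -/
def model (𝒳 𝒮 : Type*) [MeasurableSpace 𝒳] [MeasurableSpace 𝒮]
    [StandardBorelSpace 𝒳] [StandardBorelSpace 𝒮] (ε : ℝ) :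
    Set (ProbabilityMeasure (Subject 𝒳 𝒮)) :=
  {P | Assumptions ε (P : Measure (Subject 𝒳 𝒮))}

/-- `v` is the efficiency lower bound for the average treatment effect at `P` when `obs` is
observed. -/
def IsATEBound {O : Type*} [MeasurableSpace O] (ε : ℝ) (obs : Subject 𝒳 𝒮 → O)
    (P : ProbabilityMeasure (Subject 𝒳 𝒮)) (v : ℝ) : Prop :=
  IsEfficiencyBound (model 𝒳 𝒮 ε) (fun Q => ate (Q : Measure (Subject 𝒳 𝒮))) obs P v

end Model

/-! ### The explicit influence functions and their second moments -/

section Explicit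

variable {𝒳 𝒮 : Type*} [MeasurableSpace 𝒳] [MeasurableSpace 𝒮]

/-- Efficient influence function without surrogates. -/
def psiI (P : Measure (Subject 𝒳 𝒮)) [IsFiniteMeasure P] (ω : Subject 𝒳 𝒮) : ℝ :=
  mu P true (X ω) - mu P false (X ω)
    + ind (T ω) * ind (R ω) / (e P (X ω) * r P true (X ω)) * (Y ω - mu P true (X ω))
    - (1 - ind (T ω)) * ind (R ω) / ((1 - e P (X ω)) * r P false (X ω))
        * (Y ω - mu P false (X ω))
    - ate P

/-- Efficient influence function with surrogates on all units. -/
def psiIII (P : Measure (Subject 𝒳 𝒮)) [IsFiniteMeasure P] (ω : Subject 𝒳 𝒮) : ℝ :=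
  mu P true (X ω) - mu P false (X ω)
    + ind (T ω) * ind (R ω) / (e P (X ω) * r P true (X ω)) * (Y ω - muS P true (X ω) (S ω))
    - (1 - ind (T ω)) * ind (R ω) / ((1 - e P (X ω)) * r P false (X ω))
        * (Y ω - muS P false (X ω) (S ω))
    + ind (T ω) / e P (X ω) * (muS P true (X ω) (S ω) - mu P true (X ω))
    - (1 - ind (T ω)) / (1 - e P (X ω)) * (muS P false (X ω) (S ω) - mu P false (X ω))
    - ate P

/-- Efficient influence function with fully labelled data. -/
def psiIV (P : Measure (Subject 𝒳 𝒮)) [IsFiniteMeasure P] (ω : Subject 𝒳 𝒮) : ℝ :=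
  mu P true (X ω) - mu P false (X ω)
    + ind (T ω) / e P (X ω) * (Y ω - mu P true (X ω))
    - (1 - ind (T ω)) / (1 - e P (X ω)) * (Y ω - mu P false (X ω))
    - ate P

/-- `E[ψ²]` for `ψ = psiI`. -/
def VI (P : Measure (Subject 𝒳 𝒮)) [IsFiniteMeasure P] : ℝ := ∫ ω, psiI P ω ^ 2 ∂P

/-- `E[ψ²]` for `ψ = psiIII`. -/
def VIII (P : Measure (Subject 𝒳 𝒮)) [IsFiniteMeasure P] : ℝ := ∫ ω, psiIII P ω ^ 2 ∂P

/-- `E[ψ²]` for `ψ = psiIV`. -/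
def VIV (P : Measure (Subject 𝒳 𝒮)) [IsFiniteMeasure P] : ℝ := ∫ ω, psiIV P ω ^ 2 ∂P

/-- The integrand of the first gap:
`(1/e(X)) ((1 - r(1,X))/r(1,X)) Var{μ̃(1,X,S(1)) | X}` plus the same for the control arm. -/
def gainIntegrand (P : Measure (Subject 𝒳 𝒮)) [IsFiniteMeasure P] (ω : Subject 𝒳 𝒮) : ℝ :=
  1 / e P (X ω) * ((1 - r P true (X ω)) / r P true (X ω))
      * condVar (MeasurableSpace.comap X inferInstance)
          (fun ω => muS P true (X ω) (Spot true ω)) P ω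
    + 1 / (1 - e P (X ω)) * ((1 - r P false (X ω)) / r P false (X ω))
      * condVar (MeasurableSpace.comap X inferInstance)
          (fun ω => muS P false (X ω) (Spot false ω)) P ω

/-- The integrand of the second gap:
`(1/e(X)) ((1 - r(1,X))/r(1,X)) Var{Y(1) | X, S(1)}` plus the same for the control arm. -/
def lossIntegrand (P : Measure (Subject 𝒳 𝒮)) [IsFiniteMeasure P] (ω : Subject 𝒳 𝒮) : ℝ :=
  1 / e P (X ω) * ((1 - r P true (X ω)) / r P true (X ω))
      * condVar (MeasurableSpace.comap (fun ω => (X ω, Spot true ω)) inferInstance)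
          (Ypot true) P ω
    + 1 / (1 - e P (X ω)) * ((1 - r P false (X ω)) / r P false (X ω))
      * condVar (MeasurableSpace.comap (fun ω => (X ω, Spot false ω)) inferInstance)
          (Ypot false) P ω

end Explicit

end SurrogateATE

end

/-! Everything is written in terms of conditional probabilities of events given the potential
variables. Under the assumptions, within arm t treatment has probability π(t, X) and labelling has
probability η(t, X) given (X, S(t), Y(t)): assumption (ii) removes Y(t) from the labelling
probability and (iii) removes S(t). Hence regressions on labelled units are regressions of the
potential outcomes (`IsRandomized.integral_mul_sub_regression`), and all three candidates ψ are
instances of one function `Regression.psi`: a contrast of regressions on X, plus an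
inverse-probability-weighted residual Y − m, plus an inverse-probability-weighted deviation m − μ.
Settings I and IV take m = μ, with different revealing probabilities; setting III takes for m the
regression on X and S.

The function is an influence function by double robustness. Along a smooth submodel Q_γ nothing is
known about the regressions of Q_γ, so let H_γ have the regressions of P but the weights of Q_γ.
True weights give ∫ H_γ dQ_γ = δ(Q_γ) − δ(P) (`Regression.integral_psi_inv`); true regressions give
∫ H_γ dP = 0 for any weights (`Regression.IsCentered.integral_psi`). Therefore (δ(Q_γ) − δ(P))/γ =
E[H_γ (p_γ − 1)/γ], which tends to E[h g] once H_γ → h in L². The weights of Q_γ are bounded and are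
determined by the observed law, so they converge in L¹, and that is enough
(`integral_abs_sub_le_of_isPropensity`, `tendsto_eLpNorm_two_mul`).

The function lies in the tangent space because the joint law of the two arms is not identified.
Replace P by a law P' with the same observed law, in which the arms are independent given X and (T,
R) depends on the potential variables through X only (`exists_isDecoupling`). Tilting P' by 1 + γD,
with D a bounded mean-zero function of the potential variables, does not alter the conditional law
of (T, R), so the tilt stays in the model and its score is E'[D | W] (`exists_mem_tangentSet`). An
element k orthogonal to all scores is thus orthogonal to every square-integrable mean-zero D of the
potential variables. Take for D the function `Regression.score`, in which both arms enter with
residuals and deviations. It differs from ψ only by terms of the arm or outcome that the data hide,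
and these have conditional mean zero given W; so k is orthogonal to ψ. Perturbing the law of the
potential variables is therefore enough, and the propensities never have to be perturbed.

Being both an influence function and a tangent vector determines the element of L² uniquely. The
second moments split into orthogonal pieces, and both gaps follow from 1/(πη) = 1/π + (1/π)(1 − η)/η
together with the Pythagorean decomposition of Y(t) − μ into (Y(t) − μ̃) + (μ̃ − μ). -/

noncomputable section

namespace SurrogateATE

/-! ### Propensities -/

section Propensity

open scoped ENNReal

variable {Ω α β γ : Type*} [MeasurableSpace Ω] [MeasurableSpace α] [MeasurableSpace β]
  [MeasurableSpace γ]

/-- `ρ` is a version of the conditional probability of `E` given `V`. -/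
def IsPropensity (μ : Measure Ω) (E : Set Ω) (V : Ω → α) (ρ : α → ℝ≥0∞) : Prop :=
  (μ.restrict E).map V = (μ.map V).withDensity ρ

namespace IsPropensity

variable {μ ν : Measure Ω} {E F : Set Ω} {V : Ω → α} {ρ ρ' : α → ℝ≥0∞}

theorem lintegral (h : IsPropensity μ E V ρ) (hV : Measurable V) (hρ : Measurable ρ)
    {f : α → ℝ≥0∞} (hf : Measurable f) :
    ∫⁻ ω in E, f (V ω) ∂μ = ∫⁻ ω, ρ (V ω) * f (V ω) ∂μ := by
  rw [← lintegral_map hf hV, h, lintegral_withDensity_eq_lintegral_mul _ hρ hf,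
    lintegral_map (hρ.mul hf) hV]
  rfl

theorem integral {p : α → ℝ} (h : IsPropensity μ E V fun v => ENNReal.ofReal (p v))
    (hV : Measurable V) (hp : Measurable p) (hp0 : ∀ v, 0 ≤ p v)
    {f : α → ℝ} (hf : Measurable f) :
    ∫ ω in E, f (V ω) ∂μ = ∫ ω, p (V ω) * f (V ω) ∂μ := by
  rw [← integral_map (f := f) hV.aemeasurable hf.aestronglyMeasurable, h,
    integral_withDensity_eq_integral_toReal_smul hp.ennreal_ofReal (by simp),
    integral_map hV.aemeasurable]
  · simp [ENNReal.toReal_ofReal (hp0 _)]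
  · exact (hp.ennreal_ofReal.ennreal_toReal.smul hf).aestronglyMeasurable

theorem of_measure (hV : Measurable V) (hρ : Measurable ρ)
    (h : ∀ A, MeasurableSet A → μ (V ⁻¹' A ∩ E) = ∫⁻ ω in V ⁻¹' A, ρ (V ω) ∂μ) :
    IsPropensity μ E V ρ := by
  ext A hA
  rw [Measure.map_apply hV hA, Measure.restrict_apply (hV hA), h A hA, withDensity_apply _ hA,
    setLIntegral_map hA hρ hV]

theorem congr (h : IsPropensity μ E V ρ) (hρ : ρ =ᵐ[μ.map V] ρ') : IsPropensity μ E V ρ' :=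
  Eq.trans h (withDensity_congr_ae hρ)

/-- Coarsening the conditioning variable averages the conditional probability over the finer
information; one that already depends on the coarser variable only is unchanged by the averaging. -/
theorem comp (h : IsPropensity μ E V fun a => ρ' a) (hV : Measurable V) {W : Ω → β} {f : α → β}
    (hf : Measurable f) (hW : ∀ ω, W ω = f (V ω)) {η : β → ℝ≥0∞} (hη : Measurable η)
    (hρ : ∀ᵐ ω ∂μ, ρ' (V ω) = η (W ω)) (hρ' : Measurable ρ') : IsPropensity μ E W η := by
  obtain rfl : W = f ∘ V := funext hW
  refine of_measure (hf.comp hV) hη fun A hA => ?_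
  have h1 := h.lintegral hV hρ' (f := (f ⁻¹' A).indicator 1) (measurable_one.indicator (hf hA))
  have e1 : ∀ ω, (f ⁻¹' A).indicator (1 : α → ℝ≥0∞) (V ω) = (f ∘ V ⁻¹' A).indicator 1 ω :=
    fun ω => rfl
  simp_rw [e1] at h1
  rw [lintegral_indicator_one ((hf.comp hV) hA), Measure.restrict_apply ((hf.comp hV) hA)] at h1
  rw [h1, ← lintegral_indicator ((hf.comp hV) hA)]
  refine lintegral_congr_ae ?_
  filter_upwards [hρ] with ω hω
  by_cases hm : ω ∈ f ∘ V ⁻¹' A <;> simp [hm, hω]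

theorem unique [IsFiniteMeasure μ] (h : IsPropensity μ E V ρ) (h' : IsPropensity μ E V ρ')
    (hρ : Measurable ρ) (hρ' : Measurable ρ') (hV : Measurable V) : ∀ᵐ ω ∂μ, ρ (V ω) = ρ' (V ω) := by
  have h1 : (μ.map V).withDensity ρ = (μ.map V).withDensity ρ' := h.symm.trans h'
  have := (withDensity_eq_iff_of_sigmaFinite hρ.aemeasurable hρ'.aemeasurable).1 h1
  exact ae_of_ae_map hV.aemeasurable this

theorem smul_iff {c : ℝ≥0∞} (hc : c ≠ 0) (hc' : c ≠ ∞) :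
    IsPropensity (c • μ) E V ρ ↔ IsPropensity μ E V ρ := by
  unfold IsPropensity
  rw [Measure.restrict_smul, Measure.map_smul, Measure.map_smul, withDensity_smul_measure]
  constructor
  · intro h
    have := congrArg (fun m => c⁻¹ • m) h
    simpa [smul_smul, ENNReal.inv_mul_cancel hc hc'] using this
  · intro h; rw [h]

theorem add (h : IsPropensity μ E V ρ) (h' : IsPropensity ν E V ρ) (hV : Measurable V) :
    IsPropensity (μ + ν) E V ρ := by
  unfold IsPropensity at *
  rw [Measure.restrict_add, Measure.map_add _ _ hV, Measure.map_add _ _ hV, h, h',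
    withDensity_add_measure]

theorem restrict_preimage (h : IsPropensity μ E V ρ) (hV : Measurable V) (hρ : Measurable ρ)
    {A : Set α} (hA : MeasurableSet A) : IsPropensity (μ.restrict (V ⁻¹' A)) E V ρ := by
  refine of_measure hV hρ fun B hB => ?_
  have h1 := h.lintegral hV hρ (f := (B ∩ A).indicator 1) (measurable_one.indicator (hB.inter hA))
  have e1 : ∀ ω, (B ∩ A).indicator (1 : α → ℝ≥0∞) (V ω) = (V ⁻¹' (B ∩ A)).indicator 1 ω :=
    fun ω => rfl
  simp_rw [e1] at h1
  rw [lintegral_indicator_one (hV (hB.inter hA)), Measure.restrict_apply (hV (hB.inter hA))] at h1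
  rw [Measure.restrict_apply' (hV hA), Measure.restrict_restrict (hV hB), ← Set.preimage_inter,
    Set.inter_right_comm, ← Set.preimage_inter, h1, ← lintegral_indicator (hV (hB.inter hA))]
  refine lintegral_congr fun ω => ?_
  by_cases hm : ω ∈ V ⁻¹' (B ∩ A)
  · rw [Set.indicator_of_mem hm, Set.indicator_of_mem hm, Pi.one_apply, mul_one]
  · rw [Set.indicator_of_notMem hm, Set.indicator_of_notMem hm, mul_zero]

/-- The multiplication rule for conditional probabilities: restricting to `E` multiplies the law of
`V` by ρ, and then to `F` by ρ'. -/
theorem chain (h : IsPropensity μ E V ρ) (h' : IsPropensity (μ.restrict E) F V ρ')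
    (hF : MeasurableSet F) (hρ : Measurable ρ) (hρ' : Measurable ρ') :
    IsPropensity μ (E ∩ F) V fun v => ρ v * ρ' v := by
  unfold IsPropensity at *
  rw [Set.inter_comm, ← Measure.restrict_restrict hF, h', h, ← withDensity_mul _ hρ hρ']
  rfl

theorem of_chain (h : IsPropensity μ E V ρ)
    (h' : IsPropensity μ (E ∩ F) V fun v => ρ v * ρ' v)
    (hF : MeasurableSet F) (hρ : Measurable ρ) (hρ' : Measurable ρ') :
    IsPropensity (μ.restrict E) F V ρ' := by
  unfold IsPropensity at *
  rw [Measure.restrict_restrict hF, Set.inter_comm, h', h, ← withDensity_mul _ hρ hρ']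
  rfl

theorem of_condDistrib [IsFiniteMeasure μ] {f : Ω → Bool} (hf : Measurable f) (hV : Measurable V)
    (b : Bool) : IsPropensity μ (f ⁻¹' {b}) V fun v => condDistrib f V μ v {b} :=
  of_measure hV (measurable_condDistrib_apply b) fun _ hA =>
    (setLIntegral_preimage_condDistrib hV hf.aemeasurable (measurableSet_singleton b) hA).symm
where
  measurable_condDistrib_apply (b : Bool) : Measurable fun v => condDistrib f V μ v {b} :=
    Kernel.measurable_coe _ (measurableSet_singleton b)

/-- Conditional independence means that adding `W` to the conditioning variables does not change the
conditional law of `f`. -/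
theorem of_condIndepFun [StandardBorelSpace Ω] [StandardBorelSpace β] [Nonempty β]
    [IsFiniteMeasure μ] {f : Ω → Bool} {W : Ω → β} (hf : Measurable f) (hV : Measurable V)
    (hW : Measurable W)
    (h : CondIndepFun (MeasurableSpace.comap V inferInstance) hV.comap_le f W μ) (b : Bool) :
    IsPropensity μ (f ⁻¹' {b}) (fun ω => (V ω, W ω)) fun v => condDistrib f V μ v.1 {b} := by
  have h1 := (condIndepFun_iff_condDistrib_prod_ae_eq_prodMkRight hf hW hV).1 h.symm
  refine (of_condDistrib hf (hV.prodMk hW) b).congr ?_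
  filter_upwards [h1] with v hv
  rw [hv]; rfl

/-- A binary variable has its conditional law determined by the probability of `true`. If that
probability given (V, W) depends on V only, averaging identifies it with the probability given V. -/
theorem condIndepFun [StandardBorelSpace Ω] [StandardBorelSpace β] [Nonempty β]
    [IsFiniteMeasure μ] {f : Ω → Bool} {W : Ω → β} (hf : Measurable f) (hV : Measurable V)
    (hW : Measurable W) (hρ : Measurable ρ)
    (h : IsPropensity μ (f ⁻¹' {true}) (fun ω => (V ω, W ω)) fun v => ρ v.1) :
    CondIndepFun (MeasurableSpace.comap V inferInstance) hV.comap_le f W μ := by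
  refine CondIndepFun.symm ?_
  refine (condIndepFun_iff_condDistrib_prod_ae_eq_prodMkRight hf hW hV).2 ?_
  have hVW := hV.prodMk hW
  have m0 : Measurable fun v => condDistrib f V μ v {true} :=
    Kernel.measurable_coe _ (measurableSet_singleton true)
  have m1 : Measurable fun v => condDistrib f (fun ω => (V ω, W ω)) μ v {true} :=
    Kernel.measurable_coe _ (measurableSet_singleton true)
  have h1 := (of_condDistrib hf hVW true).unique h m1 (hρ.comp measurable_fst) hVW
  have h2 := (h.comp hVW measurable_fst (fun _ => rfl) hρ (ae_of_all _ fun _ => rfl)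
    (hρ.comp measurable_fst)).unique (of_condDistrib hf hV true) hρ m0 hV
  have h3 : ∀ᵐ v ∂μ.map (fun ω => (V ω, W ω)),
      condDistrib f (fun ω => (V ω, W ω)) μ v {true} = condDistrib f V μ v.1 {true} := by
    refine (ae_map_iff hVW.aemeasurable (measurableSet_eq_fun m1 (m0.comp measurable_fst))).2 ?_
    filter_upwards [h1, h2] with ω a b
    exact a.trans b
  filter_upwards [h3] with v hv
  refine Measure.ext_of_singleton fun b => ?_
  have hc : ({false} : Set Bool) = {true}ᶜ := by ext b; cases b <;> simp
  cases b with
  | true => exact hv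
  | false =>
    rw [hc, prob_compl_eq_one_sub (measurableSet_singleton _),
      prob_compl_eq_one_sub (measurableSet_singleton _), hv]
    rfl

end IsPropensity

end Propensity

/-! ### Identification -/

section Identification

open scoped ENNReal

variable {𝒳 𝒮 : Type*} [MeasurableSpace 𝒳] [MeasurableSpace 𝒮]

theorem measurable_R : Measurable (R : Subject 𝒳 𝒮 → Bool) := by
  unfold R; fun_prop

theorem measurable_Ypot (t : Bool) : Measurable (Ypot t : Subject 𝒳 𝒮 → ℝ) := by
  unfold Ypot; fun_prop

/-- Covariates, surrogate and outcome of one arm. -/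
def armData (t : Bool) (ω : Subject 𝒳 𝒮) : 𝒳 × 𝒮 × ℝ := (X ω, Spot t ω, Ypot t ω)

theorem measurable_armData (t : Bool) : Measurable (armData t : Subject 𝒳 𝒮 → _) :=
  measurable_X.prodMk ((measurable_Spot t).prodMk (measurable_Ypot t))

theorem measurableSet_arm (t : Bool) : MeasurableSet (T ⁻¹' {t} : Set (Subject 𝒳 𝒮)) :=
  measurable_T (measurableSet_singleton t)

theorem measurableSet_labelled (t : Bool) : MeasurableSet (labelled t : Set (Subject 𝒳 𝒮)) :=
  (measurableSet_arm t).inter (measurable_R (measurableSet_singleton true))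

/-- Treatment probabilities `π t x` and labelling probabilities `η t x` bounded below by `ε`. -/
structure IsWeights {𝒳 : Type*} [MeasurableSpace 𝒳] (ε : ℝ) (π η : Bool → 𝒳 → ℝ) : Prop where
  measurable_treat : ∀ t, Measurable (π t)
  measurable_label : ∀ t, Measurable (η t)
  treat_mem : ∀ t x, π t x ∈ Set.Icc ε 1
  label_mem : ∀ t x, η t x ∈ Set.Icc ε 1
  treat_add : ∀ x, π true x + π false x = 1

/-- Within each arm `t`, treatment has probability `π t x` and labelling has probability `η t x`
given covariates, surrogate and outcome. -/
structure IsRandomized (ε : ℝ) (Q : Measure (Subject 𝒳 𝒮)) (π η : Bool → 𝒳 → ℝ) : Prop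
    extends IsWeights ε π η where
  treat : ∀ t, IsPropensity Q (T ⁻¹' {t}) (armData t) fun z => ENNReal.ofReal (π t z.1)
  label : ∀ t, IsPropensity Q (labelled t) (armData t)
    fun z => ENNReal.ofReal (π t z.1 * η t z.1)

theorem cond_eq_smul (Q : Measure (Subject 𝒳 𝒮)) (E : Set (Subject 𝒳 𝒮)) :
    Q[|E] = (Q E)⁻¹ • Q.restrict E := rfl

theorem isPropensity_cond {Q : Measure (Subject 𝒳 𝒮)} [IsFiniteMeasure Q] {α : Type*}
    [MeasurableSpace α] {E F : Set (Subject 𝒳 𝒮)} {V : Subject 𝒳 𝒮 → α} {ρ : α → ℝ≥0∞}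
    (hE : Q E ≠ 0) : IsPropensity (Q[|E]) F V ρ ↔ IsPropensity (Q.restrict E) F V ρ := by
  rw [cond_eq_smul]
  exact IsPropensity.smul_iff (ENNReal.inv_ne_zero.2 (measure_ne_top Q E)) (ENNReal.inv_ne_top.2 hE)

theorem ae_cond_iff {Q : Measure (Subject 𝒳 𝒮)} [IsFiniteMeasure Q]
    {E : Set (Subject 𝒳 𝒮)} {p : Subject 𝒳 𝒮 → Prop} :
    (∀ᵐ ω ∂Q[|E], p ω) ↔ ∀ᵐ ω ∂Q.restrict E, p ω := by
  rw [cond_eq_smul, Measure.ae_ennreal_smul_measure_iff (ENNReal.inv_ne_zero.2 (measure_ne_top Q E))]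

/-- With positive propensity the law of `V` on `E` and its law on the whole space have the same null
sets. This carries facts known only inside one arm over to the population. -/
theorem IsPropensity.ae_of_ae_restrict {Ω α : Type*} [MeasurableSpace Ω] [MeasurableSpace α]
    {μ : Measure Ω} {E : Set Ω} {V : Ω → α} {ρ : α → ℝ≥0∞}
    (h : IsPropensity μ E V ρ) (hV : Measurable V) (hρ : Measurable ρ)
    (hpos : ∀ᵐ ω ∂μ, ρ (V ω) ≠ 0) {p : α → Prop} (hp : MeasurableSet {v | p v})
    (hae : ∀ᵐ ω ∂μ.restrict E, p (V ω)) : ∀ᵐ ω ∂μ, p (V ω) := by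
  have h1 : ∀ᵐ v ∂(μ.restrict E).map V, p v := (ae_map_iff hV.aemeasurable hp).2 hae
  have h2 : ∀ᵐ v ∂(μ.map V).withDensity ρ, p v := by
    have h' : (μ.restrict E).map V = (μ.map V).withDensity ρ := h
    rw [← h']; exact h1
  rw [ae_withDensity_iff hρ, ae_map_iff hV.aemeasurable] at h2
  · filter_upwards [h2, hpos] with ω a b using a b
  · exact ((measurableSet_eq_fun hρ measurable_const).compl.compl.union hp).congr (by
      ext v; simp only [Set.mem_union, Set.mem_compl_iff, Set.mem_ofPred_eq]; tauto)

theorem e_add_condDistrib_false (Q : Measure (Subject 𝒳 𝒮)) [IsFiniteMeasure Q] (x : 𝒳) :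
    (condDistrib T X Q x).real {false} = 1 - e Q x := by
  have hc : ({false} : Set Bool) = {true}ᶜ := by ext b; cases b <;> simp
  rw [hc, probReal_compl_eq_one_sub (measurableSet_singleton _)]; rfl

theorem e_nonneg (Q : Measure (Subject 𝒳 𝒮)) [IsFiniteMeasure Q] (x : 𝒳) : 0 ≤ e Q x :=
  measureReal_nonneg

theorem rS_nonneg (Q : Measure (Subject 𝒳 𝒮)) [IsFiniteMeasure Q] (t : Bool) (x : 𝒳) (s : 𝒮) :
    0 ≤ rS Q t x s :=
  measureReal_nonneg

theorem S_eq_Spot_ae {Q : Measure (Subject 𝒳 𝒮)} (t : Bool) :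
    ∀ᵐ ω ∂Q.restrict (T ⁻¹' {t}), S ω = Spot t ω := by
  filter_upwards [ae_restrict_mem (measurableSet_arm t)] with ω hω
  have : T ω = t := hω
  simp [S, this]

variable [StandardBorelSpace 𝒳] [StandardBorelSpace 𝒮]

/-- Treatment probabilities come from (i). Inside arm t, (ii) gives labelling probability `rS` given
(X, S(t), Y(t)), while by (iii) the probability given (X, S(t)) is a function of X, necessarily `r`;
hence `rS` = `r` almost surely, and the multiplication rule yields the probability of being in the
arm and labelled. Truncation turns the almost sure overlap bounds into bounds at every point, so
that inverse weights are bounded without exceptional sets. -/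
theorem Assumptions.exists_isRandomized {ε : ℝ} (hε : 0 < ε) (hε' : ε < 1 / 2)
    {Q : Measure (Subject 𝒳 𝒮)} [IsProbabilityMeasure Q] (h : Assumptions ε Q) :
    ∃ π η : Bool → 𝒳 → ℝ, IsRandomized ε Q π η ∧
      (∀ᵐ ω ∂Q, e Q (X ω) = π true (X ω) ∧ 1 - e Q (X ω) = π false (X ω)) ∧
      ∀ t, ∀ᵐ ω ∂Q, r Q t (X ω) = η t (X ω) := by
  have hne : Nonempty (Subject 𝒳 𝒮) := (inferInstance : NeZero Q).1 |> fun h0 => by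
    by_contra hc
    rw [not_nonempty_iff] at hc
    exact h0 (Measure.eq_zero_of_isEmpty Q)
  have : Nonempty 𝒮 := ⟨S hne.some⟩
  let π₀ : Bool → 𝒳 → ℝ := fun t x => (condDistrib T X Q x).real {t}
  -- The interval [ε, 1 − ε] is symmetric about 1/2, so truncating to it keeps the probabilities of
  -- the two arms summing to one at every point.
  let clampT : ℝ → ℝ := fun a => max ε (min (1 - ε) a)
  have mclampT : Measurable clampT := measurable_const.max (measurable_const.min measurable_id)
  have clampT_mem : ∀ a, clampT a ∈ Set.Icc ε 1 := fun a =>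
    ⟨le_max_left _ _, max_le (by linarith) ((min_le_left _ _).trans (by linarith))⟩
  have clampT_id : ∀ a, ε ≤ a → a ≤ 1 - ε → clampT a = a := fun a h1 h2 => by
    simp [clampT, h1, h2]
  have clampT_add : ∀ a, clampT a + clampT (1 - a) = 1 := fun a => by
    simp only [clampT, max_def, min_def]
    split_ifs <;> linarith
  let clamp : ℝ → ℝ := fun a => max ε (min 1 a)
  have mclamp : Measurable clamp := measurable_const.max (measurable_const.min measurable_id)
  have clamp_mem : ∀ a, clamp a ∈ Set.Icc ε 1 := fun a =>
    ⟨le_max_left _ _, max_le (by linarith) (min_le_left _ _)⟩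
  have clamp_id : ∀ a, ε ≤ a → a ≤ 1 → clamp a = a := fun a h1 h2 => by
    simp [clamp, h1, h2]
  have mπ₀ : ∀ t, Measurable (π₀ t) := fun t =>
    (Kernel.measurable_coe _ (measurableSet_singleton t)).ennreal_toReal
  have hπ₀ : ∀ t, ∀ᵐ ω ∂Q, ε ≤ π₀ t (X ω) ∧ π₀ t (X ω) ≤ 1 - ε := by
    intro t
    filter_upwards [h.overlap_treatment] with ω hω
    cases t with
    | true => exact hω
    | false =>
      change ε ≤ (condDistrib T X Q (X ω)).real {false} ∧
        (condDistrib T X Q (X ω)).real {false} ≤ 1 - ε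
      rw [e_add_condDistrib_false]
      exact ⟨by linarith [hω.2], by linarith [hω.1]⟩
  have mX1 : Measurable fun z : 𝒳 × 𝒮 × ℝ => z.1 := measurable_fst
  have htreat₀ : ∀ t, IsPropensity Q (T ⁻¹' {t}) (armData t) fun z => ENNReal.ofReal (π₀ t z.1) := by
    intro t
    have h1 := IsPropensity.of_condIndepFun measurable_T measurable_X
      ((measurable_Ypot t).prodMk (measurable_Spot t)) (h.unconfounded_treatment t).symm t
    refine h1.comp (measurable_X.prodMk ((measurable_Ypot t).prodMk (measurable_Spot t)))
      (f := fun v => (v.1, v.2.2, v.2.1)) (by fun_prop) (fun _ => rfl)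
      ((mπ₀ t).comp mX1).ennreal_ofReal (ae_of_all _ fun ω => ?_)
      ((Kernel.measurable_coe _ (measurableSet_singleton t)).comp measurable_fst)
    exact (ofReal_measureReal (measure_ne_top _ _)).symm
  have hpos : ∀ t, Q (T ⁻¹' {t} : Set (Subject 𝒳 𝒮)) ≠ 0 := by
    intro t h0
    have h1 := (htreat₀ t).lintegral (measurable_armData t) ((mπ₀ t).comp mX1).ennreal_ofReal
      (f := fun _ => 1) measurable_const
    simp only [lintegral_const, Measure.restrict_apply MeasurableSet.univ, Set.univ_inter, h0,
      mul_zero, mul_one] at h1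
    have h2 := (lintegral_eq_zero_iff
      (((mπ₀ t).comp mX1).ennreal_ofReal.comp (measurable_armData t))).1 h1.symm
    have h3 : ∀ᵐ _ ∂Q, False := by
      filter_upwards [h2, hπ₀ t] with ω a b
      have : ENNReal.ofReal (π₀ t (X ω)) = 0 := a
      rw [ENNReal.ofReal_eq_zero] at this
      linarith [b.1]
    simp only [eventually_false_iff_eq_bot, ae_eq_bot] at h3
    exact IsProbabilityMeasure.ne_zero Q h3
  have mXS : ∀ t, Measurable fun ω : Subject 𝒳 𝒮 => (X ω, Spot t ω) := fun t =>
    measurable_X.prodMk (measurable_Spot t)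
  have mr : ∀ t, Measurable (r Q t) := fun t =>
    (Kernel.measurable_coe _ (measurableSet_singleton true)).ennreal_toReal
  have mrS : ∀ t, Measurable fun v : 𝒳 × 𝒮 => rS Q t v.1 v.2 := fun t =>
    (Kernel.measurable_coe _ (measurableSet_singleton true)).ennreal_toReal
  have hr : ∀ t, IsPropensity (Q[|T ⁻¹' {t}]) (R ⁻¹' {true}) X fun x => ENNReal.ofReal (r Q t x) := by
    intro t
    refine (IsPropensity.of_condDistrib measurable_R measurable_X true).congr
      (ae_of_all _ fun x => ?_)
    exact (ofReal_measureReal (measure_ne_top _ _)).symm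
  have hrS : ∀ t, IsPropensity (Q[|T ⁻¹' {t}]) (R ⁻¹' {true})
      (fun ω => ((X ω, Spot t ω), Ypot t ω)) fun v => ENNReal.ofReal (rS Q t v.1.1 v.1.2) := by
    intro t
    have h1 := IsPropensity.of_condIndepFun measurable_R (mXS t) (measurable_Ypot t)
      (h.unconfounded_labelling t) true
    have h2 : (fun ω => (X ω, Spot t ω)) =ᵐ[Q[|T ⁻¹' {t}]] fun ω => (X ω, S ω) := by
      refine ae_cond_iff.2 ?_
      filter_upwards [S_eq_Spot_ae t] with ω hω using by rw [hω]
    rw [condDistrib_congr_right h2] at h1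
    refine h1.congr (ae_of_all _ fun v => ?_)
    exact (ofReal_measureReal (measure_ne_top _ _)).symm
  -- Assumption (iii) conditions on (T, X) in the whole population. Restricting to T = t freezes the
  -- first coordinate, and coarsening to X identifies the remaining function of x with `r`.
  have hrX : ∀ t, IsPropensity (Q[|T ⁻¹' {t}]) (R ⁻¹' {true})
      (fun ω => (X ω, Spot t ω)) fun v => ENNReal.ofReal (r Q t v.1) := by
    intro t
    have mTX := (measurable_T (𝒳 := 𝒳) (𝒮 := 𝒮)).prodMk measurable_X
    let ρ : Bool × 𝒳 → ℝ≥0∞ := fun v => condDistrib R (fun ω => (T ω, X ω)) Q v {true}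
    have mρ : Measurable ρ := Kernel.measurable_coe _ (measurableSet_singleton true)
    have h1 : IsPropensity Q (R ⁻¹' {true}) (fun ω => ((T ω, X ω), Spot t ω)) fun v => ρ v.1 :=
      IsPropensity.of_condIndepFun measurable_R mTX (measurable_Spot t)
        (h.labelling_surrogate t) true
    have h2 := h1.restrict_preimage (mTX.prodMk (measurable_Spot t)) (mρ.comp measurable_fst)
      (A := {v | v.1.1 = t})
      (measurableSet_eq_fun (measurable_fst.comp measurable_fst) measurable_const)
    have h3 : IsPropensity (Q[|T ⁻¹' {t}]) (R ⁻¹' {true})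
        (fun ω => (X ω, Spot t ω)) fun v => ρ (t, v.1) := by
      refine (isPropensity_cond (hpos t)).2 ?_
      refine h2.comp (mTX.prodMk (measurable_Spot t)) (f := fun v => (v.1.2, v.2)) (by fun_prop)
        (fun _ => rfl) (by fun_prop) ?_ (mρ.comp measurable_fst)
      filter_upwards [ae_restrict_mem (measurableSet_arm t)] with ω hω
      have : T ω = t := hω
      simp [this]
    have h4 : IsPropensity (Q[|T ⁻¹' {t}]) (R ⁻¹' {true}) X fun x => ρ (t, x) :=
      h3.comp (mXS t) measurable_fst (fun _ => rfl) (by fun_prop) (ae_of_all _ fun _ => rfl)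
        (by fun_prop)
    have h5 := h4.unique (hr t) (by fun_prop) (mr t).ennreal_ofReal measurable_X
    refine h3.congr ?_
    refine (ae_map_iff (mXS t).aemeasurable (measurableSet_eq_fun (by fun_prop)
      ((mr t).comp measurable_fst).ennreal_ofReal)).2 h5
  -- After forgetting Y(t), both `rS` and `r` are versions of the labelling probability given (X,
  -- S(t)) in arm t.
  have hrSr : ∀ t, ∀ᵐ ω ∂Q[|T ⁻¹' {t}], rS Q t (X ω) (Spot t ω) = r Q t (X ω) := by
    intro t
    have h1 := (hrS t).comp ((mXS t).prodMk (measurable_Ypot t)) measurable_fst (fun _ => rfl)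
      (mrS t).ennreal_ofReal (ae_of_all _ fun _ => rfl) ((mrS t).comp measurable_fst).ennreal_ofReal
    filter_upwards [h1.unique (hrX t) (mrS t).ennreal_ofReal
      ((mr t).comp measurable_fst).ennreal_ofReal (mXS t)] with ω hω
    have h2 := congrArg ENNReal.toReal hω
    rwa [ENNReal.toReal_ofReal, ENNReal.toReal_ofReal] at h2 <;> exact measureReal_nonneg
  have hlab₀ : ∀ t, IsPropensity (Q.restrict (T ⁻¹' {t})) (R ⁻¹' {true}) (armData t)
      fun z => ENNReal.ofReal (r Q t z.1) := by
    intro t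
    refine (isPropensity_cond (hpos t)).1 ?_
    refine (hrS t).comp ((mXS t).prodMk (measurable_Ypot t)) (f := fun v => (v.1.1, v.1.2, v.2))
      (by fun_prop) (fun _ => rfl) ((mr t).comp mX1).ennreal_ofReal ?_
      ((mrS t).comp measurable_fst).ennreal_ofReal
    filter_upwards [hrSr t] with ω hω
    simp only [hω]
  -- The equality of `rS` and `r` holds only on arm t. The bound obtained there for `r` extends to
  -- everybody because treatment t has positive probability given the covariates.
  have hr_mem : ∀ t, ∀ᵐ ω ∂Q, ε ≤ r Q t (X ω) ∧ r Q t (X ω) ≤ 1 := by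
    intro t
    refine (htreat₀ t).ae_of_ae_restrict (measurable_armData t) ((mπ₀ t).comp mX1).ennreal_ofReal
      (p := fun z => ε ≤ r Q t z.1 ∧ r Q t z.1 ≤ 1) ?_ ?_ ?_
    · filter_upwards [hπ₀ t] with ω hω
      have : 0 < π₀ t (X ω) := by linarith [hω.1]
      simpa [armData] using this
    · exact (measurableSet_le measurable_const ((mr t).comp mX1)).inter
        (measurableSet_le ((mr t).comp mX1) measurable_const)
    · filter_upwards [ae_cond_iff.1 (hrSr t), ae_restrict_of_ae (h.overlap_labelling t)]
        with ω a b
      rw [a] at b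
      exact b
  refine ⟨fun t x => clampT (π₀ t x), fun t x => clamp (r Q t x), ?_, ?_, ?_⟩
  · have hcong : ∀ t, ∀ᵐ z ∂Q.map (armData t),
        clampT (π₀ t z.1) = π₀ t z.1 ∧ clamp (r Q t z.1) = r Q t z.1 := by
      intro t
      refine (ae_map_iff (measurable_armData t).aemeasurable ?_).2 ?_
      · exact (measurableSet_eq_fun (mclampT.comp ((mπ₀ t).comp mX1)) ((mπ₀ t).comp mX1)).inter
          (measurableSet_eq_fun (mclamp.comp ((mr t).comp mX1)) ((mr t).comp mX1))
      · filter_upwards [hπ₀ t, hr_mem t] with ω a b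
        exact ⟨clampT_id _ a.1 a.2, clamp_id _ b.1 b.2⟩
    refine ⟨⟨fun t => mclampT.comp (mπ₀ t), fun t => mclamp.comp (mr t), fun t x => clampT_mem _,
      fun t x => clamp_mem _, fun x => ?_⟩, fun t => ?_, fun t => ?_⟩
    · rw [← clampT_add (π₀ true x)]
      congr 2
      exact e_add_condDistrib_false Q x
    · refine (htreat₀ t).congr ?_
      filter_upwards [hcong t] with z hz
      rw [hz.1]
    · refine ((htreat₀ t).chain (hlab₀ t) (measurable_R (measurableSet_singleton true))
        ((mπ₀ t).comp mX1).ennreal_ofReal ((mr t).comp mX1).ennreal_ofReal).congr ?_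
      filter_upwards [hcong t] with z hz
      rw [hz.1, hz.2, ENNReal.ofReal_mul measureReal_nonneg]
  · filter_upwards [hπ₀ true, hπ₀ false] with ω a b
    rw [clampT_id _ a.1 a.2, clampT_id _ b.1 b.2]
    exact ⟨rfl, (e_add_condDistrib_false Q (X ω)).symm⟩
  · intro t
    filter_upwards [hr_mem t] with ω a
    rw [clamp_id _ a.1 a.2]

end Identification

/-! ### Laws with treatment and labelling driven by covariates belong to the model -/

section Membership

open scoped ENNReal

variable {𝒳 𝒮 : Type*} [MeasurableSpace 𝒳] [MeasurableSpace 𝒮]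

/-- Covariates and all potential variables. -/
def potData (ω : Subject 𝒳 𝒮) : 𝒳 × (Bool → 𝒮) × (Bool → ℝ) := (X ω, ω.2.2.2.1, ω.2.2.2.2)

theorem measurable_potData : Measurable (potData : Subject 𝒳 𝒮 → _) := by
  unfold potData X; fun_prop

/-- One arm of the potential data. -/
def armOf (t : Bool) (u : 𝒳 × (Bool → 𝒮) × (Bool → ℝ)) : 𝒳 × 𝒮 × ℝ := (u.1, u.2.1 t, u.2.2 t)

theorem measurable_armOf (t : Bool) :
    Measurable (armOf t : 𝒳 × (Bool → 𝒮) × (Bool → ℝ) → 𝒳 × 𝒮 × ℝ) := by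
  unfold armOf; fun_prop

variable [StandardBorelSpace 𝒳] [StandardBorelSpace 𝒮]

/-- All the conditional independences follow from a single stronger one: given every potential
variable, treatment and labelling depend on the covariates only. This is the test by which the
perturbed laws are recognised as members of the model. -/
theorem Assumptions.of_isPropensity {ε : ℝ} (hε : 0 < ε) {Q : Measure (Subject 𝒳 𝒮)}
    [IsProbabilityMeasure Q] {π η : Bool → 𝒳 → ℝ}
    (mπ : ∀ t, Measurable (π t)) (mη : ∀ t, Measurable (η t))
    (hπ : ∀ t x, ε ≤ π t x) (hsum : ∀ x, π true x + π false x = 1)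
    (hη : ∀ t x, η t x ∈ Set.Icc ε 1)
    (htreat : ∀ t, IsPropensity Q (T ⁻¹' {t}) potData fun u => ENNReal.ofReal (π t u.1))
    (hlabel : ∀ t, IsPropensity Q (labelled t) potData
      fun u => ENNReal.ofReal (π t u.1 * η t u.1))
    (hY : ∀ t, MemLp (Ypot t) 2 Q) : Assumptions ε Q := by
  have hne : Nonempty (Subject 𝒳 𝒮) := by
    by_contra hc
    rw [not_nonempty_iff] at hc
    exact IsProbabilityMeasure.ne_zero Q (Measure.eq_zero_of_isEmpty Q)
  have : Nonempty 𝒮 := ⟨S hne.some⟩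
  have mπ1 : ∀ t, Measurable fun u : 𝒳 × (Bool → 𝒮) × (Bool → ℝ) => ENNReal.ofReal (π t u.1) :=
    fun t => ((mπ t).comp measurable_fst).ennreal_ofReal
  have mη1 : ∀ t, Measurable fun u : 𝒳 × (Bool → 𝒮) × (Bool → ℝ) => ENNReal.ofReal (η t u.1) :=
    fun t => ((mη t).comp measurable_fst).ennreal_ofReal
  have hwithin : ∀ t, IsPropensity (Q.restrict (T ⁻¹' {t})) (R ⁻¹' {true}) potData
      fun u => ENNReal.ofReal (η t u.1) := by
    intro t
    refine (htreat t).of_chain ((hlabel t).congr (ae_of_all _ fun u => ?_))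
      (measurable_R (measurableSet_singleton true)) (mπ1 t) (mη1 t)
    exact ENNReal.ofReal_mul (hε.le.trans (hπ _ _))
  have hπpos : ∀ t, ∀ᵐ ω ∂Q, ENNReal.ofReal (π t (potData ω).1) ≠ 0 := by
    intro t
    refine ae_of_all _ fun ω => ?_
    have : 0 < π t (potData ω).1 := hε.trans_le (hπ _ _)
    simpa using this
  have hpos : ∀ t, Q (T ⁻¹' {t} : Set (Subject 𝒳 𝒮)) ≠ 0 := by
    intro t h0
    have h1 := (htreat t).ae_of_ae_restrict measurable_potData (mπ1 t) (hπpos t)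
      (p := fun _ => False) MeasurableSet.empty
      (by rw [Measure.restrict_eq_zero.2 h0]; simp)
    simp only [eventually_false_iff_eq_bot, ae_eq_bot] at h1
    exact IsProbabilityMeasure.ne_zero Q h1
  have mXS : ∀ t, Measurable fun ω : Subject 𝒳 𝒮 => (X ω, Spot t ω) := fun t =>
    measurable_X.prodMk (measurable_Spot t)
  have me : Measurable (e Q) :=
    (Kernel.measurable_coe _ (measurableSet_singleton true)).ennreal_toReal
  have mrS : ∀ t, Measurable fun v : 𝒳 × 𝒮 => rS Q t v.1 v.2 := fun t =>
    (Kernel.measurable_coe _ (measurableSet_singleton true)).ennreal_toReal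
  constructor
  · intro t
    refine CondIndepFun.symm (IsPropensity.condIndepFun measurable_T measurable_X
      ((measurable_Ypot t).prodMk (measurable_Spot t)) (ρ := fun x => ENNReal.ofReal (π true x))
      (mπ true).ennreal_ofReal ?_)
    exact (htreat true).comp measurable_potData (f := fun u => (u.1, u.2.2 t, u.2.1 t))
      (by fun_prop) (fun _ => rfl) ((mπ true).comp measurable_fst).ennreal_ofReal
      (ae_of_all _ fun _ => rfl) (mπ1 true)
  · intro t
    refine IsPropensity.condIndepFun measurable_R (mXS t) (measurable_Ypot t)
      (ρ := fun v => ENNReal.ofReal (η t v.1)) ((mη t).comp measurable_fst).ennreal_ofReal ?_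
    refine (isPropensity_cond (hpos t)).2 ?_
    exact (hwithin t).comp measurable_potData (f := fun u => ((u.1, u.2.1 t), u.2.2 t))
      (by fun_prop) (fun _ => rfl)
      ((mη t).comp (measurable_fst.comp measurable_fst)).ennreal_ofReal
      (ae_of_all _ fun _ => rfl) (mη1 t)
  · intro t
    have mη2 : Measurable fun v : Bool × 𝒳 => ENNReal.ofReal (η v.1 v.2) :=
      measurable_from_prod_countable_right fun t => (mη t).ennreal_ofReal
    refine IsPropensity.condIndepFun measurable_R (measurable_T.prodMk measurable_X)
      (measurable_Spot t) (ρ := fun v => ENNReal.ofReal (η v.1 v.2)) mη2 ?_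
    -- S(t) must be independent of labelling in both arms b, also for b ≠ t, which is why the
    -- propensities are given relative to all potential variables. Each arm is treated with T frozen
    -- at b, and the two are then added.
    have h1 : ∀ b, IsPropensity (Q.restrict (T ⁻¹' {b})) (R ⁻¹' {true})
        (fun ω => ((T ω, X ω), Spot t ω)) fun v => ENNReal.ofReal (η v.1.1 v.1.2) := by
      intro b
      have h2 : IsPropensity (Q.restrict (T ⁻¹' {b})) (R ⁻¹' {true})
          (fun ω => ((b, X ω), Spot t ω)) fun v => ENNReal.ofReal (η v.1.1 v.1.2) :=
        (hwithin b).comp measurable_potData (f := fun u => ((b, u.1), u.2.1 t)) (by fun_prop)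
          (fun _ => rfl) (mη2.comp measurable_fst) (ae_of_all _ fun _ => rfl) (mη1 b)
      have h3 : (fun ω : Subject 𝒳 𝒮 => ((b, X ω), Spot t ω)) =ᵐ[Q.restrict (T ⁻¹' {b})]
          fun ω => ((T ω, X ω), Spot t ω) := by
        filter_upwards [ae_restrict_mem (measurableSet_arm b)] with ω hω
        have : T ω = b := hω
        rw [this]
      unfold IsPropensity at h2 ⊢
      rwa [Measure.map_congr h3, Measure.map_congr (ae_restrict_of_ae h3)] at h2
    have h4 : Q = Q.restrict (T ⁻¹' {true}) + Q.restrict (T ⁻¹' {false}) := by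
      have hc : (T ⁻¹' {false} : Set (Subject 𝒳 𝒮)) = (T ⁻¹' {true})ᶜ := by
        ext ω; simp
      rw [hc, Measure.restrict_add_restrict_compl (measurableSet_arm true)]
    rw [h4]
    exact (h1 true).add (h1 false)
      ((measurable_T.prodMk measurable_X).prodMk (measurable_Spot t))
  · have h1 : IsPropensity Q (T ⁻¹' {true}) X fun x => ENNReal.ofReal (π true x) :=
      (htreat true).comp measurable_potData measurable_fst (fun _ => rfl)
        (mπ true).ennreal_ofReal (ae_of_all _ fun _ => rfl) (mπ1 true)
    have h2 : IsPropensity Q (T ⁻¹' {true}) X fun x => ENNReal.ofReal (e Q x) :=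
      (IsPropensity.of_condDistrib measurable_T measurable_X true).congr
        (ae_of_all _ fun x => (ofReal_measureReal (measure_ne_top _ _)).symm)
    filter_upwards [h2.unique h1 me.ennreal_ofReal (mπ true).ennreal_ofReal measurable_X]
      with ω hω
    have h3 := congrArg ENNReal.toReal hω
    rw [ENNReal.toReal_ofReal (e_nonneg Q (X ω)),
      ENNReal.toReal_ofReal (hε.le.trans (hπ _ _))] at h3
    rw [h3]
    exact ⟨hπ _ _, by linarith [hπ false (X ω), hsum (X ω)]⟩
  · intro t
    have h1 : IsPropensity (Q[|T ⁻¹' {t}]) (R ⁻¹' {true}) (fun ω => (X ω, Spot t ω))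
        fun v => ENNReal.ofReal (η t v.1) :=
      (isPropensity_cond (hpos t)).2 <| (hwithin t).comp measurable_potData
        (f := fun u => (u.1, u.2.1 t)) (by fun_prop) (fun _ => rfl)
        ((mη t).comp measurable_fst).ennreal_ofReal (ae_of_all _ fun _ => rfl) (mη1 t)
    have h2 : IsPropensity (Q[|T ⁻¹' {t}]) (R ⁻¹' {true}) (fun ω => (X ω, Spot t ω))
        fun v => ENNReal.ofReal (rS Q t v.1 v.2) := by
      have h3 : (fun ω => (X ω, Spot t ω)) =ᵐ[Q[|T ⁻¹' {t}]] fun ω => (X ω, S ω) := by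
        refine ae_cond_iff.2 ?_
        filter_upwards [S_eq_Spot_ae t] with ω hω using by rw [hω]
      refine (IsPropensity.of_condDistrib measurable_R (mXS t) true).congr
        (ae_of_all _ fun v => ?_)
      rw [condDistrib_congr_right h3]
      exact (ofReal_measureReal (measure_ne_top _ _)).symm
    have h3 : ∀ᵐ ω ∂Q.restrict (T ⁻¹' {t}), rS Q t (X ω) (Spot t ω) = η t (X ω) := by
      filter_upwards [ae_cond_iff.1 (h2.unique h1 (mrS t).ennreal_ofReal
        ((mη t).comp measurable_fst).ennreal_ofReal (mXS t))] with ω hω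
      have h4 := congrArg ENNReal.toReal hω
      rwa [ENNReal.toReal_ofReal (rS_nonneg Q t (X ω) (Spot t ω)),
        ENNReal.toReal_ofReal (hε.le.trans (hη _ _).1)] at h4
    have mrS' : Measurable fun u : 𝒳 × (Bool → 𝒮) × (Bool → ℝ) => rS Q t u.1 (u.2.1 t) :=
      (mrS t).comp (f := fun u : 𝒳 × (Bool → 𝒮) × (Bool → ℝ) => (u.1, u.2.1 t)) (by fun_prop)
    -- `rS` is determined by arm t alone, whereas overlap is asked of S(t) in the whole population;
    -- positivity of π bridges the two.
    have h4 := (htreat t).ae_of_ae_restrict measurable_potData (mπ1 t) (hπpos t)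
      (p := fun u => rS Q t u.1 (u.2.1 t) = η t u.1)
      (measurableSet_eq_fun mrS' ((mη t).comp measurable_fst)) h3
    filter_upwards [h4] with ω hω
    have h5 : rS Q t (X ω) (Spot t ω) = η t (X ω) := hω
    rw [h5]
    exact hη t _
  · exact hY

end Membership

/-! ### Differentiability along smooth submodels -/

section SmoothSubmodel

open scoped ENNReal

/-- L¹ convergence gives almost everywhere convergence along a further subsequence of any sequence,
and dominated convergence with |C f|² as the bound finishes. Uniform boundedness thus replaces L² or
uniform convergence of the factors `u i`. -/
theorem tendsto_eLpNorm_two_mul {O ι : Type*} [MeasurableSpace O] {ν : Measure O} {l : Filter ι}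
    [l.IsCountablyGenerated] {f : O → ℝ} (hf : MemLp f 2 ν) {u : ι → O → ℝ}
    (hu : ∀ i, Measurable (u i)) {C : ℝ} (hC : ∀ i o, |u i o| ≤ C)
    (h0 : Tendsto (fun i => eLpNorm (u i) 1 ν) l (𝓝 0)) :
    Tendsto (fun i => eLpNorm (fun o => u i o * f o) 2 ν) l (𝓝 0) := by
  have key : Tendsto (fun i => ∫⁻ o, ‖u i o * f o‖ₑ ^ (2 : ℝ) ∂ν) l (𝓝 0) := by
    refine tendsto_of_seq_tendsto fun x hx => ?_
    refine tendsto_of_subseq_tendsto fun ns hns => ?_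
    have h1 : TendstoInMeasure ν (fun n => u (x (ns n))) atTop (0 : O → ℝ) := by
      refine tendstoInMeasure_of_tendsto_eLpNorm one_ne_zero
        (fun n => (hu _).aestronglyMeasurable) aestronglyMeasurable_zero ?_
      simpa [Function.comp_def] using h0.comp (hx.comp hns)
    obtain ⟨ms, -, hms⟩ := h1.exists_seq_tendsto_ae
    refine ⟨ms, ?_⟩
    obtain ⟨f', hf', hff'⟩ := hf.1
    have e1 : ∀ n, ∫⁻ o, ‖u (x (ns (ms n))) o * f o‖ₑ ^ (2 : ℝ) ∂ν
        = ∫⁻ o, ‖u (x (ns (ms n))) o * f' o‖ₑ ^ (2 : ℝ) ∂ν := fun n =>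
      lintegral_congr_ae (by filter_upwards [hff'] with o ho; rw [ho])
    refine Tendsto.congr (fun n => (e1 n).symm) ?_
    have hf2 : MemLp f' 2 ν := hf.ae_eq hff'
    have := tendsto_lintegral_of_dominated_convergence (μ := ν)
      (F := fun n o => ‖u (x (ns (ms n))) o * f' o‖ₑ ^ (2 : ℝ)) (f := fun _ => 0)
      (fun o => ‖C * f' o‖ₑ ^ (2 : ℝ)) (fun n => ((hu _).mul hf'.measurable).enorm.pow_const _)
      (fun n => ae_of_all _ fun o => ?_) ?_ ?_
    · simpa using this
    · dsimp only
      gcongr ?_ ^ (2 : ℝ)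
      rw [enorm_mul, enorm_mul]
      gcongr
      rw [enorm_le_iff_norm_le, Real.norm_eq_abs, Real.norm_eq_abs]
      exact (hC _ _).trans (le_abs_self C)
    · have := (hf2.const_mul C).2
      rw [eLpNorm_lt_top_iff_lintegral_rpow_enorm_lt_top (by norm_num) (by norm_num)] at this
      simpa using this.ne
    · filter_upwards [hms] with o ho
      have h2 : Tendsto (fun n => u (x (ns (ms n))) o * f' o) atTop (𝓝 (0 * f' o)) :=
        ho.mul_const _
      rw [zero_mul] at h2
      have h3 : Tendsto (fun n => ‖u (x (ns (ms n))) o * f' o‖ₑ ^ (2 : ℝ)) atTop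
          (𝓝 (‖(0 : ℝ)‖ₑ ^ (2 : ℝ))) :=
        ((ENNReal.continuous_rpow_const (y := 2)).comp continuous_enorm).continuousAt.tendsto.comp h2
      simpa using h3
  have h4 : ∀ i, eLpNorm (fun o => u i o * f o) 2 ν
      = (∫⁻ o, ‖u i o * f o‖ₑ ^ (2 : ℝ) ∂ν) ^ (1 / 2 : ℝ) := fun i => by
    rw [eLpNorm_eq_lintegral_rpow_enorm_toReal (by norm_num) (by norm_num)]
    simp
  simp_rw [h4]
  have h5 := ((ENNReal.continuous_rpow_const (y := 1 / 2)).tendsto 0).comp key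
  simpa [Function.comp_def] using h5

variable {Ω O : Type*} [MeasurableSpace Ω] [MeasurableSpace O] {𝓜 : Set (ProbabilityMeasure Ω)}
  {obs : Ω → O} {P : ProbabilityMeasure Ω} {Q : ℝ → ProbabilityMeasure Ω}
  {g : Lp ℝ 2 ((P : Measure Ω).map obs)}

/-- The law of the observed data. -/
abbrev obsLaw (obs : Ω → O) (P : ProbabilityMeasure Ω) : Measure O := (P : Measure Ω).map obs

/-- Likelihood ratio of the observed laws. -/
def ratio (obs : Ω → O) (P Q : ProbabilityMeasure Ω) (w : O) : ℝ :=
  (((Q : Measure Ω).map obs).rnDeriv ((P : Measure Ω).map obs) w).toReal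

theorem measurable_ratio (P Q : ProbabilityMeasure Ω) : Measurable (ratio obs P Q) :=
  (Measure.measurable_rnDeriv _ _).ennreal_toReal

namespace IsSmoothSubmodel

/-- The deviation p_γ − 1 is γ times a difference quotient whose L² distance to g tends to zero, so
its norm is of order γ. -/
theorem tendsto_ratio (h : IsSmoothSubmodel 𝓜 obs P Q g) :
    Tendsto (fun γ => eLpNorm (fun w => ratio obs P (Q γ) w - 1) 2 (obsLaw obs P))
      (𝓝[≠] 0) (𝓝 0) := by
  have h1 : Tendsto (fun γ : ℝ => ‖γ‖ₑ * (eLpNorm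
      (fun w => (ratio obs P (Q γ) w - 1) / γ - g w) 2 (obsLaw obs P) + eLpNorm g 2 (obsLaw obs P))) (𝓝[≠] 0) (𝓝 0) := by
    have h2 : Tendsto (fun γ : ℝ => eLpNorm
        (fun w => (ratio obs P (Q γ) w - 1) / γ - g w) 2 (obsLaw obs P) + eLpNorm g 2 (obsLaw obs P)) (𝓝[≠] 0)
        (𝓝 (0 + eLpNorm g 2 (obsLaw obs P))) := Tendsto.add h.score tendsto_const_nhds
    have h3 : Tendsto (fun γ : ℝ => ‖γ‖ₑ) (𝓝[≠] 0) (𝓝 0) := by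
      have := (continuous_enorm (E := ℝ)).tendsto 0
      simp only [enorm_zero] at this
      exact this.mono_left nhdsWithin_le_nhds
    have h4 := ENNReal.Tendsto.mul h3 (Or.inr (by simpa using (Lp.memLp g).2.ne)) h2
      (Or.inr ENNReal.zero_ne_top)
    simpa using h4
  refine tendsto_of_tendsto_of_tendsto_of_le_of_le' tendsto_const_nhds h1
    (Eventually.of_forall fun _ => zero_le) ?_
  filter_upwards [self_mem_nhdsWithin] with γ hγ
  have hγ : γ ≠ 0 := hγ
  have e1 : (fun w => ratio obs P (Q γ) w - 1)
      = γ • ((fun w => (ratio obs P (Q γ) w - 1) / γ - g w) + g) := by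
    funext w
    simp only [Pi.smul_apply, Pi.add_apply, smul_eq_mul]
    field_simp
    ring
  rw [e1, eLpNorm_const_smul]
  gcongr
  refine eLpNorm_add_le ?_ (Lp.aestronglyMeasurable g) (by norm_num)
  exact ((((measurable_ratio P (Q γ)).sub_const 1).div_const γ).aestronglyMeasurable).sub
    (Lp.aestronglyMeasurable g)

theorem memLp_ratio (hobs : Measurable obs) (h : IsSmoothSubmodel 𝓜 obs P Q g) :
    ∀ᶠ γ in 𝓝 (0 : ℝ), MemLp (ratio obs P (Q γ)) 2 (obsLaw obs P) := by
  have : IsProbabilityMeasure (obsLaw obs P) :=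
    Measure.isProbabilityMeasure_map hobs.aemeasurable
  rw [← nhdsNE_sup_pure, eventually_sup]
  constructor
  · filter_upwards [h.tendsto_ratio.eventually_lt_const ENNReal.zero_lt_top] with γ hγ
    have h1 : MemLp (fun w => ratio obs P (Q γ) w - 1) 2 (obsLaw obs P) :=
      ⟨((measurable_ratio P (Q γ)).sub_const 1).aestronglyMeasurable, hγ⟩
    have h2 := h1.add (memLp_const (1 : ℝ))
    refine h2.ae_eq (ae_of_all _ fun w => ?_)
    simp
  -- The score condition concerns γ ≠ 0 only. At γ = 0 the observed law is that of P, and the ratio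
  -- is almost everywhere 1.
  · change MemLp _ _ _
    refine (memLp_const (1 : ℝ)).ae_eq ?_
    unfold ratio
    rw [h.base]
    filter_upwards [Measure.rnDeriv_self (obsLaw obs P)] with w hw
    rw [hw]; simp

open Classical in
/-- The chain rule along a smooth submodel: if `θ (Q γ) - c` is the mean of `H γ` under `Q γ`, the
mean of `H γ` under `P` vanishes, and `H γ → h` in `L²`, then `θ` has derivative `⟪h, g⟫`. -/
theorem hasDerivAt (hobs : Measurable obs) (hQ : IsSmoothSubmodel 𝓜 obs P Q g)
    {θ : ProbabilityMeasure Ω → ℝ} {c : ℝ} {H : ℝ → O → ℝ}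
    {h : Lp ℝ 2 (obsLaw obs P)}
    (hmem : ∀ γ, MemLp (H γ) 2 (obsLaw obs P))
    (hθ : ∀ᶠ γ in 𝓝 (0 : ℝ), θ (Q γ) - c = ∫ w, H γ w ∂((Q γ : Measure Ω).map obs))
    (hzero : ∀ᶠ γ in 𝓝 (0 : ℝ), ∫ w, H γ w ∂(obsLaw obs P) = 0)
    (hlim : Tendsto (fun γ => eLpNorm (fun w => H γ w - h w) 2 (obsLaw obs P))
      (𝓝[≠] 0) (𝓝 0)) :
    HasDerivAt (fun γ => θ (Q γ)) (inner ℝ h g) 0 := by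
  have : IsProbabilityMeasure (obsLaw obs P) :=
    Measure.isProbabilityMeasure_map hobs.aemeasurable
  have : ∀ γ, IsProbabilityMeasure ((Q γ : Measure Ω).map obs) := fun γ =>
    Measure.isProbabilityMeasure_map hobs.aemeasurable
  have h0 : θ (Q 0) = c := by
    have h1 := hθ.self_of_nhds
    rw [hQ.base, hzero.self_of_nhds] at h1
    linarith
  rw [hasDerivAt_iff_tendsto_slope_zero]
  simp only [zero_add, h0, smul_eq_mul]
  -- Difference quotients as elements of L². The default 0 is used only where the quotient is not
  -- square-integrable, which does not happen for small γ ≠ 0.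
  let s : ℝ → Lp ℝ 2 (obsLaw obs P) := fun γ =>
    if hm : MemLp (fun w => (ratio obs P (Q γ) w - 1) / γ) 2 (obsLaw obs P) then hm.toLp else 0
  have hsmem : ∀ᶠ γ in 𝓝[≠] (0 : ℝ), MemLp (fun w => (ratio obs P (Q γ) w - 1) / γ) 2 (obsLaw obs P) := by
    filter_upwards [(hQ.memLp_ratio hobs).filter_mono nhdsWithin_le_nhds] with γ hγ
    have := (hγ.sub (memLp_const (1 : ℝ))).const_mul γ⁻¹
    refine this.ae_eq (ae_of_all _ fun w => ?_)
    simp [div_eq_inv_mul]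
  have hs : Tendsto s (𝓝[≠] 0) (𝓝 g) := by
    rw [Lp.tendsto_Lp_iff_tendsto_eLpNorm']
    refine hQ.score.congr' ?_
    filter_upwards [hsmem] with γ hγ
    refine eLpNorm_congr_ae ?_
    simp only [s, dif_pos hγ]
    filter_upwards [hγ.coeFn_toLp] with w hw
    rw [Pi.sub_apply, hw]
    rfl
  have hH : Tendsto (fun γ => (hmem γ).toLp) (𝓝[≠] 0) (𝓝 h) := by
    rw [Lp.tendsto_Lp_iff_tendsto_eLpNorm']
    refine hlim.congr fun γ => eLpNorm_congr_ae ?_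
    filter_upwards [(hmem γ).coeFn_toLp] with w hw
    rw [Pi.sub_apply, hw]
  -- Changing measure, θ(Q γ) − c = E[p_γ H_γ] = E[(p_γ − 1) H_γ], since H_γ has mean zero under P.
  -- Dividing by γ gives exactly this inner product.
  refine (hH.inner hs).congr' ?_
  filter_upwards [hsmem, hθ.filter_mono nhdsWithin_le_nhds, hzero.filter_mono nhdsWithin_le_nhds,
    hQ.dominated.filter_mono nhdsWithin_le_nhds, self_mem_nhdsWithin,
    (hQ.memLp_ratio hobs).filter_mono nhdsWithin_le_nhds] with γ h1 h2 h3 h4 h5 h6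
  have h5 : γ ≠ 0 := h5
  rw [h2, ← integral_rnDeriv_smul h4, L2.inner_def]
  have h7 : ∫ w, (((Q γ : Measure Ω).map obs).rnDeriv (obsLaw obs P) w).toReal • H γ w ∂obsLaw obs P
      = ∫ w, (ratio obs P (Q γ) w * H γ w - H γ w) ∂obsLaw obs P := by
    have hi : Integrable (fun w => ratio obs P (Q γ) w * H γ w) (obsLaw obs P) :=
      h6.integrable_mul (hmem γ)
    rw [integral_sub hi ((hmem γ).integrable (by norm_num)), h3, sub_zero]
    rfl
  rw [h7, ← integral_const_mul]
  refine integral_congr_ae ?_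
  simp only [s, dif_pos h1]
  filter_upwards [h1.coeFn_toLp, (hmem γ).coeFn_toLp] with w hw hw'
  rw [hw, hw']
  simp only [RCLike.inner_apply, conj_trivial]
  field_simp

end IsSmoothSubmodel

end SmoothSubmodel

/-! ### A family of augmented inverse-probability-weighted functions -/

section Augmented

open scoped ENNReal

theorem measurable_bool_apply {α β γ : Type*} [MeasurableSpace α] [MeasurableSpace β]
    [MeasurableSpace γ] {w : Bool → β → γ} (hw : ∀ t, Measurable (w t)) {f : α → Bool} {x : α → β}
    (hf : Measurable f) (hx : Measurable x) : Measurable fun a => w (f a) (x a) := by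
  have h : Measurable fun v : Bool × β => w v.1 v.2 := measurable_from_prod_countable_right hw
  exact h.comp (hf.prodMk hx)

theorem memLp_two_bdd_mul {α : Type*} [MeasurableSpace α] {μ : Measure α} {u f : α → ℝ}
    (hf : MemLp f 2 μ) (hu : Measurable u) {C : ℝ} (hC : ∀ a, |u a| ≤ C) :
    MemLp (fun a => u a * f a) 2 μ := by
  refine hf.of_le_mul (c := C) (hu.aestronglyMeasurable.mul hf.1) (ae_of_all _ fun a => ?_)
  rw [norm_mul]
  exact mul_le_mul_of_nonneg_right (hC a) (norm_nonneg _)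

/-- The integral of |f(V)| over `E` is the integral of p(V)|f(V)|, hence at least δ times the full
integral. -/
theorem IsPropensity.integrable_of_restrict {Ω α : Type*} [MeasurableSpace Ω] [MeasurableSpace α]
    {μ : Measure Ω} {E : Set Ω} {V : Ω → α} {p : α → ℝ}
    (h : IsPropensity μ E V fun v => ENNReal.ofReal (p v)) (hV : Measurable V) (hp : Measurable p)
    {δ : ℝ} (hδ : 0 < δ) (hp0 : ∀ v, δ ≤ p v) {f : α → ℝ} (hf : Measurable f)
    (hi : IntegrableOn (fun ω => f (V ω)) E μ) : Integrable (fun ω => f (V ω)) μ := by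
  refine ⟨(hf.comp hV).aestronglyMeasurable, ?_⟩
  have h1 := h.lintegral hV hp.ennreal_ofReal hf.enorm
  have h2 : ENNReal.ofReal δ * ∫⁻ ω, ‖f (V ω)‖ₑ ∂μ ≤ ∫⁻ ω in E, ‖f (V ω)‖ₑ ∂μ := by
    rw [h1, ← lintegral_const_mul _ (f := fun ω => ‖f (V ω)‖ₑ) (hf.comp hV).enorm]
    exact lintegral_mono fun ω => mul_le_mul_left (ENNReal.ofReal_le_ofReal (hp0 _)) _
  have h3 := h2.trans_lt hi.2
  by_contra hc
  have h4 : ∫⁻ ω, ‖f (V ω)‖ₑ ∂μ = ∞ := by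
    rw [HasFiniteIntegral, not_lt, top_le_iff] at hc
    exact hc
  rw [h4, ENNReal.mul_top (by simpa using hδ)] at h3
  exact lt_irrefl _ h3

/-- Units of arm `t` whose outcome is revealed. -/
def revealed {𝒳 𝒮 : Type*} (full t : Bool) : Set (Subject 𝒳 𝒮) := {ω | T ω = t ∧ (full || R ω) = true}

theorem revealed_true {𝒳 𝒮 : Type*} (t : Bool) : (revealed true t : Set (Subject 𝒳 𝒮)) = T ⁻¹' {t} := by
  ext ω; simp [revealed]

theorem revealed_false {𝒳 𝒮 : Type*} (t : Bool) : (revealed false t : Set (Subject 𝒳 𝒮)) = labelled t := by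
  ext ω; simp [revealed, labelled]

variable {𝒳 𝒮 : Type*} [MeasurableSpace 𝒳] [MeasurableSpace 𝒮]

/-- The sign `±1` with which an arm enters the treatment effect. -/
def sgn (t : Bool) : ℝ := if t then 1 else -1

/-- Regression functions `m t x s` for the outcome and `μ t x` for its average over the surrogate;
`full` says whether the outcome is revealed on all units or only on labelled ones. -/
structure Regression (𝒳 𝒮 : Type*) [MeasurableSpace 𝒳] [MeasurableSpace 𝒮] where
  /-- Whether outcomes are revealed on all units. -/
  full : Bool
  /-- Regression on covariates and surrogate. -/
  m : Bool → 𝒳 → 𝒮 → ℝ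
  /-- Regression on covariates. -/
  μ : Bool → 𝒳 → ℝ
  measurable_m : ∀ t, Measurable fun v : 𝒳 × 𝒮 => m t v.1 v.2
  measurable_μ : ∀ t, Measurable (μ t)

theorem measurableSet_revealed (full t : Bool) :
    MeasurableSet (revealed full t : Set (Subject 𝒳 𝒮)) := by
  cases full
  · rw [revealed_false]; exact measurableSet_labelled t
  · rw [revealed_true]; exact measurableSet_arm t

/-- Probability given covariates that a unit is in arm `t` and has its outcome revealed. -/
def revealProb (full : Bool) (π η : Bool → 𝒳 → ℝ) (t : Bool) (x : 𝒳) : ℝ :=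
  if full then π t x else π t x * η t x

namespace IsWeights

variable {ε : ℝ} {π η : Bool → 𝒳 → ℝ}

theorem measurable_revealProb (h : IsWeights ε π η) (full t : Bool) :
    Measurable (revealProb full π η t) := by
  cases full
  · exact (h.measurable_treat t).mul (h.measurable_label t)
  · exact h.measurable_treat t

theorem le_one (h : IsWeights ε π η) (x : 𝒳) : ε ≤ 1 :=
  (h.treat_mem true x).1.trans (h.treat_mem true x).2

theorem revealProb_mem (h : IsWeights ε π η) (hε : 0 < ε) (full t : Bool) (x : 𝒳) :
    revealProb full π η t x ∈ Set.Icc (ε ^ 2) 1 := by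
  have h1 := h.treat_mem t x
  have h2 := h.label_mem t x
  have h3 := h.le_one x
  unfold revealProb
  cases full
  · simp only [Bool.false_eq_true, if_false]
    exact ⟨by rw [sq]; exact mul_le_mul h1.1 h2.1 hε.le (hε.le.trans h1.1),
      mul_le_one₀ h1.2 (hε.le.trans h2.1) h2.2⟩
  · simp only [if_true]
    exact ⟨by nlinarith [h1.1], h1.2⟩

theorem sq_le_treat (h : IsWeights ε π η) (hε : 0 < ε) (t : Bool) (x : 𝒳) : ε ^ 2 ≤ π t x :=
  (h.revealProb_mem hε true t x).1

end IsWeights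

namespace IsRandomized

variable {ε : ℝ} {π η : Bool → 𝒳 → ℝ} {Q : Measure (Subject 𝒳 𝒮)}

theorem reveal (h : IsRandomized ε Q π η) (full t : Bool) :
    IsPropensity Q (revealed full t) (armData t)
      fun z => ENNReal.ofReal (revealProb full π η t z.1) := by
  unfold revealProb
  cases full
  · rw [revealed_false]; simpa using h.label t
  · rw [revealed_true]; simpa using h.treat t

end IsRandomized

namespace Regression

variable (N : Regression 𝒳 𝒮)

/-- Outcome residual. -/
def resid (t : Bool) (z : 𝒳 × 𝒮 × ℝ) : ℝ := z.2.2 - N.m t z.1 z.2.1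

/-- Deviation of the regression on covariates and surrogate from the regression on covariates. -/
def devi (t : Bool) (z : 𝒳 × 𝒮 × ℝ) : ℝ := N.m t z.1 z.2.1 - N.μ t z.1

theorem measurable_m' (t : Bool) : Measurable fun z : 𝒳 × 𝒮 × ℝ => N.m t z.1 z.2.1 :=
  (N.measurable_m t).comp (f := fun z : 𝒳 × 𝒮 × ℝ => (z.1, z.2.1)) (by fun_prop)

theorem measurable_resid (t : Bool) : Measurable (N.resid t) :=
  (measurable_snd.comp measurable_snd).sub (N.measurable_m' t)

theorem measurable_devi (t : Bool) : Measurable (N.devi t) :=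
  (N.measurable_m' t).sub ((N.measurable_μ t).comp measurable_fst)

/-- Augmented weighting with weights `w` for the residuals and `v` for the deviations. -/
def psi (w v : Bool → 𝒳 → ℝ) (c : ℝ) (ω : Subject 𝒳 𝒮) : ℝ :=
  N.μ true (X ω) - N.μ false (X ω)
    + sgn (T ω) * (ind (N.full || R ω) * w (T ω) (X ω) * N.resid (T ω) (armData (T ω) ω)
      + v (T ω) (X ω) * N.devi (T ω) (armData (T ω) ω)) - c

/-- The contribution of arm `t` to `psi`. -/
def armPart (w v : Bool → 𝒳 → ℝ) (t : Bool) (ω : Subject 𝒳 𝒮) : ℝ :=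
  (revealed N.full t).indicator (fun ω => w t (X ω) * N.resid t (armData t ω)) ω
    + (T ⁻¹' {t}).indicator (fun ω => v t (X ω) * N.devi t (armData t ω)) ω

theorem psi_eq (w v : Bool → 𝒳 → ℝ) (c : ℝ) (ω : Subject 𝒳 𝒮) :
    N.psi w v c ω = N.μ true (X ω) - N.μ false (X ω)
      + (N.armPart w v true ω - N.armPart w v false ω) - c := by
  unfold psi armPart
  cases hT : T ω <;> cases hF : N.full <;> cases hR : R ω <;>
    simp [Set.indicator, revealed, hT, hR, sgn, ind]

/-- The regressions are integrable under `Q`. -/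
structure Integrable (Q : Measure (Subject 𝒳 𝒮)) : Prop where
  out : ∀ t, MeasureTheory.Integrable (Ypot t) Q
  m : ∀ t, MeasureTheory.Integrable (fun ω => N.m t (X ω) (Spot t ω)) Q
  μ : ∀ t, MeasureTheory.Integrable (fun ω => N.μ t (X ω)) Q

/-- Square-integrable regressions with residuals and deviations centered given covariates. -/
structure IsCentered (P : Measure (Subject 𝒳 𝒮)) : Prop where
  memLp_out : ∀ t, MemLp (Ypot t) 2 P
  memLp_m : ∀ t, MemLp (fun ω => N.m t (X ω) (Spot t ω)) 2 P
  memLp_μ : ∀ t, MemLp (fun ω => N.μ t (X ω)) 2 P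
  resid : ∀ t (c : 𝒳 → ℝ), Measurable c → ∫ ω, c (X ω) * N.resid t (armData t ω) ∂P = 0
  devi : ∀ t (c : 𝒳 → ℝ), Measurable c → ∫ ω, c (X ω) * N.devi t (armData t ω) ∂P = 0

variable {N}

theorem Integrable.resid {Q : Measure (Subject 𝒳 𝒮)} (h : N.Integrable Q) (t : Bool) :
    MeasureTheory.Integrable (fun ω => N.resid t (armData t ω)) Q :=
  (h.out t).sub (h.m t)

theorem Integrable.devi {Q : Measure (Subject 𝒳 𝒮)} (h : N.Integrable Q) (t : Bool) :
    MeasureTheory.Integrable (fun ω => N.devi t (armData t ω)) Q :=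
  (h.m t).sub (h.μ t)

theorem IsCentered.memLp_resid {P : Measure (Subject 𝒳 𝒮)} (h : N.IsCentered P) (t : Bool) :
    MemLp (fun ω => N.resid t (armData t ω)) 2 P :=
  (h.memLp_out t).sub (h.memLp_m t)

theorem IsCentered.memLp_devi {P : Measure (Subject 𝒳 𝒮)} (h : N.IsCentered P) (t : Bool) :
    MemLp (fun ω => N.devi t (armData t ω)) 2 P :=
  (h.memLp_m t).sub (h.memLp_μ t)

theorem IsCentered.integrable {P : Measure (Subject 𝒳 𝒮)} [IsFiniteMeasure P]
    (h : N.IsCentered P) : N.Integrable P :=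
  ⟨fun t => (h.memLp_out t).integrable (by norm_num),
    fun t => (h.memLp_m t).integrable (by norm_num),
    fun t => (h.memLp_μ t).integrable (by norm_num)⟩

/-- The mean of `armPart` under randomization with probabilities `π` and `η`. -/
def armMean (N : Regression 𝒳 𝒮) (Q : Measure (Subject 𝒳 𝒮)) (π η w v : Bool → 𝒳 → ℝ)
    (t : Bool) : ℝ :=
  ∫ ω, revealProb N.full π η t (X ω) * w t (X ω) * N.resid t (armData t ω) ∂Q
    + ∫ ω, π t (X ω) * v t (X ω) * N.devi t (armData t ω) ∂Q

/-- Randomization replaces the indicator of each arm, or of its revealed units, by its probability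
given the covariates. Neither the weights nor the regressions need be the true ones. -/
theorem integral_psi {ε : ℝ} (hε : 0 < ε) {Q : Measure (Subject 𝒳 𝒮)} [IsProbabilityMeasure Q]
    {π η : Bool → 𝒳 → ℝ} (hQ : IsRandomized ε Q π η) (hi : N.Integrable Q)
    {w v : Bool → 𝒳 → ℝ} (hw : ∀ t, Measurable (w t)) (hv : ∀ t, Measurable (v t)) {C : ℝ}
    (hwC : ∀ t x, |w t x| ≤ C) (hvC : ∀ t x, |v t x| ≤ C) (c : ℝ) :
    ∫ ω, N.psi w v c ω ∂Q
      = ∫ ω, N.μ true (X ω) ∂Q - ∫ ω, N.μ false (X ω) ∂Q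
        + (N.armMean Q π η w v true - N.armMean Q π η w v false) - c := by
  have i1 : ∀ t, MeasureTheory.Integrable (fun ω => w t (X ω) * N.resid t (armData t ω)) Q :=
    fun t => (hi.resid t).bdd_mul ((hw t).comp measurable_X).aestronglyMeasurable
      (ae_of_all _ fun _ => hwC _ _)
  have i2 : ∀ t, MeasureTheory.Integrable (fun ω => v t (X ω) * N.devi t (armData t ω)) Q :=
    fun t => (hi.devi t).bdd_mul ((hv t).comp measurable_X).aestronglyMeasurable
      (ae_of_all _ fun _ => hvC _ _)
  have i1' := fun t => (i1 t).indicator (measurableSet_revealed N.full t)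
  have i2' := fun t => (i2 t).indicator (measurableSet_arm (𝒳 := 𝒳) (𝒮 := 𝒮) t)
  have hJ : ∀ t, ∫ ω, N.armPart w v t ω ∂Q = N.armMean Q π η w v t := by
    intro t
    unfold armPart
    rw [integral_add (i1' t) (i2' t), integral_indicator (measurableSet_revealed N.full t),
      integral_indicator (measurableSet_arm t)]
    have e1 := (hQ.reveal N.full t).integral (measurable_armData t)
      ((hQ.measurable_revealProb N.full t).comp measurable_fst)
      (fun z => (sq_nonneg ε).trans (hQ.revealProb_mem hε N.full t z.1).1)
      (f := fun z => w t z.1 * N.resid t z)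
      (((hw t).comp measurable_fst).mul (N.measurable_resid t))
    have e2 := (hQ.treat t).integral (measurable_armData t)
      ((hQ.measurable_treat t).comp measurable_fst)
      (fun z => hε.le.trans (hQ.treat_mem t z.1).1)
      (f := fun z => v t z.1 * N.devi t z)
      (((hv t).comp measurable_fst).mul (N.measurable_devi t))
    simp only [armMean, mul_assoc]
    exact congrArg₂ (· + ·) e1 e2
  have i3 : ∀ t, MeasureTheory.Integrable (N.armPart w v t) Q := fun t => (i1' t).add (i2' t)
  have i4 : MeasureTheory.Integrable (fun ω => N.μ true (X ω) - N.μ false (X ω)) Q :=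
    (hi.μ true).sub (hi.μ false)
  have i5 : MeasureTheory.Integrable
      (fun ω => N.armPart w v true ω - N.armPart w v false ω) Q := (i3 true).sub (i3 false)
  have i6 : MeasureTheory.Integrable (fun ω => N.μ true (X ω) - N.μ false (X ω)
      + (N.armPart w v true ω - N.armPart w v false ω)) Q := i4.add i5
  simp_rw [psi_eq]
  rw [integral_sub i6 (integrable_const c), integral_add i4 i5,
    integral_sub (hi.μ true) (hi.μ false), integral_sub (i3 true) (i3 false), hJ, hJ]
  simp

theorem abs_inv_le {δ a : ℝ} (hδ : 0 < δ) (ha : δ ≤ a) : |a⁻¹| ≤ δ⁻¹ := by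
  have := hδ.trans_le ha
  rw [abs_of_pos (inv_pos.2 this)]
  exact inv_anti₀ hδ ha

/-- First half of double robustness: with the true weights the indicators average to one, and (Y(t)
− m) + (m − μ) + μ telescopes to Y(t), whatever the regressions are. -/
theorem integral_psi_inv {ε : ℝ} (hε : 0 < ε) {Q : Measure (Subject 𝒳 𝒮)} [IsProbabilityMeasure Q]
    {π η : Bool → 𝒳 → ℝ} (hQ : IsRandomized ε Q π η) (hi : N.Integrable Q) (c : ℝ) :
    ∫ ω, N.psi (fun t x => (revealProb N.full π η t x)⁻¹) (fun t x => (π t x)⁻¹) c ω ∂Q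
      = ate Q - c := by
  rw [integral_psi hε hQ hi (w := fun t x => (revealProb N.full π η t x)⁻¹)
    (v := fun t x => (π t x)⁻¹) (fun t => (hQ.measurable_revealProb N.full t).inv)
    (fun t => (hQ.measurable_treat t).inv) (C := (ε ^ 2)⁻¹)
    (fun t x => abs_inv_le (by positivity) (hQ.revealProb_mem hε N.full t x).1)
    (fun t x => abs_inv_le (by positivity) (hQ.sq_le_treat hε t x))]
  have h1 : ∀ t x, revealProb N.full π η t x * (revealProb N.full π η t x)⁻¹ = 1 := fun t x =>
    mul_inv_cancel₀ (ne_of_gt ((pow_pos hε 2).trans_le (hQ.revealProb_mem hε N.full t x).1))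
  have h2 : ∀ t x, π t x * (π t x)⁻¹ = 1 := fun t x =>
    mul_inv_cancel₀ (ne_of_gt (hε.trans_le (hQ.treat_mem t x).1))
  simp only [armMean, h1, h2, one_mul]
  have h3 : ∀ t, ∫ ω, N.resid t (armData t ω) ∂Q
      = ∫ ω, Ypot t ω ∂Q - ∫ ω, N.m t (X ω) (Spot t ω) ∂Q := fun t =>
    integral_sub (hi.out t) (hi.m t)
  have h4 : ∀ t, ∫ ω, N.devi t (armData t ω) ∂Q
      = ∫ ω, N.m t (X ω) (Spot t ω) ∂Q - ∫ ω, N.μ t (X ω) ∂Q := fun t =>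
    integral_sub (hi.m t) (hi.μ t)
  rw [h3, h3, h4, h4, ate]
  ring

/-- Second half of double robustness: with the true regressions every residual and deviation is
centered given the covariates, so any bounded weights multiplying them are harmless. -/
theorem IsCentered.integral_psi {ε : ℝ} (hε : 0 < ε) {P : Measure (Subject 𝒳 𝒮)}
    [IsProbabilityMeasure P] {π η : Bool → 𝒳 → ℝ} (hP : IsRandomized ε P π η) (hc : N.IsCentered P)
    {w v : Bool → 𝒳 → ℝ} (hw : ∀ t, Measurable (w t)) (hv : ∀ t, Measurable (v t)) {C : ℝ}
    (hwC : ∀ t x, |w t x| ≤ C) (hvC : ∀ t x, |v t x| ≤ C) :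
    ∫ ω, N.psi w v (ate P) ω ∂P = 0 := by
  have hi := hc.integrable
  rw [Regression.integral_psi hε hP hi hw hv hwC hvC, armMean, armMean]
  rw [hc.resid true (fun x => revealProb N.full π η true x * w true x)
      ((hP.measurable_revealProb N.full true).mul (hw true)),
    hc.resid false (fun x => revealProb N.full π η false x * w false x)
      ((hP.measurable_revealProb N.full false).mul (hw false)),
    hc.devi true (fun x => π true x * v true x) ((hP.measurable_treat true).mul (hv true)),
    hc.devi false (fun x => π false x * v false x) ((hP.measurable_treat false).mul (hv false)),
    ate]
  have h1 : ∀ t, ∫ ω, Ypot t ω ∂P = ∫ ω, N.μ t (X ω) ∂P := by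
    intro t
    have h3 : ∫ ω, N.resid t (armData t ω) ∂P
        = ∫ ω, Ypot t ω ∂P - ∫ ω, N.m t (X ω) (Spot t ω) ∂P := integral_sub (hi.out t) (hi.m t)
    have h4 : ∫ ω, N.devi t (armData t ω) ∂P
        = ∫ ω, N.m t (X ω) (Spot t ω) ∂P - ∫ ω, N.μ t (X ω) ∂P := integral_sub (hi.m t) (hi.μ t)
    have h5 := hc.resid t (fun _ => 1) measurable_const
    have h6 := hc.devi t (fun _ => 1) measurable_const
    simp only [one_mul] at h5 h6
    linarith
  rw [h1, h1]
  ring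

end Regression

end Augmented

/-! ### Augmented functions are influence functions -/

section InfluenceFunction

open scoped ENNReal

/-- Test with the sign s of a' − a, so that |a' − a| = a's − as. The mean of as under P is that of s
on `E` under P, and the mean of a's under Q is that of s on `E` under Q. Comparing P with Q once for
a's and once for s on `E` costs τ each time. -/
theorem integral_abs_sub_le_of_isPropensity {Ω 𝒱 : Type*} [MeasurableSpace Ω] [MeasurableSpace 𝒱]
    {P Q : Measure Ω} [IsProbabilityMeasure P] [IsProbabilityMeasure Q] {V : Ω → 𝒱}
    (hV : Measurable V) {E : Set Ω} {a a' : 𝒱 → ℝ}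
    (ha : Measurable a) (ha' : Measurable a') (ha01 : ∀ v, a v ∈ Set.Icc 0 1)
    (ha01' : ∀ v, a' v ∈ Set.Icc 0 1)
    (hP : IsPropensity P E V fun v => ENNReal.ofReal (a v))
    (hQ : IsPropensity Q E V fun v => ENNReal.ofReal (a' v)) {τ : ℝ}
    (hτ : ∀ F : 𝒱 → ℝ, Measurable F → (∀ v, |F v| ≤ 1) →
      |∫ ω, F (V ω) ∂Q - ∫ ω, F (V ω) ∂P| ≤ τ ∧
      |∫ ω in E, F (V ω) ∂Q - ∫ ω in E, F (V ω) ∂P| ≤ τ) :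
    ∫ ω, |a' (V ω) - a (V ω)| ∂P ≤ 2 * τ := by
  let s : 𝒱 → ℝ := fun v => if a v ≤ a' v then 1 else -1
  have ms : Measurable s :=
    Measurable.ite (measurableSet_le ha ha') measurable_const measurable_const
  have s1 : ∀ v, |s v| ≤ 1 := fun v => by
    simp only [s]; split_ifs <;> simp
  have hs : ∀ v, |a' v - a v| = a' v * s v - a v * s v := fun v => by
    simp only [s]
    split_ifs with h
    · rw [abs_of_nonneg (by linarith)]; ring
    · rw [abs_of_nonpos (by linarith)]; ring
  have bdd : ∀ b : 𝒱 → ℝ, (∀ v, b v ∈ Set.Icc 0 1) → ∀ v, |b v * s v| ≤ 1 := fun b hb v => by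
    rw [abs_mul, abs_of_nonneg (hb v).1]
    exact mul_le_one₀ (hb v).2 (abs_nonneg _) (s1 v)
  have int : ∀ b : 𝒱 → ℝ, Measurable b → (∀ v, b v ∈ Set.Icc 0 1) →
      Integrable (fun ω => b (V ω) * s (V ω)) P := fun b mb hb =>
    Integrable.of_bound ((mb.comp hV).mul (ms.comp hV)).aestronglyMeasurable 1
      (ae_of_all _ fun ω => bdd b hb _)
  simp_rw [hs]
  rw [integral_sub (int a' ha' ha01') (int a ha ha01)]
  have h1 := (hτ (fun v => a' v * s v) (ha'.mul ms) (bdd a' ha01')).1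
  have h2 := (hτ s ms s1).2
  rw [hQ.integral hV ha' (fun v => (ha01' v).1) ms,
    hP.integral hV ha (fun v => (ha01 v).1) ms] at h2
  rw [abs_le] at h1 h2
  linarith [h1.1, h2.2]

/-! ### Comparison of observed laws in L¹. -/

section Ratio

variable {Ω O : Type*} [MeasurableSpace Ω] [MeasurableSpace O] {𝓜 : Set (ProbabilityMeasure Ω)}
  {obs : Ω → O} {P : ProbabilityMeasure Ω} {Q : ℝ → ProbabilityMeasure Ω}
  {g : Lp ℝ 2 ((P : Measure Ω).map obs)}

/-- `L¹` distance of the observed laws. -/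
def obsDist (obs : Ω → O) (P Q : ProbabilityMeasure Ω) : ℝ :=
  ∫ w, |ratio obs P Q w - 1| ∂obsLaw obs P

theorem integrable_ratio (P Q : ProbabilityMeasure Ω) : Integrable (ratio obs P Q) (obsLaw obs P) :=
  Measure.integrable_toReal_rnDeriv

theorem abs_integral_sub_le_obsDist (hobs : Measurable obs) {P Q : ProbabilityMeasure Ω}
    (hPQ : obsLaw obs Q ≪ obsLaw obs P) {F : O → ℝ} (hF : Measurable F) (hF1 : ∀ w, |F w| ≤ 1) :
    |∫ w, F w ∂obsLaw obs Q - ∫ w, F w ∂obsLaw obs P| ≤ obsDist obs P Q := by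
  have : IsProbabilityMeasure (obsLaw obs P) := Measure.isProbabilityMeasure_map hobs.aemeasurable
  have : IsProbabilityMeasure (obsLaw obs Q) := Measure.isProbabilityMeasure_map hobs.aemeasurable
  have iF : Integrable F (obsLaw obs P) :=
    Integrable.of_bound hF.aestronglyMeasurable 1 (ae_of_all _ hF1)
  have h1 : ∫ w, F w ∂obsLaw obs Q = ∫ w, ratio obs P Q w * F w ∂obsLaw obs P :=
    (integral_rnDeriv_smul hPQ).symm
  have i1 : Integrable (fun w => ratio obs P Q w * F w) (obsLaw obs P) := by
    have := (integrable_ratio (obs := obs) P Q).bdd_mul hF.aestronglyMeasurable (ae_of_all _ hF1)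
    exact this.congr (ae_of_all _ fun w => mul_comm _ _)
  rw [h1, ← integral_sub i1 iF]
  refine (abs_integral_le_integral_abs).trans (integral_mono (i1.sub iF).abs
    ((integrable_ratio P Q).sub (integrable_const 1)).abs fun w => ?_)
  have : ratio obs P Q w * F w - F w = (ratio obs P Q w - 1) * F w := by ring
  simp only [this, abs_mul]
  exact mul_le_of_le_one_right (abs_nonneg _) (hF1 w)

theorem IsSmoothSubmodel.tendsto_obsDist (hobs : Measurable obs)
    (hQ : IsSmoothSubmodel 𝓜 obs P Q g) :
    Tendsto (fun γ => obsDist obs P (Q γ)) (𝓝[≠] 0) (𝓝 0) := by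
  have : IsProbabilityMeasure (obsLaw obs P) := Measure.isProbabilityMeasure_map hobs.aemeasurable
  have h1 : Tendsto (fun γ => eLpNorm (fun w => ratio obs P (Q γ) w - 1) 1 (obsLaw obs P))
      (𝓝[≠] 0) (𝓝 0) :=
    tendsto_of_tendsto_of_tendsto_of_le_of_le tendsto_const_nhds hQ.tendsto_ratio
      (fun _ => zero_le) (fun γ => eLpNorm_le_eLpNorm_of_exponent_le (by norm_num)
        ((measurable_ratio P (Q γ)).sub_const 1).aestronglyMeasurable)
  have h2 := (ENNReal.tendsto_toReal ENNReal.zero_ne_top).comp h1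
  simp only [ENNReal.toReal_zero] at h2
  refine h2.congr fun γ => ?_
  rw [Function.comp_apply, eLpNorm_one_eq_lintegral_enorm,
    ← integral_norm_eq_lintegral_enorm ((measurable_ratio P (Q γ)).sub_const 1).aestronglyMeasurable]
  rfl

end Ratio

variable {𝒳 𝒮 O : Type*} [MeasurableSpace 𝒳] [MeasurableSpace 𝒮] [MeasurableSpace O]

/-- The observed data determine every ingredient of `N.psi`. -/
structure Observes (obs : Subject 𝒳 𝒮 → O) (N : Regression 𝒳 𝒮) where
  /-- Covariates. -/
  cov : O → 𝒳
  /-- Treatment. -/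
  treat : O → Bool
  /-- Whether the outcome is revealed. -/
  reveal : O → Bool
  /-- The outcome, if revealed. -/
  out : O → ℝ
  /-- The regression in the actual arm. -/
  reg : O → ℝ
  measurable_cov : Measurable cov
  measurable_treat : Measurable treat
  measurable_reveal : Measurable reveal
  measurable_out : Measurable out
  measurable_reg : Measurable reg
  cov_obs : ∀ ω, cov (obs ω) = X ω
  treat_obs : ∀ ω, treat (obs ω) = T ω
  reveal_obs : ∀ ω, reveal (obs ω) = (N.full || R ω)
  out_obs : ∀ ω, out (obs ω) = ind (N.full || R ω) * Y ω
  reg_obs : ∀ ω, reg (obs ω) = N.m (T ω) (X ω) (S ω)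

/-! ### The augmented function as a function of the observed data. -/

namespace Observes

variable {obs : Subject 𝒳 𝒮 → O} {N : Regression 𝒳 𝒮} (B : Observes obs N)

theorem measurable_ind : Measurable ind := measurable_of_countable _

theorem measurable_sgn : Measurable sgn := measurable_of_countable _

theorem abs_sgn (t : Bool) : |sgn t| = 1 := by cases t <;> simp [sgn]

theorem abs_ind_le (t : Bool) : |ind t| ≤ 1 := by cases t <;> simp [ind]

/-- The revealed residual. -/
def resid (w : O) : ℝ := B.out w - ind (B.reveal w) * B.reg w

/-- The deviation in the actual arm. -/
def devi (w : O) : ℝ := B.reg w - N.μ (B.treat w) (B.cov w)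

/-- `N.psi` as a function of the observed data. -/
def psi (w v : Bool → 𝒳 → ℝ) (c : ℝ) (o : O) : ℝ :=
  N.μ true (B.cov o) - N.μ false (B.cov o)
    + sgn (B.treat o) * w (B.treat o) (B.cov o) * B.resid o
    + sgn (B.treat o) * v (B.treat o) (B.cov o) * B.devi o - c

theorem psi_obs (w v : Bool → 𝒳 → ℝ) (c : ℝ) (ω : Subject 𝒳 𝒮) :
    B.psi w v c (obs ω) = N.psi w v c ω := by
  simp only [psi, resid, devi, Regression.psi, B.cov_obs, B.treat_obs, B.reveal_obs, B.out_obs,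
    B.reg_obs]
  have h1 : N.resid (T ω) (armData (T ω) ω) = Y ω - N.m (T ω) (X ω) (S ω) := rfl
  have h2 : N.devi (T ω) (armData (T ω) ω) = N.m (T ω) (X ω) (S ω) - N.μ (T ω) (X ω) := rfl
  rw [h1, h2]
  ring

theorem measurable_resid : Measurable B.resid :=
  B.measurable_out.sub ((measurable_ind.comp B.measurable_reveal).mul B.measurable_reg)

theorem measurable_devi : Measurable B.devi :=
  B.measurable_reg.sub (measurable_bool_apply N.measurable_μ B.measurable_treat B.measurable_cov)

theorem measurable_signed {w : Bool → 𝒳 → ℝ} (hw : ∀ t, Measurable (w t)) :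
    Measurable fun o => sgn (B.treat o) * w (B.treat o) (B.cov o) :=
  (measurable_sgn.comp B.measurable_treat).mul
    (measurable_bool_apply hw B.measurable_treat B.measurable_cov)

theorem measurable_psi {w v : Bool → 𝒳 → ℝ} (hw : ∀ t, Measurable (w t))
    (hv : ∀ t, Measurable (v t)) (c : ℝ) : Measurable (B.psi w v c) :=
  (((((N.measurable_μ true).comp B.measurable_cov).sub
    ((N.measurable_μ false).comp B.measurable_cov)).add
    ((B.measurable_signed hw).mul B.measurable_resid)).add
    ((B.measurable_signed hv).mul B.measurable_devi)).sub_const c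

theorem memLp_bool {P : Measure (Subject 𝒳 𝒮)} {f : Bool → Subject 𝒳 𝒮 → ℝ}
    (hf : ∀ t, MemLp (f t) 2 P) : MemLp (fun ω => f (T ω) ω) 2 P := by
  have h : (fun ω => f (T ω) ω)
      = (T ⁻¹' {true}).indicator (f true) + (T ⁻¹' {false}).indicator (f false) := by
    funext ω
    cases hT : T ω <;> simp [Set.indicator, hT]
  rw [h]
  exact ((hf true).indicator (measurableSet_arm true)).add
    ((hf false).indicator (measurableSet_arm false))

variable {P : ProbabilityMeasure (Subject 𝒳 𝒮)}

theorem memLp_reg (hobs : Measurable obs) (hc : N.IsCentered (P : Measure (Subject 𝒳 𝒮))) :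
    MemLp B.reg 2 (obsLaw obs P) := by
  rw [memLp_map_measure_iff B.measurable_reg.aestronglyMeasurable hobs.aemeasurable]
  refine (memLp_bool hc.memLp_m).ae_eq (ae_of_all _ fun ω => ?_)
  exact (B.reg_obs ω).symm

theorem memLp_μ (hobs : Measurable obs) (hc : N.IsCentered (P : Measure (Subject 𝒳 𝒮)))
    (t : Bool) : MemLp (fun o => N.μ t (B.cov o)) 2 (obsLaw obs P) := by
  refine (memLp_map_measure_iff ((N.measurable_μ t).comp B.measurable_cov).aestronglyMeasurable
    hobs.aemeasurable).2 ?_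
  refine (hc.memLp_μ t).ae_eq (ae_of_all _ fun ω => ?_)
  exact congrArg (N.μ t) (B.cov_obs ω).symm

theorem memLp_resid (hobs : Measurable obs) (hc : N.IsCentered (P : Measure (Subject 𝒳 𝒮))) :
    MemLp B.resid 2 (obsLaw obs P) := by
  refine MemLp.sub ?_ (memLp_two_bdd_mul (B.memLp_reg hobs hc)
    (measurable_ind.comp B.measurable_reveal) fun o => abs_ind_le _)
  rw [memLp_map_measure_iff B.measurable_out.aestronglyMeasurable hobs.aemeasurable]
  refine (memLp_two_bdd_mul (memLp_bool hc.memLp_out) (u := fun ω => ind (B.reveal (obs ω)))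
    (measurable_ind.comp (B.measurable_reveal.comp hobs)) fun ω => abs_ind_le _).ae_eq
    (ae_of_all _ fun ω => ?_)
  simp only [Function.comp_apply, B.out_obs, B.reveal_obs]
  rfl

theorem memLp_devi (hobs : Measurable obs) (hc : N.IsCentered (P : Measure (Subject 𝒳 𝒮))) :
    MemLp B.devi 2 (obsLaw obs P) := by
  rw [memLp_map_measure_iff B.measurable_devi.aestronglyMeasurable hobs.aemeasurable]
  refine (memLp_bool hc.memLp_devi).ae_eq (ae_of_all _ fun ω => ?_)
  simp only [Function.comp_apply, devi, B.reg_obs, B.treat_obs, B.cov_obs]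
  rfl

theorem abs_signed_le {w : Bool → 𝒳 → ℝ} {C : ℝ} (hw : ∀ t x, |w t x| ≤ C) (o : O) :
    |sgn (B.treat o) * w (B.treat o) (B.cov o)| ≤ C := by
  rw [abs_mul, abs_sgn, one_mul]; exact hw _ _

theorem memLp_psi (hobs : Measurable obs) (hc : N.IsCentered (P : Measure (Subject 𝒳 𝒮)))
    {w v : Bool → 𝒳 → ℝ} (hw : ∀ t, Measurable (w t)) (hv : ∀ t, Measurable (v t)) {C : ℝ}
    (hwC : ∀ t x, |w t x| ≤ C) (hvC : ∀ t x, |v t x| ≤ C) (c : ℝ) :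
    MemLp (B.psi w v c) 2 (obsLaw obs P) := by
  have : IsProbabilityMeasure (obsLaw obs P) := Measure.isProbabilityMeasure_map hobs.aemeasurable
  exact ((((B.memLp_μ hobs hc true).sub (B.memLp_μ hobs hc false)).add
    (memLp_two_bdd_mul (B.memLp_resid hobs hc) (B.measurable_signed hw)
      (B.abs_signed_le hwC))).add
    (memLp_two_bdd_mul (B.memLp_devi hobs hc) (B.measurable_signed hv)
      (B.abs_signed_le hvC))).sub (memLp_const c)

/-- Along a law with square-integrable likelihood ratio the regressions stay integrable. -/
theorem integrable_of_memLp_ratio (B : Observes obs N) {ε : ℝ} (hε : 0 < ε) (hobs : Measurable obs)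
    (hc : N.IsCentered (P : Measure (Subject 𝒳 𝒮))) {Q : ProbabilityMeasure (Subject 𝒳 𝒮)}
    (hPQ : obsLaw obs Q ≪ obsLaw obs P) (hr : MemLp (ratio obs P Q) 2 (obsLaw obs P))
    {π η : Bool → 𝒳 → ℝ} (hQ : IsRandomized ε (Q : Measure (Subject 𝒳 𝒮)) π η)
    (hY : ∀ t, MemLp (Ypot t) 2 (Q : Measure (Subject 𝒳 𝒮))) :
    N.Integrable (Q : Measure (Subject 𝒳 𝒮)) := by
  have key : ∀ f : O → ℝ, MemLp f 2 (obsLaw obs P) →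
      MeasureTheory.Integrable (fun ω => f (obs ω)) (Q : Measure (Subject 𝒳 𝒮)) := by
    intro f hf
    have h1 : MeasureTheory.Integrable (fun o => ratio obs P Q o * f o) (obsLaw obs P) :=
      hr.integrable_mul hf
    have h2 : MeasureTheory.Integrable f (obsLaw obs Q) := (integrable_rnDeriv_smul_iff hPQ).1 h1
    exact h2.comp_measurable hobs
  refine ⟨fun t => (hY t).integrable (by norm_num), fun t => ?_, fun t => ?_⟩
  -- The data show the regression of the actual arm only. Integrability on the units of arm t
  -- extends to all units since their treatment probability is at least ε.
  · have h1 := (key _ (B.memLp_reg hobs hc)).integrableOn (s := T ⁻¹' {t})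
    refine (hQ.treat t).integrable_of_restrict (f := fun z => N.m t z.1 z.2.1)
      (measurable_armData t) ((hQ.measurable_treat t).comp measurable_fst) hε
      (fun z => (hQ.treat_mem t z.1).1) (N.measurable_m' t) ?_
    refine h1.congr ?_
    filter_upwards [ae_restrict_mem (measurableSet_arm t)] with ω hω
    have hT : T ω = t := hω
    rw [B.reg_obs, S, hT]
    rfl
  · refine (key _ (B.memLp_μ hobs hc t)).congr (ae_of_all _ fun ω => ?_)
    exact congrArg (N.μ t) (B.cov_obs ω)

theorem abs_inv_sub_inv_le {δ a b : ℝ} (hδ : 0 < δ) (ha : δ ≤ a) (hb : δ ≤ b) :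
    |a⁻¹ - b⁻¹| ≤ (δ ^ 2)⁻¹ * |a - b| := by
  have ha0 := hδ.trans_le ha
  have hb0 := hδ.trans_le hb
  have h1 : a⁻¹ - b⁻¹ = (a * b)⁻¹ * (b - a) := by field_simp
  rw [h1, abs_mul, abs_sub_comm b a, abs_of_pos (by positivity)]
  gcongr
  rw [sq]
  exact mul_le_mul ha hb hδ.le ha0.le

/-- Inverse weights converge in `L¹` along a smooth submodel. -/
theorem tendsto_eLpNorm_inv_sub (hobs : Measurable obs) {Q : ℝ → ProbabilityMeasure (Subject 𝒳 𝒮)}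
    {E : Bool → Set O} (hE : ∀ t, MeasurableSet (E t)) {δ : ℝ} (hδ : 0 < δ)
    {a : Bool → 𝒳 → ℝ} {a' : ℝ → Bool → 𝒳 → ℝ} (ha : ∀ t, Measurable (a t))
    (ha' : ∀ γ t, Measurable (a' γ t)) (ham : ∀ t x, a t x ∈ Set.Icc δ 1)
    (ham' : ∀ γ t x, a' γ t x ∈ Set.Icc δ 1)
    (hP : ∀ t, IsPropensity (P : Measure (Subject 𝒳 𝒮)) (obs ⁻¹' E t) X
      fun x => ENNReal.ofReal (a t x))
    (hQ : ∀ᶠ γ in 𝓝[≠] (0 : ℝ), ∀ t, IsPropensity (Q γ : Measure (Subject 𝒳 𝒮)) (obs ⁻¹' E t) X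
      fun x => ENNReal.ofReal (a' γ t x))
    (hPQ : ∀ᶠ γ in 𝓝[≠] (0 : ℝ), obsLaw obs (Q γ) ≪ obsLaw obs P)
    (hdist : Tendsto (fun γ => obsDist obs P (Q γ)) (𝓝[≠] 0) (𝓝 0)) :
    Tendsto (fun γ => eLpNorm (fun o => sgn (B.treat o) *
      ((a' γ (B.treat o) (B.cov o))⁻¹ - (a (B.treat o) (B.cov o))⁻¹)) 1 (obsLaw obs P))
      (𝓝[≠] 0) (𝓝 0) := by
  have : IsProbabilityMeasure (obsLaw obs P) := Measure.isProbabilityMeasure_map hobs.aemeasurable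
  -- Inversion is Lipschitz on [δ, 1] with constant δ⁻², and the probabilities of each arm move in
  -- L¹ by at most twice the distance of the observed laws; the two summands are the two arms.
  have h1 : Tendsto (fun γ => ENNReal.ofReal ((δ ^ 2)⁻¹ *
      (2 * obsDist obs P (Q γ) + 2 * obsDist obs P (Q γ)))) (𝓝[≠] 0) (𝓝 0) := by
    have := ((hdist.const_mul 2).add (hdist.const_mul 2)).const_mul (δ ^ 2)⁻¹
    simpa using ENNReal.tendsto_ofReal this
  refine tendsto_of_tendsto_of_tendsto_of_le_of_le' tendsto_const_nhds h1
    (Eventually.of_forall fun _ => zero_le) ?_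
  have mcov := B.measurable_cov
  filter_upwards [hQ, hPQ] with γ hγ hac
  have hcov : ∀ ω, X ω = B.cov (obs ω) := fun ω => (B.cov_obs ω).symm
  have hle : ∀ t, ∫ ω, |a' γ t (X ω) - a t (X ω)| ∂(P : Measure (Subject 𝒳 𝒮))
      ≤ 2 * obsDist obs P (Q γ) := by
    intro t
    refine integral_abs_sub_le_of_isPropensity measurable_X (ha t) (ha' γ t)
      (fun x => ⟨hδ.le.trans (ham t x).1, (ham t x).2⟩)
      (fun x => ⟨hδ.le.trans (ham' γ t x).1, (ham' γ t x).2⟩) (hP t) (hγ t) fun F hF hF1 => ?_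
    constructor
    · have h2 := abs_integral_sub_le_obsDist hobs hac (hF.comp mcov) fun o => hF1 _
      rw [integral_map hobs.aemeasurable (hF.comp mcov).aestronglyMeasurable,
        integral_map hobs.aemeasurable (hF.comp mcov).aestronglyMeasurable] at h2
      simpa only [Function.comp_apply, B.cov_obs] using h2
    · have h2 := abs_integral_sub_le_obsDist hobs hac ((hF.comp mcov).indicator (hE t))
        fun o => by
          by_cases ho : o ∈ E t
          · rw [Set.indicator_of_mem ho]; exact hF1 _
          · rw [Set.indicator_of_notMem ho]; simp
      rw [integral_indicator (hE t), integral_indicator (hE t),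
        setIntegral_map (hE t) (hF.comp mcov).aestronglyMeasurable hobs.aemeasurable,
        setIntegral_map (hE t) (hF.comp mcov).aestronglyMeasurable hobs.aemeasurable] at h2
      simpa only [Function.comp_apply, B.cov_obs] using h2
  have mbase : ∀ t, Measurable fun o => |a' γ t (B.cov o) - a t (B.cov o)| := fun t =>
    (((ha' γ t).comp mcov).sub ((ha t).comp mcov)).abs
  have ibase : ∀ t, Integrable (fun o => |a' γ t (B.cov o) - a t (B.cov o)|) (obsLaw obs P) :=
    fun t => Integrable.of_bound (mbase t).aestronglyMeasurable 1 (ae_of_all _ fun o => by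
      rw [Real.norm_eq_abs, abs_abs, abs_le]
      constructor <;> linarith [(ham t (B.cov o)).1, (ham t (B.cov o)).2,
        (ham' γ t (B.cov o)).1, (ham' γ t (B.cov o)).2])
  have hle' : ∀ t, ∫ o, |a' γ t (B.cov o) - a t (B.cov o)| ∂obsLaw obs P
      ≤ 2 * obsDist obs P (Q γ) := fun t => by
    rw [integral_map hobs.aemeasurable (mbase t).aestronglyMeasurable]
    simpa only [B.cov_obs] using hle t
  have iall : Integrable (fun o => (δ ^ 2)⁻¹ * (|a' γ true (B.cov o) - a true (B.cov o)|
      + |a' γ false (B.cov o) - a false (B.cov o)|)) (obsLaw obs P) :=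
    ((ibase true).add (ibase false)).const_mul _
  calc eLpNorm (fun o => sgn (B.treat o) *
      ((a' γ (B.treat o) (B.cov o))⁻¹ - (a (B.treat o) (B.cov o))⁻¹)) 1 (obsLaw obs P)
      ≤ eLpNorm (fun o => (δ ^ 2)⁻¹ * (|a' γ true (B.cov o) - a true (B.cov o)|
        + |a' γ false (B.cov o) - a false (B.cov o)|)) 1 (obsLaw obs P) := by
        refine eLpNorm_mono_real fun o => ?_
        rw [Real.norm_eq_abs, abs_mul, abs_sgn, one_mul]
        refine (abs_inv_sub_inv_le hδ (ham' γ _ _).1 (ham _ _).1).trans ?_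
        gcongr
        cases B.treat o
        · linarith [abs_nonneg (a' γ true (B.cov o) - a true (B.cov o))]
        · linarith [abs_nonneg (a' γ false (B.cov o) - a false (B.cov o))]
    _ = ENNReal.ofReal (∫ o, (δ ^ 2)⁻¹ * (|a' γ true (B.cov o) - a true (B.cov o)|
        + |a' γ false (B.cov o) - a false (B.cov o)|) ∂obsLaw obs P) := by
        rw [eLpNorm_one_eq_lintegral_enorm, ofReal_integral_eq_lintegral_ofReal iall
          (ae_of_all _ fun o => by positivity)]
        refine lintegral_congr fun o => ?_
        rw [Real.enorm_of_nonneg (by positivity)]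
    _ ≤ _ := by
        refine ENNReal.ofReal_le_ofReal ?_
        rw [integral_const_mul, integral_add (ibase true) (ibase false)]
        gcongr
        · exact hle' true
        · exact hle' false

variable [StandardBorelSpace 𝒳] [StandardBorelSpace 𝒮]

/-- The chain rule is applied to the hybrid H γ with the weights of Q γ and the regressions of P.
Double robustness supplies both mean identities at once, and the regressions of Q γ, over which the
submodel gives no control, never appear. -/
theorem isInfluenceFunction {ε : ℝ} (hε : 0 < ε) (hε' : ε < 1 / 2) (hobs : Measurable obs)
    (hc : N.IsCentered (P : Measure (Subject 𝒳 𝒮))) {π η : Bool → 𝒳 → ℝ}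
    (hP : IsRandomized ε (P : Measure (Subject 𝒳 𝒮)) π η) {h : Lp ℝ 2 (obsLaw obs P)}
    (hh : h =ᵐ[obsLaw obs P] B.psi (fun t x => (revealProb N.full π η t x)⁻¹)
      (fun t x => (π t x)⁻¹) (ate (P : Measure (Subject 𝒳 𝒮)))) :
    IsInfluenceFunction (model 𝒳 𝒮 ε) (fun Q => ate (Q : Measure (Subject 𝒳 𝒮))) obs P h := by
  intro Q g hQ
  -- Q γ has weights of its own only when it belongs to the model. For the other γ, which stay away
  -- from 0, the weights of P serve as a default so that the bounds hold for every γ.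
  have hweights : ∀ γ, ∃ p q : Bool → 𝒳 → ℝ, IsWeights ε p q ∧
      (Q γ ∈ model 𝒳 𝒮 ε → IsRandomized ε (Q γ : Measure (Subject 𝒳 𝒮)) p q) := by
    intro γ
    by_cases hγ : Q γ ∈ model 𝒳 𝒮 ε
    · obtain ⟨p, q, h1, -⟩ := Assumptions.exists_isRandomized hε hε' hγ
      exact ⟨p, q, h1.toIsWeights, fun _ => h1⟩
    · exact ⟨π, η, hP.toIsWeights, fun h => absurd h hγ⟩
  choose p q hpq hrand using hweights
  have hδ : 0 < ε ^ 2 := pow_pos hε 2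
  set c := ate (P : Measure (Subject 𝒳 𝒮)) with hcdef
  let w : ℝ → Bool → 𝒳 → ℝ := fun γ t x => (revealProb N.full (p γ) (q γ) t x)⁻¹
  let v : ℝ → Bool → 𝒳 → ℝ := fun γ t x => (p γ t x)⁻¹
  have mw : ∀ γ t, Measurable (w γ t) := fun γ t => ((hpq γ).measurable_revealProb N.full t).inv
  have mv : ∀ γ t, Measurable (v γ t) := fun γ t => ((hpq γ).measurable_treat t).inv
  have wC : ∀ γ t x, |w γ t x| ≤ (ε ^ 2)⁻¹ := fun γ t x =>
    Regression.abs_inv_le hδ ((hpq γ).revealProb_mem hε N.full t x).1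
  have vC : ∀ γ t x, |v γ t x| ≤ (ε ^ 2)⁻¹ := fun γ t x =>
    Regression.abs_inv_le hδ ((hpq γ).sq_le_treat hε t x)
  let w₀ : Bool → 𝒳 → ℝ := fun t x => (revealProb N.full π η t x)⁻¹
  let v₀ : Bool → 𝒳 → ℝ := fun t x => (π t x)⁻¹
  have mw₀ : ∀ t, Measurable (w₀ t) := fun t => (hP.measurable_revealProb N.full t).inv
  have mv₀ : ∀ t, Measurable (v₀ t) := fun t => (hP.measurable_treat t).inv
  have wC₀ : ∀ t x, |w₀ t x| ≤ (ε ^ 2)⁻¹ := fun t x =>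
    Regression.abs_inv_le hδ (hP.revealProb_mem hε N.full t x).1
  have vC₀ : ∀ t x, |v₀ t x| ≤ (ε ^ 2)⁻¹ := fun t x =>
    Regression.abs_inv_le hδ (hP.sq_le_treat hε t x)
  refine hQ.hasDerivAt hobs (θ := fun Q => ate (Q : Measure (Subject 𝒳 𝒮))) (h := h) (c := c)
    (H := fun γ => B.psi (w γ) (v γ) c)
    (fun γ => B.memLp_psi hobs hc (mw γ) (mv γ) (wC γ) (vC γ) c) ?_ ?_ ?_
  · filter_upwards [hQ.mem_model, hQ.dominated, hQ.memLp_ratio hobs] with γ h1 h2 h3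
    have hi := B.integrable_of_memLp_ratio hε hobs hc h2 h3 (hrand γ h1)
      (Assumptions.square_integrable h1)
    rw [integral_map hobs.aemeasurable (B.measurable_psi (mw γ) (mv γ) c).aestronglyMeasurable]
    simp_rw [B.psi_obs]
    exact (Regression.integral_psi_inv hε (hrand γ h1) hi c).symm
  · refine Eventually.of_forall fun γ => ?_
    rw [integral_map hobs.aemeasurable (B.measurable_psi (mw γ) (mv γ) c).aestronglyMeasurable]
    simp_rw [B.psi_obs]
    exact Regression.IsCentered.integral_psi hε hP hc (mw γ) (mv γ) (wC γ) (vC γ)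
  · have hE1 : ∀ t, obs ⁻¹' {o | B.treat o = t ∧ B.reveal o = true} = revealed N.full t := by
      intro t; ext ω
      change (B.treat (obs ω) = t ∧ B.reveal (obs ω) = true) ↔ _
      rw [B.treat_obs, B.reveal_obs]; rfl
    have hE2 : ∀ t, obs ⁻¹' {o | B.treat o = t} = T ⁻¹' {t} := by
      intro t; ext ω
      change B.treat (obs ω) = t ↔ _
      rw [B.treat_obs]; rfl
    have mE2 : ∀ t, MeasurableSet {o | B.treat o = t} := fun t =>
      B.measurable_treat (measurableSet_singleton t)
    have mE1 : ∀ t, MeasurableSet {o | B.treat o = t ∧ B.reveal o = true} := fun t =>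
      (mE2 t).inter (B.measurable_reveal (measurableSet_singleton true))
    have toX : ∀ {Q' : Measure (Subject 𝒳 𝒮)} {E : Set (Subject 𝒳 𝒮)} {a : 𝒳 → ℝ} (t : Bool),
        Measurable a → IsPropensity Q' E (armData t) (fun z => ENNReal.ofReal (a z.1)) →
        IsPropensity Q' E X fun x => ENNReal.ofReal (a x) := by
      intro Q' E a t ma h1
      exact h1.comp (measurable_armData t) measurable_fst (fun _ => rfl) ma.ennreal_ofReal
        (ae_of_all _ fun _ => rfl) (ma.comp measurable_fst).ennreal_ofReal
    have hdom : ∀ᶠ γ in 𝓝[≠] (0 : ℝ), obsLaw obs (Q γ) ≪ obsLaw obs P :=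
      hQ.dominated.filter_mono nhdsWithin_le_nhds
    have hmod : ∀ᶠ γ in 𝓝[≠] (0 : ℝ), Q γ ∈ model 𝒳 𝒮 ε :=
      hQ.mem_model.filter_mono nhdsWithin_le_nhds
    have t1 := B.tendsto_eLpNorm_inv_sub hobs (Q := Q) mE1 hδ
      (a := revealProb N.full π η) (a' := fun γ => revealProb N.full (p γ) (q γ))
      (fun t => hP.measurable_revealProb N.full t)
      (fun γ t => (hpq γ).measurable_revealProb N.full t)
      (fun t x => hP.revealProb_mem hε N.full t x)
      (fun γ t x => (hpq γ).revealProb_mem hε N.full t x)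
      (fun t => by
        rw [hE1]; exact toX t (hP.measurable_revealProb N.full t) (hP.reveal N.full t))
      (by
        filter_upwards [hmod] with γ h1 t
        rw [hE1]
        exact toX t ((hpq γ).measurable_revealProb N.full t) ((hrand γ h1).reveal N.full t))
      hdom (hQ.tendsto_obsDist hobs)
    have t2 := B.tendsto_eLpNorm_inv_sub hobs (Q := Q) mE2 hδ (a := π) (a' := p)
      hP.measurable_treat (fun γ => (hpq γ).measurable_treat)
      (fun t x => ⟨hP.sq_le_treat hε t x, (hP.treat_mem t x).2⟩)
      (fun γ t x => ⟨(hpq γ).sq_le_treat hε t x, ((hpq γ).treat_mem t x).2⟩)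
      (fun t => by rw [hE2]; exact toX t (hP.measurable_treat t) (hP.treat t))
      (by
        filter_upwards [hmod] with γ h1 t
        rw [hE2]
        exact toX t ((hpq γ).measurable_treat t) ((hrand γ h1).treat t))
      hdom (hQ.tendsto_obsDist hobs)
    have bd : ∀ {a b : Bool → 𝒳 → ℝ}, (∀ t x, |a t x| ≤ (ε ^ 2)⁻¹) →
        (∀ t x, |b t x| ≤ (ε ^ 2)⁻¹) → ∀ o, |sgn (B.treat o) *
          (a (B.treat o) (B.cov o) - b (B.treat o) (B.cov o))| ≤ 2 * (ε ^ 2)⁻¹ := by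
      intro a b ha hb o
      rw [abs_mul, abs_sgn, one_mul]
      refine (abs_sub _ _).trans ?_
      linarith [ha (B.treat o) (B.cov o), hb (B.treat o) (B.cov o)]
    have l1 := tendsto_eLpNorm_two_mul (B.memLp_resid hobs hc)
      (u := fun γ o => sgn (B.treat o) *
        (w γ (B.treat o) (B.cov o) - w₀ (B.treat o) (B.cov o)))
      (fun γ => B.measurable_signed (w := fun t x => w γ t x - w₀ t x)
        fun t => (mw γ t).sub (mw₀ t)) (fun γ => bd (wC γ) wC₀) t1
    have l2 := tendsto_eLpNorm_two_mul (B.memLp_devi hobs hc)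
      (u := fun γ o => sgn (B.treat o) *
        (v γ (B.treat o) (B.cov o) - v₀ (B.treat o) (B.cov o)))
      (fun γ => B.measurable_signed (w := fun t x => v γ t x - v₀ t x)
        fun t => (mv γ t).sub (mv₀ t)) (fun γ => bd (vC γ) vC₀) t2
    have l3 := l1.add l2
    rw [add_zero] at l3
    refine tendsto_of_tendsto_of_tendsto_of_le_of_le tendsto_const_nhds l3
      (fun _ => zero_le) fun γ => ?_
    -- H γ and h share their regressions, so the difference consists of weight differences times a
    -- fixed square-integrable residual and deviation.
    have e1 : eLpNorm (fun o => B.psi (w γ) (v γ) c o - h o) 2 (obsLaw obs P)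
        = eLpNorm ((fun o => sgn (B.treat o) *
            (w γ (B.treat o) (B.cov o) - w₀ (B.treat o) (B.cov o)) * B.resid o)
          + fun o => sgn (B.treat o) *
            (v γ (B.treat o) (B.cov o) - v₀ (B.treat o) (B.cov o)) * B.devi o) 2
          (obsLaw obs P) := by
      refine eLpNorm_congr_ae ?_
      filter_upwards [hh] with o ho
      rw [ho]
      simp only [psi, Pi.add_apply, w₀, v₀]
      ring
    rw [e1]
    refine eLpNorm_add_le ?_ ?_ (by norm_num)
    · exact ((B.measurable_signed (w := fun t x => w γ t x - w₀ t x)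
        fun t => (mw γ t).sub (mw₀ t)).mul B.measurable_resid).aestronglyMeasurable
    · exact ((B.measurable_signed (w := fun t x => v γ t x - v₀ t x)
        fun t => (mv γ t).sub (mv₀ t)).mul B.measurable_devi).aestronglyMeasurable

end Observes

end InfluenceFunction

/-! ### Decoupling treatment and labelling from the potential variables -/

section Decoupling

open scoped ENNReal

theorem map_withDensity_comp {α β : Type*} [MeasurableSpace α] [MeasurableSpace β] {μ : Measure α}
    {g : α → β} (hg : Measurable g) {f : β → ℝ≥0∞} (hf : Measurable f) :
    (μ.withDensity fun a => f (g a)).map g = (μ.map g).withDensity f := by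
  ext A hA
  rw [Measure.map_apply hg hA, withDensity_apply _ (hg hA), withDensity_apply _ hA,
    setLIntegral_map hA hf hg]

namespace IsPropensity

variable {Ω α : Type*} [MeasurableSpace Ω] [MeasurableSpace α] {μ : Measure Ω} {E F : Set Ω}
  {V : Ω → α} {ρ ρ' : α → ℝ≥0∞}

theorem union (h : IsPropensity μ E V ρ) (h' : IsPropensity μ F V ρ') (hV : Measurable V)
    (hEF : Disjoint E F) (hF : MeasurableSet F) (hρ : Measurable ρ) :
    IsPropensity μ (E ∪ F) V fun v => ρ v + ρ' v := by
  unfold IsPropensity at *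
  rw [Measure.restrict_union hEF hF, Measure.map_add _ _ hV, h, h', ← withDensity_add_left hρ]
  rfl

/-- The laws of `V` on `E \ F` and on `F` add up to that on `E`; the part on `F` is finite and can
be cancelled. -/
theorem diff [IsFiniteMeasure μ] {p q : α → ℝ} (hV : Measurable V)
    (hE : IsPropensity μ E V fun v => ENNReal.ofReal (p v))
    (hF : IsPropensity μ F V fun v => ENNReal.ofReal (q v)) (hFE : F ⊆ E) (mF : MeasurableSet F)
    (hp : Measurable p) (hq : Measurable q) (hq0 : ∀ v, 0 ≤ q v) (hqp : ∀ v, q v ≤ p v) :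
    IsPropensity μ (E \ F) V fun v => ENNReal.ofReal (p v - q v) := by
  have h1 : (μ.restrict E).map V = (μ.restrict (E \ F)).map V + (μ.restrict F).map V := by
    rw [← Measure.map_add _ _ hV, ← Measure.restrict_union Set.disjoint_sdiff_left mF,
      Set.sdiff_union_of_subset hFE]
  have h2 : (μ.map V).withDensity (fun v => ENNReal.ofReal (p v))
      = (μ.map V).withDensity (fun v => ENNReal.ofReal (p v - q v))
        + (μ.map V).withDensity (fun v => ENNReal.ofReal (q v)) := by
    rw [← withDensity_add_left (f := fun v => ENNReal.ofReal (p v - q v))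
      (hp.sub hq).ennreal_ofReal]
    congr 1
    funext v
    rw [Pi.add_apply, ← ENNReal.ofReal_add (sub_nonneg.2 (hqp v)) (hq0 v), sub_add_cancel]
  unfold IsPropensity at *
  rw [h1, hF, h2] at hE
  have hfin : IsFiniteMeasure ((μ.map V).withDensity fun v => ENNReal.ofReal (q v)) := by
    rw [← hF]; infer_instance
  ext A hA
  have h3 := congrArg (fun m => m A) hE
  simp only [Measure.add_apply] at h3
  exact (ENNReal.add_left_inj (measure_ne_top _ A)).1 h3

/-- A density that is a function of `V` changes the law of `V` but cancels from conditional
probabilities given `V`. This is what keeps tilted laws in the model. -/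
theorem withDensity (h : IsPropensity μ E V ρ) (hV : Measurable V) (hE : MeasurableSet E)
    (hρ : Measurable ρ) {f : α → ℝ≥0∞} (hf : Measurable f) :
    IsPropensity (μ.withDensity fun ω => f (V ω)) E V ρ := by
  unfold IsPropensity at *
  rw [restrict_withDensity hE, map_withDensity_comp hV hf, map_withDensity_comp hV hf, h,
    ← withDensity_mul _ hρ hf, ← withDensity_mul _ hf hρ, mul_comm]

end IsPropensity

variable {𝒳 𝒮 : Type*}

/-- Units with treatment `t` and labelling `b`. -/
def cell (t b : Bool) : Set (Subject 𝒳 𝒮) := {ω | T ω = t ∧ R ω = b}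

/-- Probability of a cell given covariates. -/
def cellProb (π η : Bool → 𝒳 → ℝ) (t b : Bool) (x : 𝒳) : ℝ :=
  π t x * if b then η t x else 1 - η t x

/-- Actual data. -/
def actual (ω : Subject 𝒳 𝒮) : 𝒳 × Bool × Bool × 𝒮 × ℝ := (X ω, T ω, R ω, S ω, Y ω)

/-- Actual data in a cell. -/
def act (t b : Bool) (z : 𝒳 × 𝒮 × ℝ) : 𝒳 × Bool × Bool × 𝒮 × ℝ := (z.1, t, b, z.2.1, z.2.2)

/-- The subject with given treatment, labelling and potential variables. -/
def subject (t b : Bool) (u : 𝒳 × (Bool → 𝒮) × (Bool → ℝ)) : Subject 𝒳 𝒮 :=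
  (u.1, t, b, u.2.1, u.2.2)

theorem arm_eq_union (t : Bool) :
    (T ⁻¹' {t} : Set (Subject 𝒳 𝒮)) = cell t true ∪ cell t false := by
  ext ω
  cases hR : R ω <;> simp [cell, hR]

theorem disjoint_cell (t : Bool) :
    Disjoint (cell t true : Set (Subject 𝒳 𝒮)) (cell t false) := by
  rw [Set.disjoint_left]
  rintro ω ⟨-, h1⟩ ⟨-, h2⟩
  rw [h1] at h2
  exact absurd h2 (by simp)

theorem actual_eq {t b : Bool} {ω : Subject 𝒳 𝒮} (h : ω ∈ cell t b) :
    actual ω = act t b (armData t ω) := by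
  obtain ⟨h1, h2⟩ := h
  simp [actual, act, armData, S, Y, h1, h2]

theorem cellProb_add (π η : Bool → 𝒳 → ℝ) (t : Bool) (x : 𝒳) :
    cellProb π η t true x + cellProb π η t false x = π t x := by
  simp [cellProb]; ring

variable [MeasurableSpace 𝒳] [MeasurableSpace 𝒮]

theorem measurableSet_cell (t b : Bool) : MeasurableSet (cell t b : Set (Subject 𝒳 𝒮)) :=
  (measurableSet_arm t).inter (measurable_R (measurableSet_singleton b))

theorem measurable_act (t b : Bool) : Measurable (act t b : 𝒳 × 𝒮 × ℝ → _) := by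
  unfold act; fun_prop

theorem measurable_subject (t b : Bool) :
    Measurable (subject t b : 𝒳 × (Bool → 𝒮) × (Bool → ℝ) → _) := by
  unfold subject; fun_prop

theorem measurable_actual : Measurable (actual : Subject 𝒳 𝒮 → _) :=
  measurable_X.prodMk (measurable_T.prodMk (measurable_R.prodMk
    ((measurable_bool_apply (w := fun t (ω : Subject 𝒳 𝒮) => Spot t ω) measurable_Spot
      measurable_T measurable_id).prodMk
    (measurable_bool_apply (w := fun t (ω : Subject 𝒳 𝒮) => Ypot t ω) measurable_Ypot
      measurable_T measurable_id))))

theorem eq_sum_cells (Q : Measure (Subject 𝒳 𝒮)) :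
    Q = (Q.restrict (cell true true) + Q.restrict (cell true false))
      + (Q.restrict (cell false true) + Q.restrict (cell false false)) := by
  have h1 : ∀ t, Q.restrict (cell t true) + Q.restrict (cell t false) = Q.restrict (T ⁻¹' {t}) :=
    fun t => by
      rw [arm_eq_union, Measure.restrict_union (disjoint_cell t) (measurableSet_cell t false)]
  have hc : (T ⁻¹' {false} : Set (Subject 𝒳 𝒮)) = (T ⁻¹' {true})ᶜ := by ext ω; simp
  rw [h1, h1, hc, Measure.restrict_add_restrict_compl (measurableSet_arm true)]

/-- Within a cell the actual data are a function of one arm only, so the joint behaviour of the two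
arms is invisible. -/
theorem map_actual_eq {Q Q' : Measure (Subject 𝒳 𝒮)}
    (h : ∀ t b, (Q.restrict (cell t b)).map (armData t) = (Q'.restrict (cell t b)).map (armData t)) :
    Q.map actual = Q'.map actual := by
  have h1 : ∀ (Q : Measure (Subject 𝒳 𝒮)) t b, (Q.restrict (cell t b)).map actual
      = ((Q.restrict (cell t b)).map (armData t)).map (act t b) := by
    intro Q t b
    rw [Measure.map_map (measurable_act t b) (measurable_armData t)]
    refine Measure.map_congr ?_
    filter_upwards [ae_restrict_mem (measurableSet_cell t b)] with ω hω
    exact actual_eq hω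
  rw [eq_sum_cells Q, eq_sum_cells Q']
  simp only [Measure.map_add _ _ measurable_actual, h1, h]

namespace IsWeights

variable {ε : ℝ} {π η : Bool → 𝒳 → ℝ}

theorem measurable_cellProb (h : IsWeights ε π η) (t b : Bool) : Measurable (cellProb π η t b) := by
  cases b
  · exact (h.measurable_treat t).mul (measurable_const.sub (h.measurable_label t))
  · exact (h.measurable_treat t).mul (h.measurable_label t)

theorem cellProb_nonneg (h : IsWeights ε π η) (hε : 0 < ε) (t b : Bool) (x : 𝒳) :
    0 ≤ cellProb π η t b x := by
  have h1 := h.treat_mem t x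
  have h2 := h.label_mem t x
  refine mul_nonneg (hε.le.trans h1.1) ?_
  cases b
  · simpa using h2.2
  · simpa using hε.le.trans h2.1

theorem sum_cellProb (h : IsWeights ε π η) (hε : 0 < ε) (x : 𝒳) :
    (ENNReal.ofReal (cellProb π η true true x) + ENNReal.ofReal (cellProb π η true false x))
      + (ENNReal.ofReal (cellProb π η false true x)
        + ENNReal.ofReal (cellProb π η false false x)) = 1 := by
  have h1 := fun t b => h.cellProb_nonneg hε t b x
  rw [← ENNReal.ofReal_add (h1 _ _) (h1 _ _), ← ENNReal.ofReal_add (h1 _ _) (h1 _ _),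
    ← ENNReal.ofReal_add (add_nonneg (h1 _ _) (h1 _ _)) (add_nonneg (h1 _ _) (h1 _ _)),
    cellProb_add, cellProb_add, h.treat_add, ENNReal.ofReal_one]

end IsWeights

theorem IsRandomized.isPropensity_cell {ε : ℝ} (hε : 0 < ε) {P : Measure (Subject 𝒳 𝒮)}
    [IsFiniteMeasure P] {π η : Bool → 𝒳 → ℝ} (h : IsRandomized ε P π η) (t b : Bool) :
    IsPropensity P (cell t b) (armData t) fun z => ENNReal.ofReal (cellProb π η t b z.1) := by
  cases b
  · have h1 := IsPropensity.diff (measurable_armData t) (h.treat t) (h.label t)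
      (fun ω hω => hω.1) (measurableSet_labelled t)
      ((h.measurable_treat t).comp measurable_fst)
      (((h.measurable_treat t).mul (h.measurable_label t)).comp measurable_fst)
      (fun z => mul_nonneg (hε.le.trans (h.treat_mem t z.1).1) (hε.le.trans (h.label_mem t z.1).1))
      (fun z => mul_le_of_le_one_right (hε.le.trans (h.treat_mem t z.1).1) (h.label_mem t z.1).2)
    have h2 : (T ⁻¹' {t} \ labelled t : Set (Subject 𝒳 𝒮)) = cell t false := by
      ext ω; cases hR : R ω <;> simp [labelled, cell, hR]
    rw [h2] at h1
    refine h1.congr (ae_of_all _ fun z => ?_)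
    simp [cellProb, mul_sub]
  · have h2 : (labelled t : Set (Subject 𝒳 𝒮)) = cell t true := rfl
    have h1 := h.label t
    rw [h2] at h1
    simpa [cellProb] using h1

/-- Treatment and labelling drawn given covariates, independently of the potential variables. -/
def assemble (π η : Bool → 𝒳 → ℝ) (Λ : Measure (𝒳 × (Bool → 𝒮) × (Bool → ℝ))) :
    Measure (Subject 𝒳 𝒮) :=
  let c : Bool → Bool → Measure (Subject 𝒳 𝒮) := fun t b =>
    (Λ.withDensity fun u => ENNReal.ofReal (cellProb π η t b u.1)).map (subject t b)
  (c true true + c true false) + (c false true + c false false)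

theorem assemble_restrict_cell (π η : Bool → 𝒳 → ℝ) (Λ : Measure (𝒳 × (Bool → 𝒮) × (Bool → ℝ)))
    (t b : Bool) : (assemble π η Λ).restrict (cell t b)
      = (Λ.withDensity fun u => ENNReal.ofReal (cellProb π η t b u.1)).map (subject t b) := by
  have h1 : ∀ t' b', ((Λ.withDensity fun u => ENNReal.ofReal (cellProb π η t' b' u.1)).map
      (subject t' b')).restrict (cell t b) = if t' = t ∧ b' = b then
      (Λ.withDensity fun u => ENNReal.ofReal (cellProb π η t' b' u.1)).map (subject t' b')
      else 0 := by
    intro t' b'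
    rw [Measure.restrict_map (measurable_subject t' b') (measurableSet_cell t b)]
    split_ifs with h
    · have : subject t' b' ⁻¹' cell t b = (Set.univ : Set (𝒳 × (Bool → 𝒮) × (Bool → ℝ))) := by
        ext u; simpa [cell, subject, T, R] using h
      rw [this, Measure.restrict_univ]
    · have : subject t' b' ⁻¹' cell t b = (∅ : Set (𝒳 × (Bool → 𝒮) × (Bool → ℝ))) := by
        ext u; simpa [cell, subject, T, R] using h
      rw [this, Measure.restrict_empty, Measure.map_zero]
  unfold assemble
  simp only [Measure.restrict_add, h1]
  cases t <;> cases b <;> simp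

/-- Each of the four pieces reweights Λ by the probability of its cell, and these probabilities sum
to one. -/
theorem map_potData_assemble {ε : ℝ} (hε : 0 < ε) {π η : Bool → 𝒳 → ℝ} (h : IsWeights ε π η)
    (Λ : Measure (𝒳 × (Bool → 𝒮) × (Bool → ℝ))) : (assemble π η Λ).map potData = Λ := by
  have hm : ∀ t b, Measurable fun u : 𝒳 × (Bool → 𝒮) × (Bool → ℝ) =>
      ENNReal.ofReal (cellProb π η t b u.1) := fun t b =>
    ((h.measurable_cellProb t b).comp measurable_fst).ennreal_ofReal
  have h1 : ∀ t b (μ : Measure (𝒳 × (Bool → 𝒮) × (Bool → ℝ))),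
      (μ.map (subject t b)).map potData = μ := by
    intro t b μ
    rw [Measure.map_map measurable_potData (measurable_subject t b)]
    exact Measure.map_id
  unfold assemble
  simp only [Measure.map_add _ _ measurable_potData, h1]
  rw [← withDensity_add_left (hm _ _), ← withDensity_add_left (hm _ _),
    ← withDensity_add_left ((hm _ _).add (hm _ _))]
  have h2 : ((fun u : 𝒳 × (Bool → 𝒮) × (Bool → ℝ) => ENNReal.ofReal (cellProb π η true true u.1))
      + fun u => ENNReal.ofReal (cellProb π η true false u.1))
      + ((fun u => ENNReal.ofReal (cellProb π η false true u.1))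
        + fun u => ENNReal.ofReal (cellProb π η false false u.1)) = 1 := by
    funext u
    exact h.sum_cellProb hε u.1
  rw [h2, withDensity_one]

theorem isPropensity_cell_assemble {ε : ℝ} (hε : 0 < ε) {π η : Bool → 𝒳 → ℝ} (h : IsWeights ε π η)
    (Λ : Measure (𝒳 × (Bool → 𝒮) × (Bool → ℝ))) (t b : Bool) :
    IsPropensity (assemble π η Λ) (cell t b) potData
      fun u => ENNReal.ofReal (cellProb π η t b u.1) := by
  unfold IsPropensity
  rw [assemble_restrict_cell, map_potData_assemble hε h,
    Measure.map_map measurable_potData (measurable_subject t b)]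
  exact Measure.map_id

/-- `P'` has the same law of each arm as `P`, treatment and labelling depend on covariates only,
and the arms are independent given covariates. -/
structure IsDecoupling (P P' : Measure (Subject 𝒳 𝒮)) (π η : Bool → 𝒳 → ℝ) : Prop where
  isProbabilityMeasure : IsProbabilityMeasure P'
  cell : ∀ t b, IsPropensity P' (cell t b) potData fun u => ENNReal.ofReal (cellProb π η t b u.1)
  arm : ∀ t, P'.map (armData t) = P.map (armData t)
  indep : ∀ (t b : Bool) (K d : 𝒳 × 𝒮 × ℝ → ℝ), Measurable K → Measurable d →
    Integrable (fun ω => d (armData t ω)) P →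
    (∀ c : 𝒳 → ℝ, Measurable c → ∫ ω, c (X ω) * d (armData t ω) ∂P = 0) →
    ∫ ω in SurrogateATE.cell (!t) b, K (armData (!t) ω) * d (armData t ω) ∂P' = 0

/-- Testing with indicators of sets of values of `V` shows that 0 is a conditional expectation of
the integrand; the conditional kernel computes the same conditional expectation. The kernel form is
needed to integrate fibre by fibre over a product of kernels. -/
theorem integral_condDistrib_eq_zero {Ω β : Type*} [MeasurableSpace Ω] [MeasurableSpace β]
    [StandardBorelSpace β] [Nonempty β] {P : Measure Ω} [IsFiniteMeasure P] {V : Ω → 𝒳} {W : Ω → β}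
    (hV : Measurable V) (hW : Measurable W) {d : 𝒳 × β → ℝ} (hd : Measurable d)
    (hi : Integrable (fun ω => d (V ω, W ω)) P)
    (h0 : ∀ c : 𝒳 → ℝ, Measurable c → ∫ ω, c (V ω) * d (V ω, W ω) ∂P = 0) :
    ∀ᵐ x ∂P.map V, ∫ b, d (x, b) ∂condDistrib W V P x = 0 := by
  have h1 := condExp_prod_ae_eq_integral_condDistrib hV hW.aemeasurable hd.stronglyMeasurable hi
  have h2 : (0 : Ω → ℝ) =ᵐ[P] P[fun ω => d (V ω, W ω) | MeasurableSpace.comap V inferInstance] := by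
    refine ae_eq_condExp_of_forall_setIntegral_eq hV.comap_le hi (fun _ _ _ => integrableOn_zero)
      ?_ aestronglyMeasurable_zero
    rintro _ ⟨A, hA, rfl⟩ -
    have h3 := h0 (A.indicator 1) (measurable_one.indicator hA)
    have h4 : ∀ ω, A.indicator (1 : 𝒳 → ℝ) (V ω) * d (V ω, W ω)
        = (V ⁻¹' A).indicator (fun ω => d (V ω, W ω)) ω := by
      intro ω
      by_cases hω : V ω ∈ A
      · rw [Set.indicator_of_mem hω, Set.indicator_of_mem (show ω ∈ V ⁻¹' A from hω)]; simp
      · rw [Set.indicator_of_notMem hω, Set.indicator_of_notMem (show ω ∉ V ⁻¹' A from hω)]; simp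
    simp_rw [h4] at h3
    rw [integral_indicator (hV hA)] at h3
    simp [h3]
  have m1 : Measurable fun x => ∫ b, d (x, b) ∂condDistrib W V P x :=
    (hd.stronglyMeasurable.integral_condDistrib).measurable
  refine (ae_map_iff hV.aemeasurable (measurableSet_eq_fun m1 measurable_const)).2 ?_
  filter_upwards [h1, h2] with ω a b
  rw [← a, ← b]; rfl

/-- Combine the data of both arms. -/
def joinArms (v : 𝒳 × (𝒮 × ℝ) × (𝒮 × ℝ)) : 𝒳 × (Bool → 𝒮) × (Bool → ℝ) :=
  (v.1, fun t => bif t then v.2.2.1 else v.2.1.1, fun t => bif t then v.2.2.2 else v.2.1.2)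

theorem measurable_joinArms : Measurable (joinArms : 𝒳 × (𝒮 × ℝ) × (𝒮 × ℝ) → _) := by
  refine measurable_fst.prodMk (Measurable.prodMk ?_ ?_) <;>
  · refine measurable_pi_iff.2 fun t => ?_
    cases t <;> simp only [cond_true, cond_false] <;> fun_prop

variable [StandardBorelSpace 𝒮]

/-- Draw X from its law, then the pairs (S(t), Y(t)) of the two arms independently from their
conditional laws given X, then treatment and labelling given X alone. Each arm keeps its law, while
the dependence between arms, and between the counterfactual arm and treatment or labelling, is
removed given X. -/
theorem exists_isDecoupling {ε : ℝ} (hε : 0 < ε) {P : Measure (Subject 𝒳 𝒮)}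
    [IsProbabilityMeasure P] [Nonempty 𝒮] {π η : Bool → 𝒳 → ℝ} (h : IsWeights ε π η) :
    ∃ P' : Measure (Subject 𝒳 𝒮), IsDecoupling P P' π η := by
  let W : Bool → Subject 𝒳 𝒮 → 𝒮 × ℝ := fun t ω => (Spot t ω, Ypot t ω)
  have mW : ∀ t, Measurable (W t) := fun t => (measurable_Spot t).prodMk (measurable_Ypot t)
  let κ : Bool → Kernel 𝒳 (𝒮 × ℝ) := fun t => condDistrib (W t) X P
  let Λ₀ : Measure (𝒳 × (𝒮 × ℝ) × (𝒮 × ℝ)) := (P.map X) ⊗ₘ (κ false ×ₖ κ true)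
  have hPX : IsProbabilityMeasure (P.map X) :=
    Measure.isProbabilityMeasure_map measurable_X.aemeasurable
  have hΛ₀ : IsProbabilityMeasure Λ₀ := by infer_instance
  let Λ : Measure (𝒳 × (Bool → 𝒮) × (Bool → ℝ)) := Λ₀.map joinArms
  have hΛ : IsProbabilityMeasure Λ :=
    Measure.isProbabilityMeasure_map measurable_joinArms.aemeasurable
  have hpot := map_potData_assemble hε h Λ
  have harm : ∀ t, Λ.map (armOf t) = P.map (armData t) := by
    intro t
    have h1 : P.map (armData t) = (P.map X) ⊗ₘ κ t := by
      rw [compProd_map_condDistrib (mW t).aemeasurable]; rfl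
    rw [h1, Measure.map_map (measurable_armOf t) measurable_joinArms]
    cases t
    · have h2 : armOf false ∘ (joinArms : 𝒳 × (𝒮 × ℝ) × (𝒮 × ℝ) → _)
          = Prod.map id Prod.fst := by funext v; rfl
      rw [h2, ← Measure.compProd_map measurable_fst, ← Kernel.fst_eq, Kernel.fst_prod]
    · have h2 : armOf true ∘ (joinArms : 𝒳 × (𝒮 × ℝ) × (𝒮 × ℝ) → _)
          = Prod.map id Prod.snd := by funext v; rfl
      rw [h2, ← Measure.compProd_map measurable_snd, ← Kernel.snd_eq, Kernel.snd_prod]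
  refine ⟨assemble π η Λ, ?_, isPropensity_cell_assemble hε h Λ, ?_, ?_⟩
  · have : IsProbabilityMeasure ((assemble π η Λ).map potData) := by rw [hpot]; exact hΛ
    exact (Measure.isProbabilityMeasure_map_iff measurable_potData.aemeasurable).1 this
  · intro t
    have h1 : (armData t : Subject 𝒳 𝒮 → _) = armOf t ∘ potData := rfl
    rw [h1, ← Measure.map_map (measurable_armOf t) measurable_potData, hpot, harm]
    rfl
  · intro t b K d mK md hi h0
    have hz : ∀ᵐ x ∂P.map X, ∫ z, d (x, z) ∂κ t x = 0 :=
      integral_condDistrib_eq_zero measurable_X (mW t) md hi h0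
    have mF : Measurable fun ω : Subject 𝒳 𝒮 => K (armData (!t) ω) * d (armData t ω) :=
      (mK.comp (measurable_armData _)).mul (md.comp (measurable_armData _))
    have mc : Measurable fun u : 𝒳 × (Bool → 𝒮) × (Bool → ℝ) =>
        ENNReal.ofReal (cellProb π η (!t) b u.1) :=
      ((h.measurable_cellProb (!t) b).comp measurable_fst).ennreal_ofReal
    rw [assemble_restrict_cell, integral_map (measurable_subject _ _).aemeasurable
      mF.aestronglyMeasurable, integral_withDensity_eq_integral_toReal_smul mc (by simp)]
    simp only [ENNReal.toReal_ofReal (h.cellProb_nonneg hε _ _ _), smul_eq_mul]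
    have mG : Measurable fun u : 𝒳 × (Bool → 𝒮) × (Bool → ℝ) => cellProb π η (!t) b u.1
        * (K (armOf (!t) u) * d (armOf t u)) :=
      ((h.measurable_cellProb (!t) b).comp measurable_fst).mul
        ((mK.comp (measurable_armOf _)).mul (md.comp (measurable_armOf _)))
    change ∫ u, cellProb π η (!t) b u.1 * (K (armOf (!t) u) * d (armOf t u)) ∂Λ = 0
    rw [integral_map measurable_joinArms.aemeasurable mG.aestronglyMeasurable]
    -- K is an arbitrary measurable function; where the product is not integrable its integral is 0
    -- by convention.
    by_cases hint : Integrable (fun v => cellProb π η (!t) b (joinArms v).1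
        * (K (armOf (!t) (joinArms v)) * d (armOf t (joinArms v)))) Λ₀
    swap
    · exact integral_undef hint
    -- Given x the arms are independent, so the fibre integral factors, and the factor belonging to
    -- d vanishes for almost every x.
    rw [Measure.integral_compProd hint]
    refine integral_eq_zero_of_ae ?_
    filter_upwards [hz] with x hx
    rw [Kernel.prod_apply, Pi.zero_apply]
    cases t
    · have := integral_prod_mul (μ := κ false x) (ν := κ true x)
        (fun a => d (x, a)) fun a => K (x, a)
      rw [hx, zero_mul] at this
      rw [← mul_zero (cellProb π η true b x), ← this, ← integral_const_mul]
      refine integral_congr_ae (ae_of_all _ fun a => ?_)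
      simp only [joinArms, armOf, Bool.not_false, cond_true, cond_false]
      ring
    · have := integral_prod_mul (μ := κ false x) (ν := κ true x)
        (fun a => K (x, a)) fun a => d (x, a)
      rw [hx, mul_zero] at this
      rw [← mul_zero (cellProb π η false b x), ← this, ← integral_const_mul]
      refine integral_congr_ae (ae_of_all _ fun a => ?_)
      simp only [joinArms, armOf, Bool.not_true, cond_true, cond_false]

end Decoupling

/-! ### Tangent directions -/

section Tangent

open scoped ENNReal

/-! ### Bounded tilts, their observed laws and scores; approximation by bounded functions. -/

section Abstract

theorem tilt_nonneg {β : Type*} {F : β → ℝ} {M γ : ℝ} (hM : ∀ b, |F b| ≤ M) (hγ : |γ| * M ≤ 1) (b : β) :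
    0 ≤ 1 + γ * F b := by
  have h1 : |γ * F b| ≤ 1 := by
    rw [abs_mul]; exact (mul_le_mul_of_nonneg_left (hM b) (abs_nonneg γ)).trans hγ
  linarith [(abs_le.1 h1).1]

variable {Ω O α : Type*} [MeasurableSpace Ω] [MeasurableSpace O] [MeasurableSpace α]

/-- g is the conditional mean of F given `obs`, written as a function of the observation and
truncated at ±M so that the bound holds everywhere instead of almost everywhere. -/
theorem exists_factor_condExp {μ : Measure Ω} [IsProbabilityMeasure μ] {obs : Ω → O}
    (hobs : Measurable obs) {F : Ω → ℝ} (hF : Measurable F) {M : ℝ} (hM : ∀ ω, |F ω| ≤ M) :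
    ∃ g : O → ℝ, Measurable g ∧ (∀ o, |g o| ≤ M) ∧
      ∀ k : O → ℝ, Measurable k → Integrable k (μ.map obs) →
        ∫ ω, k (obs ω) * F ω ∂μ = ∫ o, k o * g o ∂μ.map obs := by
  have hμ : IsProbabilityMeasure (μ.map obs) :=
    Measure.isProbabilityMeasure_map hobs.aemeasurable
  have hM0 : 0 ≤ M := by
    have : Nonempty Ω := nonempty_of_isProbabilityMeasure μ
    exact (abs_nonneg _).trans (hM (Classical.arbitrary Ω))
  have hFi : Integrable F μ :=
    Integrable.of_bound hF.aestronglyMeasurable M (ae_of_all _ hM)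
  obtain ⟨g₀, hg₀, hg₀'⟩ := (stronglyMeasurable_condExp (μ := μ) (f := F)
    (m := MeasurableSpace.comap obs inferInstance)).measurable.exists_eq_measurable_comp
  have hb : ∀ᵐ ω ∂μ, |(μ[F | MeasurableSpace.comap obs inferInstance]) ω| ≤ M.toNNReal :=
    ae_bdd_abs_condExp_of_ae_bdd_abs (ae_of_all _ fun ω => by
      rw [Real.coe_toNNReal _ hM0]; exact hM ω)
  rw [Real.coe_toNNReal _ hM0] at hb
  refine ⟨fun o => max (-M) (min M (g₀ o)), measurable_const.max (measurable_const.min hg₀),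
    fun o => abs_le.2 ⟨le_max_left _ _, max_le (by linarith) (min_le_left _ _)⟩, fun k hk hki => ?_⟩
  have hki' : Integrable (fun ω => k (obs ω)) μ := hki.comp_measurable hobs
  have hkF : Integrable (fun ω => k (obs ω) * F ω) μ :=
    hki'.mul_bdd hF.aestronglyMeasurable (ae_of_all _ hM)
  have mg : Measurable fun o => k o * max (-M) (min M (g₀ o)) :=
    hk.mul (measurable_const.max (measurable_const.min hg₀))
  rw [integral_map hobs.aemeasurable mg.aestronglyMeasurable, ← integral_condExp hobs.comap_le]
  refine integral_congr_ae ?_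
  have hp := condExp_mul_of_stronglyMeasurable_left (μ := μ)
    (m := MeasurableSpace.comap obs inferInstance) (f := fun ω => k (obs ω)) (g := F)
    (hk.comp (comap_measurable obs)).stronglyMeasurable hkF hFi
  filter_upwards [hp, hb] with ω h1 h2
  refine h1.trans ?_
  rw [hg₀', abs_le] at h2
  simp only [Function.comp_apply] at h2
  rw [Pi.mul_apply, hg₀', Function.comp_apply, min_eq_right h2.2, max_eq_right h2.1]

theorem isProbabilityMeasure_tilt {μ : Measure Ω} [IsProbabilityMeasure μ] {F : Ω → ℝ}
    (hF : Measurable F) {M γ : ℝ} (hM : ∀ ω, |F ω| ≤ M) (h0 : ∫ ω, F ω ∂μ = 0)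
    (hγ : |γ| * M ≤ 1) :
    IsProbabilityMeasure (μ.withDensity fun ω => ENNReal.ofReal (1 + γ * F ω)) := by
  have hFi : Integrable F μ := Integrable.of_bound hF.aestronglyMeasurable M (ae_of_all _ hM)
  constructor
  have hi : Integrable (fun ω => 1 + γ * F ω) μ := (integrable_const 1).add (hFi.const_mul γ)
  rw [withDensity_apply _ MeasurableSet.univ, Measure.restrict_univ,
    ← ofReal_integral_eq_lintegral_ofReal hi
      (ae_of_all _ (tilt_nonneg hM hγ)), integral_add (integrable_const 1) (hFi.const_mul γ),
    integral_const_mul, h0]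
  simp

/-- Averaging the density 1 + γF given the observation turns F into its conditional mean g. -/
theorem map_tilt {μ : Measure Ω} [IsProbabilityMeasure μ] {obs : Ω → O}
    (hobs : Measurable obs) {F : Ω → ℝ} (hF : Measurable F) {M : ℝ} (hM : ∀ ω, |F ω| ≤ M)
    {g : O → ℝ} (hg : Measurable g) (hgM : ∀ o, |g o| ≤ M)
    (hk : ∀ k : O → ℝ, Measurable k → Integrable k (μ.map obs) →
        ∫ ω, k (obs ω) * F ω ∂μ = ∫ o, k o * g o ∂μ.map obs) {γ : ℝ} (hγ : |γ| * M ≤ 1) :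
    (μ.withDensity fun ω => ENNReal.ofReal (1 + γ * F ω)).map obs
      = (μ.map obs).withDensity fun o => ENNReal.ofReal (1 + γ * g o) := by
  have hμ : IsProbabilityMeasure (μ.map obs) :=
    Measure.isProbabilityMeasure_map hobs.aemeasurable
  have hFi : Integrable F μ := Integrable.of_bound hF.aestronglyMeasurable M (ae_of_all _ hM)
  have hgi : Integrable g (μ.map obs) :=
    Integrable.of_bound hg.aestronglyMeasurable M (ae_of_all _ hgM)
  ext A hA
  have i1 : Integrable (fun ω => 1 + γ * F ω) μ := (integrable_const 1).add (hFi.const_mul γ)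
  have i2 : Integrable (fun o => 1 + γ * g o) (μ.map obs) :=
    (integrable_const 1).add (hgi.const_mul γ)
  rw [Measure.map_apply hobs hA, withDensity_apply _ (hobs hA), withDensity_apply _ hA,
    ← ofReal_integral_eq_lintegral_ofReal i1.integrableOn (ae_of_all _ (tilt_nonneg hM hγ)),
    ← ofReal_integral_eq_lintegral_ofReal i2.integrableOn (ae_of_all _ (tilt_nonneg hgM hγ))]
  congr 1
  rw [integral_add (integrable_const 1) (hFi.const_mul γ).integrableOn,
    integral_add (integrable_const 1) (hgi.const_mul γ).integrableOn, integral_const_mul,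
    integral_const_mul]
  have h1 := hk (A.indicator 1) (measurable_one.indicator hA)
    ((integrable_const (1 : ℝ)).indicator hA)
  have h2 : ∀ ω, A.indicator (1 : O → ℝ) (obs ω) * F ω = (obs ⁻¹' A).indicator F ω := by
    intro ω
    by_cases hω : obs ω ∈ A
    · rw [Set.indicator_of_mem hω, Set.indicator_of_mem (show ω ∈ obs ⁻¹' A from hω)]; simp
    · rw [Set.indicator_of_notMem hω, Set.indicator_of_notMem (show ω ∉ obs ⁻¹' A from hω)]; simp
  have h3 : ∀ o, A.indicator (1 : O → ℝ) o * g o = A.indicator g o := by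
    intro o
    by_cases ho : o ∈ A <;> simp [ho]
  simp_rw [h2, h3] at h1
  rw [integral_indicator (hobs hA), integral_indicator hA] at h1
  rw [h1]
  simp [measureReal_def, Measure.map_apply hobs hA]

open Classical in
/-- A bounded mean-zero tilt of a law with the right observed law gives a score. -/
theorem exists_mem_tangentSet {𝓜 : Set (ProbabilityMeasure Ω)} {P P' : ProbabilityMeasure Ω}
    {obs : Ω → O} (hobs : Measurable obs) (hPP' : obsLaw obs P' = obsLaw obs P) {F : Ω → ℝ}
    (hF : Measurable F) {M : ℝ} (hM : ∀ ω, |F ω| ≤ M) (h0 : ∫ ω, F ω ∂(P' : Measure Ω) = 0)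
    (hmem : ∀ (γ : ℝ) (Q : ProbabilityMeasure Ω), |γ| * M ≤ 1 →
      (Q : Measure Ω) = (P' : Measure Ω).withDensity (fun ω => ENNReal.ofReal (1 + γ * F ω)) →
      Q ∈ 𝓜) :
    ∃ g : Lp ℝ 2 (obsLaw obs P), g ∈ tangentSet 𝓜 obs P ∧
      ∀ k : Lp ℝ 2 (obsLaw obs P), inner ℝ k g = ∫ ω, k (obs ω) * F ω ∂(P' : Measure Ω) := by
  have hμ : IsProbabilityMeasure (obsLaw obs P) :=
    Measure.isProbabilityMeasure_map hobs.aemeasurable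
  obtain ⟨g, mg, hgM, hg⟩ := exists_factor_condExp (μ := (P' : Measure Ω)) hobs hF hM
  have hgL : MemLp g 2 (obsLaw obs P) := MemLp.of_bound mg.aestronglyMeasurable M (ae_of_all _ hgM)
  -- For |γ| M ≤ 1 the tilted density is nonnegative with mean one. The value P' for other γ is
  -- immaterial, since only γ near 0 counts.
  let Q : ℝ → ProbabilityMeasure Ω := fun γ => if hγ : |γ| * M ≤ 1 then
    ⟨(P' : Measure Ω).withDensity fun ω => ENNReal.ofReal (1 + γ * F ω),
      isProbabilityMeasure_tilt hF hM h0 hγ⟩ else P'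
  have hQ : ∀ γ, |γ| * M ≤ 1 → (Q γ : Measure Ω)
      = (P' : Measure Ω).withDensity fun ω => ENNReal.ofReal (1 + γ * F ω) := by
    intro γ hγ
    have h1 : Q γ = ⟨(P' : Measure Ω).withDensity fun ω => ENNReal.ofReal (1 + γ * F ω),
      isProbabilityMeasure_tilt hF hM h0 hγ⟩ := dif_pos hγ
    rw [h1]
    rfl
  have hQmap : ∀ γ, |γ| * M ≤ 1 → (Q γ : Measure Ω).map obs
      = (obsLaw obs P).withDensity fun o => ENNReal.ofReal (1 + γ * g o) := by
    intro γ hγ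
    rw [hQ γ hγ, map_tilt hobs hF hM mg hgM hg hγ,
      show (P' : Measure Ω).map obs = obsLaw obs P from hPP']
  have hsmall : ∀ᶠ γ in 𝓝 (0 : ℝ), |γ| * M ≤ 1 := by
    have h1 : Tendsto (fun γ : ℝ => |γ| * M) (𝓝 0) (𝓝 (|0| * M)) :=
      (continuous_abs.mul continuous_const).tendsto 0
    rw [abs_zero, zero_mul] at h1
    filter_upwards [h1.eventually_lt_const one_pos] with γ hγ using hγ.le
  refine ⟨hgL.toLp, ⟨Q, ?_, ?_, ?_, ?_⟩, fun k => ?_⟩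
  · filter_upwards [hsmall] with γ hγ using hmem γ _ hγ (hQ γ hγ)
  · rw [hQmap 0 (by simp)]
    simp
  · filter_upwards [hsmall] with γ hγ
    rw [hQmap γ hγ]
    exact withDensity_absolutelyContinuous _ _
  -- The tilt is linear in γ, so the difference quotient of the likelihood ratio equals g almost
  -- everywhere: the distance is zero, not merely small.
  · refine (tendsto_congr' ?_).2 tendsto_const_nhds
    filter_upwards [hsmall.filter_mono nhdsWithin_le_nhds, self_mem_nhdsWithin] with γ hγ hγ0
    have hγ0 : γ ≠ 0 := hγ0
    rw [← eLpNorm_zero (μ := obsLaw obs P) (p := 2) (ε := ℝ)]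
    refine eLpNorm_congr_ae ?_
    rw [hQmap γ hγ]
    have md : Measurable fun o => ENNReal.ofReal (1 + γ * g o) :=
      (measurable_const.add (mg.const_mul γ)).ennreal_ofReal
    filter_upwards [Measure.rnDeriv_withDensity (obsLaw obs P) md, hgL.coeFn_toLp] with o h1 h2
    rw [h1, h2, ENNReal.toReal_ofReal (tilt_nonneg hgM hγ o)]
    simp only [Pi.zero_apply]
    field_simp
    ring
  · have mk : Measurable (k : O → ℝ) := (Lp.stronglyMeasurable k).measurable
    have ki : Integrable k (obsLaw obs P) := (Lp.memLp k).integrable (by norm_num)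
    rw [hg k mk (by rw [show (P' : Measure Ω).map obs = obsLaw obs P from hPP']; exact ki),
      show (P' : Measure Ω).map obs = obsLaw obs P from hPP', L2.inner_def]
    refine integral_congr_ae ?_
    filter_upwards [hgL.coeFn_toLp] with o ho
    rw [ho]
    simp [mul_comm]

/-- Orthogonality to bounded mean-zero functions of `V` extends to square-integrable ones. -/
theorem integral_mul_eq_zero_of_bounded {μ : Measure Ω} [IsProbabilityMeasure μ] {f : Ω → ℝ}
    (hf : MemLp f 2 μ) {V : Ω → α} (hV : Measurable V)
    (h : ∀ (D : α → ℝ) (M : ℝ), Measurable D → (∀ a, |D a| ≤ M) → ∫ ω, D (V ω) ∂μ = 0 →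
      ∫ ω, f ω * D (V ω) ∂μ = 0)
    {D : α → ℝ} (hD : Measurable D) (hD2 : MemLp (fun ω => D (V ω)) 2 μ)
    (h0 : ∫ ω, D (V ω) ∂μ = 0) : ∫ ω, f ω * D (V ω) ∂μ = 0 := by
  let E : ℕ → α → ℝ := fun n a => if |D a| ≤ n then D a else 0
  have mE : ∀ n, Measurable (E n) := fun n =>
    Measurable.ite (measurableSet_le hD.abs measurable_const) hD measurable_const
  have hEn : ∀ n a, |E n a| ≤ n := fun n a => by
    simp only [E]
    split_ifs with h1
    · exact h1
    · simp
  have hED : ∀ n a, |E n a| ≤ |D a| := fun n a => by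
    simp only [E]
    split_ifs with h1
    · exact le_rfl
    · simp
  have hElim : ∀ a, Tendsto (fun n => E n a) atTop (𝓝 (D a)) := fun a => by
    refine tendsto_const_nhds.congr' ?_
    obtain ⟨n₀, hn₀⟩ := exists_nat_ge |D a|
    filter_upwards [eventually_ge_atTop n₀] with n hn
    simp only [E]
    rw [if_pos (hn₀.trans (by exact_mod_cast hn))]
  have hfi : Integrable f μ := hf.integrable (by norm_num)
  have hDi : Integrable (fun ω => D (V ω)) μ := hD2.integrable (by norm_num)
  have hfD : Integrable (fun ω => f ω * D (V ω)) μ := hf.integrable_mul hD2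
  have hEi : ∀ n, Integrable (fun ω => E n (V ω)) μ := fun n =>
    Integrable.of_bound ((mE n).comp hV).aestronglyMeasurable n (ae_of_all _ fun ω => hEn n _)
  have hfE : ∀ n, Integrable (fun ω => f ω * E n (V ω)) μ := fun n =>
    hfi.mul_bdd ((mE n).comp hV).aestronglyMeasurable (ae_of_all _ fun ω => hEn n _)
  have t1 : Tendsto (fun n => ∫ ω, E n (V ω) ∂μ) atTop (𝓝 0) := by
    rw [← h0]
    refine tendsto_integral_of_dominated_convergence (fun ω => |D (V ω)|)
      (fun n => (hEi n).1) hDi.abs (fun n => ae_of_all _ fun ω => hED n _)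
      (ae_of_all _ fun ω => hElim _)
  have t2 : Tendsto (fun n => ∫ ω, f ω * E n (V ω) ∂μ) atTop (𝓝 (∫ ω, f ω * D (V ω) ∂μ)) := by
    refine tendsto_integral_of_dominated_convergence (fun ω => |f ω * D (V ω)|)
      (fun n => (hfE n).1) hfD.abs (fun n => ae_of_all _ fun ω => ?_)
      (ae_of_all _ fun ω => (hElim _).const_mul _)
    rw [Real.norm_eq_abs, abs_mul, abs_mul]
    exact mul_le_mul_of_nonneg_left (hED n _) (abs_nonneg _)
  -- A truncated D need no longer have mean zero, so the hypothesis is applied to its recentering.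
  -- The correction is the mean of the truncation times the mean of f, and it tends to zero.
  have h2 : ∀ n, ∫ ω, f ω * E n (V ω) ∂μ = (∫ ω, E n (V ω) ∂μ) * ∫ ω, f ω ∂μ := fun n => by
    have h3 := h (fun a => E n a - ∫ ω, E n (V ω) ∂μ) (n + |∫ ω, E n (V ω) ∂μ|)
      ((mE n).sub_const _) (fun a => (abs_sub _ _).trans (add_le_add (hEn n a) le_rfl))
      (by rw [integral_sub (hEi n) (integrable_const _)]; simp)
    simp only [mul_sub] at h3
    rw [integral_sub (hfE n) (hfi.mul_const _), integral_mul_const] at h3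
    linarith
  simp_rw [h2] at t2
  have t3 := t1.mul_const (∫ ω, f ω ∂μ)
  rw [zero_mul] at t3
  exact tendsto_nhds_unique t2 t3

/-- Orthogonality to bounded functions of `V` extends to all functions of `V`. -/
theorem integral_comp_mul_eq_zero_of_bounded {μ : Measure Ω} {V : Ω → α} (hV : Measurable V)
    {f : Ω → ℝ} (h : ∀ (c : α → ℝ) (M : ℝ), Measurable c → (∀ a, |c a| ≤ M) →
      ∫ ω, c (V ω) * f ω ∂μ = 0) {c : α → ℝ} (hc : Measurable c) :
    ∫ ω, c (V ω) * f ω ∂μ = 0 := by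
  by_cases hi : Integrable (fun ω => c (V ω) * f ω) μ
  swap
  · exact integral_undef hi
  have mS : ∀ n : ℕ, MeasurableSet {a | |c a| ≤ n} := fun n =>
    measurableSet_le hc.abs measurable_const
  have h1 : ∀ n : ℕ, ∫ ω in V ⁻¹' {a | |c a| ≤ n}, c (V ω) * f ω ∂μ = 0 := by
    intro n
    rw [← integral_indicator (hV (mS n)), ← h ({a | |c a| ≤ n}.indicator c) n
      (hc.indicator (mS n)) fun a => ?_]
    · refine integral_congr_ae (ae_of_all _ fun ω => ?_)
      by_cases hx : V ω ∈ {a | |c a| ≤ n}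
      · simp only [Set.indicator_of_mem (show ω ∈ V ⁻¹' {a | |c a| ≤ n} from hx),
          Set.indicator_of_mem hx]
      · simp only [Set.indicator_of_notMem (show ω ∉ V ⁻¹' {a | |c a| ≤ n} from hx),
          Set.indicator_of_notMem hx, zero_mul]
    · by_cases hx : a ∈ {a | |c a| ≤ n}
      · rw [Set.indicator_of_mem hx]; exact hx
      · rw [Set.indicator_of_notMem hx]; simp
  have h2 := tendsto_setIntegral_of_monotone (μ := μ) (f := fun ω => c (V ω) * f ω)
    (s := fun n : ℕ => V ⁻¹' {a | |c a| ≤ n}) (fun n => hV (mS n))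
    (fun m n hmn ω hω => le_trans (show |c (V ω)| ≤ m from hω) (by exact_mod_cast hmn))
    hi.integrableOn
  have h3 : (⋃ n : ℕ, V ⁻¹' {a | |c a| ≤ n}) = (Set.univ : Set Ω) :=
    Set.eq_univ_of_forall fun ω => Set.mem_iUnion.2 (exists_nat_ge |c (V ω)|)
  rw [h3, Measure.restrict_univ] at h2
  simp_rw [h1] at h2
  exact (tendsto_nhds_unique h2 tendsto_const_nhds)

end Abstract

end Tangent

/-! ### The weighted regression function lies in the tangent space -/

section TangentSpace

open scoped ENNReal

variable {𝒳 𝒮 O : Type*} [MeasurableSpace 𝒳] [MeasurableSpace 𝒮] [MeasurableSpace O]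

theorem measurable_cellProb_ofReal {ε : ℝ} {π η : Bool → 𝒳 → ℝ} (h : IsWeights ε π η)
    {β : Type*} [MeasurableSpace β] (t b : Bool) :
    Measurable fun u : 𝒳 × β => ENNReal.ofReal (cellProb π η t b u.1) :=
  ((h.measurable_cellProb t b).comp measurable_fst).ennreal_ofReal

namespace IsDecoupling

variable {ε : ℝ} {P P' : Measure (Subject 𝒳 𝒮)} {π η : Bool → 𝒳 → ℝ}

theorem map_restrict_cell (hε : 0 < ε) [IsFiniteMeasure P] (hP : IsRandomized ε P π η)
    (h : IsDecoupling P P' π η) (t b : Bool) :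
    (P'.restrict (SurrogateATE.cell t b)).map (armData t)
      = (P.restrict (SurrogateATE.cell t b)).map (armData t) := by
  have h1 : IsPropensity P' (SurrogateATE.cell t b) (armData t)
      fun z => ENNReal.ofReal (cellProb π η t b z.1) :=
    (h.cell t b).comp measurable_potData (measurable_armOf t) (fun _ => rfl)
      (measurable_cellProb_ofReal hP.toIsWeights t b) (ae_of_all _ fun _ => rfl)
      (measurable_cellProb_ofReal hP.toIsWeights t b)
  have h2 := hP.isPropensity_cell hε t b
  unfold IsPropensity at h1 h2
  rw [h1, h2, h.arm]

theorem map_actual (hε : 0 < ε) [IsFiniteMeasure P] (hP : IsRandomized ε P π η)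
    (h : IsDecoupling P P' π η) : P'.map actual = P.map actual :=
  map_actual_eq (h.map_restrict_cell hε hP)

theorem label (h : IsDecoupling P P' π η) (t : Bool) : IsPropensity P' (labelled t) potData
    fun u => ENNReal.ofReal (π t u.1 * η t u.1) := by
  change IsPropensity P' (SurrogateATE.cell t true) _ _
  simpa [cellProb] using h.cell t true

theorem treat (hε : 0 < ε) (hw : IsWeights ε π η) (h : IsDecoupling P P' π η) (t : Bool) :
    IsPropensity P' (T ⁻¹' {t}) potData fun u => ENNReal.ofReal (π t u.1) := by
  rw [arm_eq_union]
  refine ((h.cell t true).union (h.cell t false) measurable_potData (disjoint_cell t)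
    (measurableSet_cell t false) (measurable_cellProb_ofReal hw t true)).congr
    (ae_of_all _ fun u => ?_)
  beta_reduce
  rw [← ENNReal.ofReal_add (hw.cellProb_nonneg hε _ _ _) (hw.cellProb_nonneg hε _ _ _),
    cellProb_add]

theorem memLp (h : IsDecoupling P P' π η) {t : Bool} {d : 𝒳 × 𝒮 × ℝ → ℝ} (hd : Measurable d)
    (hi : MemLp (fun ω => d (armData t ω)) 2 P) : MemLp (fun ω => d (armData t ω)) 2 P' := by
  have h1 := (memLp_map_measure_iff (f := armData t) (g := d) (p := 2) (μ := P)
    hd.aestronglyMeasurable (measurable_armData t).aemeasurable).2 hi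
  rw [← h.arm] at h1
  exact h1.comp_of_map (measurable_armData t).aemeasurable

theorem integral_eq (h : IsDecoupling P P' π η) (t : Bool) {d : 𝒳 × 𝒮 × ℝ → ℝ}
    (hd : Measurable d) : ∫ ω, d (armData t ω) ∂P' = ∫ ω, d (armData t ω) ∂P := by
  rw [← integral_map (measurable_armData t).aemeasurable hd.aestronglyMeasurable, h.arm,
    integral_map (measurable_armData t).aemeasurable hd.aestronglyMeasurable]

variable [StandardBorelSpace 𝒳] [StandardBorelSpace 𝒮]

/-- The tilt is a density in the potential variables and therefore leaves the conditional law of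
treatment and labelling given them untouched. It is at most 2, so square-integrability of the
outcomes survives. -/
theorem assumptions_tilt (hε : 0 < ε) (hw : IsWeights ε π η) (h : IsDecoupling P P' π η)
    (hY : ∀ t, MemLp (Ypot t) 2 P) {D : 𝒳 × (Bool → 𝒮) × (Bool → ℝ) → ℝ} (hD : Measurable D)
    {M γ : ℝ} (hM : ∀ u, |D u| ≤ M) (hγ : |γ| * M ≤ 1) {Q : Measure (Subject 𝒳 𝒮)}
    [IsProbabilityMeasure Q]
    (hQ : Q = P'.withDensity fun ω => ENNReal.ofReal (1 + γ * D (potData ω))) :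
    Assumptions ε Q := by
  have mf : Measurable fun u => ENNReal.ofReal (1 + γ * D u) :=
    (measurable_const.add (hD.const_mul γ)).ennreal_ofReal
  have mπ : ∀ t, Measurable fun u : 𝒳 × (Bool → 𝒮) × (Bool → ℝ) => ENNReal.ofReal (π t u.1) :=
    fun t => ((hw.measurable_treat t).comp measurable_fst).ennreal_ofReal
  have mη : ∀ t, Measurable fun u : 𝒳 × (Bool → 𝒮) × (Bool → ℝ) =>
      ENNReal.ofReal (π t u.1 * η t u.1) := fun t =>
    (((hw.measurable_treat t).mul (hw.measurable_label t)).comp measurable_fst).ennreal_ofReal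
  refine Assumptions.of_isPropensity hε hw.measurable_treat hw.measurable_label
    (fun t x => (hw.treat_mem t x).1) hw.treat_add hw.label_mem (fun t => ?_) (fun t => ?_)
    fun t => ?_
  · have h1 := (h.treat hε hw t).withDensity measurable_potData (measurableSet_arm t) (mπ t) mf
    rwa [← hQ] at h1
  · have h1 := (h.label t).withDensity measurable_potData (measurableSet_labelled t) (mη t) mf
    rwa [← hQ] at h1
  · have h1 : MemLp (Ypot t) 2 P' :=
      h.memLp (d := fun z => z.2.2) (measurable_snd.comp measurable_snd) (hY t)
    refine h1.of_measure_le_smul (c := 2) (by simp) ?_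
    rw [hQ, ← withDensity_const]
    refine withDensity_mono (ae_of_all _ fun ω => ?_)
    rw [← ENNReal.ofReal_ofNat]
    refine ENNReal.ofReal_le_ofReal ?_
    have h2 : |γ * D (potData ω)| ≤ 1 := by
      rw [abs_mul]; exact (mul_le_mul_of_nonneg_left (hM _) (abs_nonneg γ)).trans hγ
    linarith [(abs_le.1 h2).2]

end IsDecoupling

/-- An element orthogonal to the complement of the tangent directions lies in the tangent space. -/
theorem mem_closure_span_tangentSet [StandardBorelSpace 𝒳] [StandardBorelSpace 𝒮] {ε : ℝ}
    (hε : 0 < ε) {P P' : ProbabilityMeasure (Subject 𝒳 𝒮)} {π η : Bool → 𝒳 → ℝ}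
    (hw : IsWeights ε π η)
    (hD : IsDecoupling (P : Measure (Subject 𝒳 𝒮)) (P' : Measure (Subject 𝒳 𝒮)) π η)
    (hY : ∀ t, MemLp (Ypot t) 2 (P : Measure (Subject 𝒳 𝒮))) {obs : Subject 𝒳 𝒮 → O}
    (hobs : Measurable obs) (hPP' : obsLaw obs P' = obsLaw obs P) {h : Lp ℝ 2 (obsLaw obs P)}
    (hh : ∀ k : Lp ℝ 2 (obsLaw obs P),
      (∀ D : 𝒳 × (Bool → 𝒮) × (Bool → ℝ) → ℝ, Measurable D →
        MemLp (fun ω => D (potData ω)) 2 (P' : Measure (Subject 𝒳 𝒮)) →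
        ∫ ω, D (potData ω) ∂(P' : Measure (Subject 𝒳 𝒮)) = 0 →
        ∫ ω, k (obs ω) * D (potData ω) ∂(P' : Measure (Subject 𝒳 𝒮)) = 0) → inner ℝ k h = 0) :
    h ∈ (Submodule.span ℝ (tangentSet (model 𝒳 𝒮 ε) obs P)).topologicalClosure := by
  -- The closed span is its own double orthogonal complement. A k orthogonal to all scores is
  -- orthogonal under P' to every bounded centered D of the potential variables, each of which
  -- generates a tilt, and then to all square-integrable ones.
  rw [← Submodule.orthogonal_orthogonal_eq_closure, Submodule.mem_orthogonal]
  intro k hk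
  rw [Submodule.mem_orthogonal'] at hk
  refine hh k ?_
  have hkL : MemLp (fun ω => k (obs ω)) 2 (P' : Measure (Subject 𝒳 𝒮)) := by
    have h1 : MemLp k 2 (obsLaw obs P') := by rw [hPP']; exact Lp.memLp k
    exact h1.comp_of_map hobs.aemeasurable
  intro D mD hD2 hD0
  refine integral_mul_eq_zero_of_bounded hkL measurable_potData (fun D M mD hM h0 => ?_) mD hD2 hD0
  obtain ⟨g, hg, hgk⟩ := exists_mem_tangentSet (𝓜 := model 𝒳 𝒮 ε) hobs hPP'
    (mD.comp measurable_potData) (fun ω => hM _) h0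
    fun γ Q hγ hQ => hD.assumptions_tilt hε hw hY mD hM hγ hQ
  exact (hgk k).symm.trans (hk g (Submodule.subset_span hg))

/-! ### The full-data score that projects onto the augmented function. -/

namespace Regression

variable (N : Regression 𝒳 𝒮)

/-- The weighted sum of residual and deviation in one arm. -/
def armScore (w v : Bool → 𝒳 → ℝ) (t : Bool) (z : 𝒳 × 𝒮 × ℝ) : ℝ :=
  w t z.1 * N.resid t z + v t z.1 * N.devi t z

/-- The function of the potential variables whose conditional mean given the observed data is
`N.psi`. -/
def score (w v : Bool → 𝒳 → ℝ) (c : ℝ) (u : 𝒳 × (Bool → 𝒮) × (Bool → ℝ)) : ℝ :=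
  N.μ true u.1 - N.μ false u.1
    + (N.armScore w v true (armOf true u) - N.armScore w v false (armOf false u)) - c

/-- What remains are the parts that the data hide: the residual of the actual arm when its outcome
is not revealed, and everything from the counterfactual arm. -/
theorem score_sub_psi (w v : Bool → 𝒳 → ℝ) (c : ℝ) {t b : Bool} {ω : Subject 𝒳 𝒮}
    (hω : ω ∈ cell t b) : N.score w v c (potData ω) - N.psi w v c ω
      = sgn t * (1 - ind (N.full || b)) * (w t (X ω) * N.resid t (armData t ω))
        + sgn (!t) * N.armScore w v (!t) (armData (!t) ω) := by
  obtain ⟨rfl, rfl⟩ := hω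
  have h1 : ∀ t, armOf t (potData ω) = armData t ω := fun _ => rfl
  have h2 : (potData ω).1 = X ω := rfl
  have h3 : ∀ t, (armData t ω).1 = X ω := fun _ => rfl
  simp only [score, psi, armScore, h1, h2, h3]
  cases T ω <;> simp [sgn] <;> ring

theorem measurable_armScore {w v : Bool → 𝒳 → ℝ} (hw : ∀ t, Measurable (w t))
    (hv : ∀ t, Measurable (v t)) (t : Bool) : Measurable (N.armScore w v t) :=
  (((hw t).comp measurable_fst).mul (N.measurable_resid t)).add
    (((hv t).comp measurable_fst).mul (N.measurable_devi t))

theorem measurable_score {w v : Bool → 𝒳 → ℝ} (hw : ∀ t, Measurable (w t))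
    (hv : ∀ t, Measurable (v t)) (c : ℝ) : Measurable (N.score w v c) :=
  ((((N.measurable_μ true).comp measurable_fst).sub ((N.measurable_μ false).comp measurable_fst)).add
    (((N.measurable_armScore hw hv true).comp (measurable_armOf true)).sub
      ((N.measurable_armScore hw hv false).comp (measurable_armOf false)))).sub_const c

namespace IsCentered

variable {N} {P : Measure (Subject 𝒳 𝒮)} {w v : Bool → 𝒳 → ℝ} {C : ℝ}

theorem memLp_weighted_resid (hc : N.IsCentered P) (hw : ∀ t, Measurable (w t))
    (hwC : ∀ t x, |w t x| ≤ C) (t : Bool) :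
    MemLp (fun ω => w t (X ω) * N.resid t (armData t ω)) 2 P :=
  memLp_two_bdd_mul (hc.memLp_resid t) ((hw t).comp measurable_X) fun _ => hwC _ _

theorem memLp_weighted_devi (hc : N.IsCentered P) (hv : ∀ t, Measurable (v t))
    (hvC : ∀ t x, |v t x| ≤ C) (t : Bool) :
    MemLp (fun ω => v t (X ω) * N.devi t (armData t ω)) 2 P :=
  memLp_two_bdd_mul (hc.memLp_devi t) ((hv t).comp measurable_X) fun _ => hvC _ _

theorem memLp_armScore (hc : N.IsCentered P) (hw : ∀ t, Measurable (w t))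
    (hv : ∀ t, Measurable (v t)) (hwC : ∀ t x, |w t x| ≤ C) (hvC : ∀ t x, |v t x| ≤ C) (t : Bool) :
    MemLp (fun ω => N.armScore w v t (armData t ω)) 2 P :=
  (hc.memLp_weighted_resid hw hwC t).add (hc.memLp_weighted_devi hv hvC t)

theorem integral_armScore [IsFiniteMeasure P] (hc : N.IsCentered P) (hw : ∀ t, Measurable (w t))
    (hv : ∀ t, Measurable (v t)) (hwC : ∀ t x, |w t x| ≤ C) (hvC : ∀ t x, |v t x| ≤ C) (t : Bool)
    {a : 𝒳 → ℝ} (ha : Measurable a) : ∫ ω, a (X ω) * N.armScore w v t (armData t ω) ∂P = 0 := by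
  refine integral_comp_mul_eq_zero_of_bounded measurable_X (fun b M mb hb => ?_) ha
  simp only [armScore, mul_add]
  rw [integral_add, ← add_zero (0 : ℝ)]
  · congr 1
    · rw [← hc.resid t (fun x => b x * w t x) (mb.mul (hw t))]
      simp only [mul_assoc]
      rfl
    · rw [← hc.devi t (fun x => b x * v t x) (mb.mul (hv t))]
      simp only [mul_assoc]
      rfl
  · exact (memLp_two_bdd_mul (hc.memLp_weighted_resid hw hwC t) (mb.comp measurable_X)
      (C := M) fun _ => hb _).integrable (by norm_num)
  · exact (memLp_two_bdd_mul (hc.memLp_weighted_devi hv hvC t) (mb.comp measurable_X)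
      (C := M) fun _ => hb _).integrable (by norm_num)

end IsCentered

end Regression

theorem integral_eq_sum_cells {Q : Measure (Subject 𝒳 𝒮)} {f : Subject 𝒳 𝒮 → ℝ}
    (hf : Integrable f Q) : ∫ ω, f ω ∂Q
      = (∫ ω in cell true true, f ω ∂Q + ∫ ω in cell true false, f ω ∂Q)
        + (∫ ω in cell false true, f ω ∂Q + ∫ ω in cell false false, f ω ∂Q) := by
  have h : ∀ t b, Integrable f (Q.restrict (cell t b)) := fun t b => hf.integrableOn
  conv_lhs => rw [eq_sum_cells Q]
  rw [integral_add_measure (integrable_add_measure.2 ⟨h _ _, h _ _⟩)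
    (integrable_add_measure.2 ⟨h _ _, h _ _⟩), integral_add_measure (h _ _) (h _ _),
    integral_add_measure (h _ _) (h _ _)]

namespace Observes

variable {N : Regression 𝒳 𝒮}

/-- The weighted function lies in the tangent space. -/
theorem mem_closure_span [StandardBorelSpace 𝒳] [StandardBorelSpace 𝒮] {ε : ℝ} (hε : 0 < ε)
    {f : 𝒳 × Bool × Bool × 𝒮 × ℝ → O} (hf : Measurable f)
    (B : Observes (fun ω : Subject 𝒳 𝒮 => f (actual ω)) N)
    {P : ProbabilityMeasure (Subject 𝒳 𝒮)} (hc : N.IsCentered (P : Measure (Subject 𝒳 𝒮)))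
    {π η : Bool → 𝒳 → ℝ} (hP : IsRandomized ε (P : Measure (Subject 𝒳 𝒮)) π η)
    (hhid : N.full = false → ∀ (t : Bool) (K : O → ℝ) (c : 𝒳 → ℝ), Measurable K → Measurable c →
      ∫ ω, c (X ω) * (K (f (act t false (armData t ω))) * N.resid t (armData t ω))
        ∂(P : Measure (Subject 𝒳 𝒮)) = 0)
    {w v : Bool → 𝒳 → ℝ} (hw : ∀ t, Measurable (w t)) (hv : ∀ t, Measurable (v t)) {C : ℝ}
    (hwC : ∀ t x, |w t x| ≤ C) (hvC : ∀ t x, |v t x| ≤ C)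
    {h : Lp ℝ 2 (obsLaw (fun ω => f (actual ω)) P)}
    (hh : h =ᵐ[obsLaw (fun ω => f (actual ω)) P] B.psi w v (ate (P : Measure (Subject 𝒳 𝒮)))) :
    h ∈ (Submodule.span ℝ
      (tangentSet (model 𝒳 𝒮 ε) (fun ω => f (actual ω)) P)).topologicalClosure := by
  have hne : Nonempty (Subject 𝒳 𝒮) := nonempty_of_isProbabilityMeasure (P : Measure _)
  have : Nonempty 𝒮 := ⟨S hne.some⟩
  obtain ⟨P'₀, hD⟩ := exists_isDecoupling (P := (P : Measure (Subject 𝒳 𝒮))) hε hP.toIsWeights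
  obtain ⟨P', rfl⟩ : ∃ P' : ProbabilityMeasure (Subject 𝒳 𝒮), P'₀ = P' :=
    ⟨⟨P'₀, hD.isProbabilityMeasure⟩, rfl⟩
  have hobs : Measurable fun ω : Subject 𝒳 𝒮 => f (actual ω) := hf.comp measurable_actual
  have hPP' : obsLaw (fun ω => f (actual ω)) P' = obsLaw (fun ω => f (actual ω)) P := by
    have h1 := congrArg (fun m => m.map f) (hD.map_actual hε hP)
    simp only [Measure.map_map hf measurable_actual] at h1
    exact h1
  set c := ate (P : Measure (Subject 𝒳 𝒮)) with hcdef
  refine mem_closure_span_tangentSet hε hP.toIsWeights hD hc.memLp_out hobs hPP' fun k hk => ?_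
  have mk : Measurable (k : O → ℝ) := (Lp.stronglyMeasurable k).measurable
  have hkL : MemLp (fun ω => k (f (actual ω))) 2 (P' : Measure (Subject 𝒳 𝒮)) := by
    have h1 : MemLp k 2 (obsLaw (fun ω => f (actual ω)) P') := by rw [hPP']; exact Lp.memLp k
    exact h1.comp_of_map hobs.aemeasurable
  have lμ : ∀ t, MemLp (fun ω => N.μ t (X ω)) 2 (P' : Measure (Subject 𝒳 𝒮)) := fun t =>
    hD.memLp (t := t) (d := fun z => N.μ t z.1) ((N.measurable_μ t).comp measurable_fst)
      (hc.memLp_μ t)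
  have lA : ∀ t, MemLp (fun ω => N.armScore w v t (armData t ω)) 2
      (P' : Measure (Subject 𝒳 𝒮)) := fun t =>
    hD.memLp (N.measurable_armScore hw hv t) (hc.memLp_armScore hw hv hwC hvC t)
  have lr : ∀ t, MemLp (fun ω => w t (X ω) * N.resid t (armData t ω)) 2
      (P' : Measure (Subject 𝒳 𝒮)) := fun t =>
    hD.memLp (d := fun z => w t z.1 * N.resid t z)
      (((hw t).comp measurable_fst).mul (N.measurable_resid t)) (hc.memLp_weighted_resid hw hwC t)
  have lscore : MemLp (fun ω => N.score w v c (potData ω)) 2 (P' : Measure (Subject 𝒳 𝒮)) :=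
    (((lμ true).sub (lμ false)).add ((lA true).sub (lA false))).sub (memLp_const c)
  have lpsi : MemLp (N.psi w v c) 2 (P' : Measure (Subject 𝒳 𝒮)) := by
    have h1 := B.memLp_psi hobs hc hw hv hwC hvC c
    rw [← hPP'] at h1
    refine (h1.comp_of_map hobs.aemeasurable).ae_eq (ae_of_all _ fun ω => B.psi_obs w v c ω)
  have iμ : ∀ t, ∫ ω, N.μ t (X ω) ∂(P' : Measure (Subject 𝒳 𝒮))
      = ∫ ω, Ypot t ω ∂(P : Measure (Subject 𝒳 𝒮)) := by
    intro t
    have h1 := hD.integral_eq t (d := fun z => N.μ t z.1) ((N.measurable_μ t).comp measurable_fst)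
    have h2 := hc.integral_armScore (w := fun _ _ => 1) (v := fun _ _ => 1) (C := 1)
      (fun _ => measurable_const) (fun _ => measurable_const) (by simp) (by simp) t
      (a := fun _ => 1) measurable_const
    have h3 : ∀ ω : Subject 𝒳 𝒮, (1 : ℝ) * N.armScore (fun _ _ => 1) (fun _ _ => 1) t (armData t ω)
        = Ypot t ω - N.μ t (X ω) := fun ω => by
      simp only [Regression.armScore, Regression.resid, Regression.devi, armData]; ring
    simp_rw [h3] at h2
    rw [integral_sub (hc.integrable.out t) (hc.integrable.μ t), sub_eq_zero] at h2
    rw [h2]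
    exact h1
  have iA : ∀ t, ∫ ω, N.armScore w v t (armData t ω) ∂(P' : Measure (Subject 𝒳 𝒮)) = 0 := by
    intro t
    rw [hD.integral_eq t (N.measurable_armScore hw hv t)]
    simpa using hc.integral_armScore hw hv hwC hvC t (a := fun _ => 1) measurable_const
  have hscore0 : ∫ ω, N.score w v c (potData ω) ∂(P' : Measure (Subject 𝒳 𝒮)) = 0 := by
    have i1 : ∀ t, Integrable (fun ω => N.μ t (X ω)) (P' : Measure (Subject 𝒳 𝒮)) := fun t =>
      (lμ t).integrable (by norm_num)
    have i2 : ∀ t, Integrable (fun ω => N.armScore w v t (armData t ω))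
        (P' : Measure (Subject 𝒳 𝒮)) := fun t => (lA t).integrable (by norm_num)
    change ∫ ω, (N.μ true (X ω) - N.μ false (X ω)
      + (N.armScore w v true (armData true ω) - N.armScore w v false (armData false ω)) - c)
        ∂(P' : Measure (Subject 𝒳 𝒮)) = 0
    have i3 : Integrable (fun ω => N.μ true (X ω) - N.μ false (X ω))
      (P' : Measure (Subject 𝒳 𝒮)) := (i1 true).sub (i1 false)
    have i4 : Integrable (fun ω => N.armScore w v true (armData true ω)
      - N.armScore w v false (armData false ω)) (P' : Measure (Subject 𝒳 𝒮)) :=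
      (i2 true).sub (i2 false)
    have i5 : Integrable (fun ω => N.μ true (X ω) - N.μ false (X ω)
      + (N.armScore w v true (armData true ω) - N.armScore w v false (armData false ω)))
      (P' : Measure (Subject 𝒳 𝒮)) := i3.add i4
    rw [integral_sub i5 (integrable_const c), integral_add i3 i4, integral_sub (i1 _) (i1 _),
      integral_sub (i2 _) (i2 _), iμ, iμ, iA, iA, hcdef, ate]
    simp
  have h1 := hk _ (N.measurable_score hw hv c) lscore hscore0
  have ik1 : Integrable (fun ω => k (f (actual ω)) * N.score w v c (potData ω))
    (P' : Measure (Subject 𝒳 𝒮)) := hkL.integrable_mul lscore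
  have ik2 : Integrable (fun ω => k (f (actual ω)) * N.psi w v c ω)
    (P' : Measure (Subject 𝒳 𝒮)) := hkL.integrable_mul lpsi
  -- The full-data score and the augmented function have the same inner product with k, cell by
  -- cell, because each hidden term vanishes separately.
  have hcell : ∀ t b, ∫ ω in cell t b, (k (f (actual ω)) * N.score w v c (potData ω)
      - k (f (actual ω)) * N.psi w v c ω) ∂(P' : Measure (Subject 𝒳 𝒮)) = 0 := by
    intro t b
    have e1 : ∀ᵐ ω ∂(P' : Measure (Subject 𝒳 𝒮)).restrict (cell t b),
        k (f (actual ω)) * N.score w v c (potData ω) - k (f (actual ω)) * N.psi w v c ω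
          = sgn t * (1 - ind (N.full || b))
              * (k (f (actual ω)) * (w t (X ω) * N.resid t (armData t ω)))
            + sgn (!t) * (k (f (actual ω)) * N.armScore w v (!t) (armData (!t) ω)) := by
      filter_upwards [ae_restrict_mem (measurableSet_cell t b)] with ω hω
      rw [← mul_sub, N.score_sub_psi w v c hω]
      ring
    have i1 : Integrable (fun ω => k (f (actual ω)) * (w t (X ω) * N.resid t (armData t ω)))
      (P' : Measure (Subject 𝒳 𝒮)) := hkL.integrable_mul (lr t)
    have i2 : Integrable (fun ω => k (f (actual ω)) * N.armScore w v (!t) (armData (!t) ω))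
      (P' : Measure (Subject 𝒳 𝒮)) := hkL.integrable_mul (lA (!t))
    rw [integral_congr_ae e1, integral_add (i1.integrableOn.const_mul _)
      (i2.integrableOn.const_mul _), integral_const_mul, integral_const_mul]
    -- On the cell, k is a function of the actual arm, and under P' the other arm is independent of
    -- it given X with centered contribution.
    have z2 : ∫ ω in cell t b, k (f (actual ω)) * N.armScore w v (!t) (armData (!t) ω)
        ∂(P' : Measure (Subject 𝒳 𝒮)) = 0 := by
      have h2 := hD.indep (!t) b (fun z => k (f (act t b z))) (N.armScore w v (!t))
        (mk.comp (hf.comp (measurable_act t b))) (N.measurable_armScore hw hv (!t))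
        ((hc.memLp_armScore hw hv hwC hvC (!t)).integrable (by norm_num))
        (fun a ha => hc.integral_armScore hw hv hwC hvC (!t) ha)
      rw [Bool.not_not] at h2
      rw [← h2]
      refine integral_congr_ae ?_
      filter_upwards [ae_restrict_mem (measurableSet_cell t b)] with ω hω
      rw [actual_eq hω]
    rw [z2, mul_zero, add_zero]
    -- A revealed outcome makes the coefficient of the residual zero. Otherwise the data contain of
    -- this arm only what the observation scheme shows for R = 0, and the residual is orthogonal to
    -- that by `hhid`, once the integral over the cell has been carried from P' to P.
    cases hfb : N.full || b with
    | true => simp [ind]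
    | false =>
      rw [Bool.or_eq_false_iff] at hfb
      obtain ⟨hfull, rfl⟩ := hfb
      have md : Measurable fun z : 𝒳 × 𝒮 × ℝ =>
          k (f (act t false z)) * (w t z.1 * N.resid t z) :=
        (mk.comp (hf.comp (measurable_act t false))).mul
          (((hw t).comp measurable_fst).mul (N.measurable_resid t))
      have z1 : ∫ ω in cell t false, k (f (actual ω)) * (w t (X ω) * N.resid t (armData t ω))
          ∂(P' : Measure (Subject 𝒳 𝒮)) = 0 := by
        have e2 : ∫ ω in cell t false, k (f (actual ω)) * (w t (X ω) * N.resid t (armData t ω))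
            ∂(P' : Measure (Subject 𝒳 𝒮))
            = ∫ z, k (f (act t false z)) * (w t z.1 * N.resid t z)
              ∂((P' : Measure (Subject 𝒳 𝒮)).restrict (cell t false)).map (armData t) := by
          rw [integral_map (measurable_armData t).aemeasurable md.aestronglyMeasurable]
          refine integral_congr_ae ?_
          filter_upwards [ae_restrict_mem (measurableSet_cell t false)] with ω hω
          rw [actual_eq hω]
          rfl
        rw [e2, hD.map_restrict_cell hε hP,
          integral_map (measurable_armData t).aemeasurable md.aestronglyMeasurable]
        have e3 := (hP.isPropensity_cell hε t false).integral (measurable_armData t)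
          ((hP.measurable_cellProb t false).comp measurable_fst)
          (fun z => hP.cellProb_nonneg hε t false z.1) md
        refine e3.trans ?_
        rw [← hhid hfull t k (fun x => cellProb π η t false x * w t x) mk
          ((hP.measurable_cellProb t false).mul (hw t))]
        refine integral_congr_ae (ae_of_all _ fun ω => ?_)
        simp only [armData]
        ring
      rw [z1, mul_zero]
  have h2 : ∫ ω, (k (f (actual ω)) * N.score w v c (potData ω)
      - k (f (actual ω)) * N.psi w v c ω) ∂(P' : Measure (Subject 𝒳 𝒮)) = 0 := by
    refine (integral_eq_sum_cells (ik1.sub ik2)).trans ?_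
    simp only [Pi.sub_apply]
    rw [hcell, hcell, hcell, hcell]
    simp
  rw [integral_sub ik1 ik2, h1, zero_sub, neg_eq_zero] at h2
  rw [L2.inner_def]
  have h3 : ∫ o, inner ℝ (k o) (h o) ∂obsLaw (fun ω => f (actual ω)) P
      = ∫ o, k o * B.psi w v c o ∂obsLaw (fun ω => f (actual ω)) P := by
    refine integral_congr_ae ?_
    filter_upwards [hh] with o ho
    rw [ho]
    simp [mul_comm]
  have h4 : ∫ o, k o * B.psi w v c o ∂obsLaw (fun ω => f (actual ω)) P
      = ∫ o, k o * B.psi w v c o ∂obsLaw (fun ω => f (actual ω)) P' :=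
    congrArg (fun m : Measure O => ∫ o, k o * B.psi w v c o ∂m) hPP'.symm
  have mkB : Measurable fun o => k o * B.psi w v c o := mk.mul (B.measurable_psi hw hv c)
  rw [h3, h4, integral_map hobs.aemeasurable mkB.aestronglyMeasurable, ← h2]
  refine integral_congr_ae (ae_of_all _ fun ω => ?_)
  exact congrArg (k (f (actual ω)) * ·) (B.psi_obs w v c ω)

end Observes

end TangentSpace

/-! ### Regressions on labelled units -/

section Regressions

open scoped ENNReal

/-! ### Regressions and conditional variances characterised by orthogonality. -/

section Centered

variable {Ω α : Type*} [MeasurableSpace Ω] [MeasurableSpace α] {μ : Measure Ω}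

/-- The mean of the conditional law is a version of the conditional expectation, so its residual is
orthogonal to functions of `V`. No bound on c is needed, as a non-integrable product has integral 0
by convention. -/
theorem integral_mul_sub_integral_condDistrib [IsFiniteMeasure μ] {V : Ω → α} (hV : Measurable V)
    {f : Ω → ℝ} (hf : MemLp f 2 μ) :
    MemLp (fun ω => ∫ y, y ∂condDistrib f V μ (V ω)) 2 μ ∧
      ∀ c : α → ℝ, Measurable c →
        ∫ ω, c (V ω) * (f ω - ∫ y, y ∂condDistrib f V μ (V ω)) ∂μ = 0 := by
  have hfi : Integrable f μ := hf.integrable (by norm_num)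
  have h1 := condExp_ae_eq_integral_condDistrib' hV hfi
  have h2 : MemLp (fun ω => ∫ y, y ∂condDistrib f V μ (V ω)) 2 μ :=
    (hf.condExp (m := MeasurableSpace.comap V inferInstance) (by norm_num)).ae_eq h1
  refine ⟨h2, fun c hc => ?_⟩
  by_cases hi : Integrable (fun ω => c (V ω) * (f ω - ∫ y, y ∂condDistrib f V μ (V ω))) μ
  swap
  · exact integral_undef hi
  have h3 : Integrable (fun ω => f ω - ∫ y, y ∂condDistrib f V μ (V ω)) μ :=
    hfi.sub (h2.integrable (by norm_num))
  have h4 := condExp_mul_of_stronglyMeasurable_left (μ := μ)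
    (m := MeasurableSpace.comap V inferInstance) (f := fun ω => c (V ω))
    (g := fun ω => f ω - ∫ y, y ∂condDistrib f V μ (V ω))
    (hc.comp (comap_measurable V)).stronglyMeasurable hi h3
  have h5 : μ[fun ω => f ω - ∫ y, y ∂condDistrib f V μ (V ω) |
      MeasurableSpace.comap V inferInstance] =ᵐ[μ] 0 := by
    have h6 : (fun ω => f ω - ∫ y, y ∂condDistrib f V μ (V ω)) =ᵐ[μ]
        f - μ[f | MeasurableSpace.comap V inferInstance] := by
      filter_upwards [h1] with ω hω
      rw [Pi.sub_apply, hω]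
    refine (condExp_congr_ae h6).trans ((condExp_sub hfi integrable_condExp _).trans ?_)
    rw [condExp_of_stronglyMeasurable hV.comap_le stronglyMeasurable_condExp integrable_condExp,
      sub_self]
  rw [← integral_condExp hV.comap_le]
  refine integral_eq_zero_of_ae ?_
  filter_upwards [h4, h5] with ω a b
  refine a.trans ?_
  rw [Pi.mul_apply, b]
  simp

theorem condExp_eq_of_integral_mul_eq_zero [IsFiniteMeasure μ] {V : Ω → α} (hV : Measurable V)
    {f : Ω → ℝ} (hf : Integrable f μ) {m : α → ℝ} (hm : Measurable m)
    (hmi : Integrable (fun ω => m (V ω)) μ)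
    (h : ∀ c : α → ℝ, Measurable c → ∫ ω, c (V ω) * (f ω - m (V ω)) ∂μ = 0) :
    (fun ω => m (V ω)) =ᵐ[μ] μ[f | MeasurableSpace.comap V inferInstance] := by
  refine ae_eq_condExp_of_forall_setIntegral_eq hV.comap_le hf (fun _ _ _ => hmi.integrableOn) ?_
    (hm.comp (comap_measurable V)).aestronglyMeasurable
  rintro _ ⟨A, hA, rfl⟩ -
  have h1 := h (A.indicator 1) (measurable_one.indicator hA)
  have h2 : ∀ ω, A.indicator (1 : α → ℝ) (V ω) * (f ω - m (V ω))
      = (V ⁻¹' A).indicator (fun ω => f ω - m (V ω)) ω := by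
    intro ω
    by_cases hω : V ω ∈ A
    · rw [Set.indicator_of_mem hω, Set.indicator_of_mem (show ω ∈ V ⁻¹' A from hω)]; simp
    · rw [Set.indicator_of_notMem hω, Set.indicator_of_notMem (show ω ∉ V ⁻¹' A from hω)]; simp
  simp_rw [h2] at h1
  rw [integral_indicator (hV hA), integral_sub hf.integrableOn hmi.integrableOn, sub_eq_zero] at h1
  exact h1.symm

/-- The mean of a weighted conditional variance. -/
theorem integral_mul_condVar [IsFiniteMeasure μ] {V : Ω → α} (hV : Measurable V)
    {f : Ω → ℝ} (hf : MemLp f 2 μ) {m : α → ℝ} (hm : Measurable m)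
    (hm2 : MemLp (fun ω => m (V ω)) 2 μ)
    (h : ∀ c : α → ℝ, Measurable c → ∫ ω, c (V ω) * (f ω - m (V ω)) ∂μ = 0)
    {c : α → ℝ} (hc : Measurable c) {C : ℝ} (hcC : ∀ a, |c a| ≤ C) :
    Integrable (fun ω => c (V ω) * condVar (MeasurableSpace.comap V inferInstance) f μ ω) μ ∧
      ∫ ω, c (V ω) * condVar (MeasurableSpace.comap V inferInstance) f μ ω ∂μ
        = ∫ ω, c (V ω) * (f ω - m (V ω)) ^ 2 ∂μ := by
  have h1 := condExp_eq_of_integral_mul_eq_zero hV (hf.integrable (by norm_num)) hm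
    (hm2.integrable (by norm_num)) h
  have h2 : condVar (MeasurableSpace.comap V inferInstance) f μ =ᵐ[μ]
      μ[fun ω => (f ω - m (V ω)) ^ 2 | MeasurableSpace.comap V inferInstance] := by
    refine condExp_congr_ae ?_
    filter_upwards [h1] with ω hω
    simp [hω]
  have hsq : Integrable (fun ω => (f ω - m (V ω)) ^ 2) μ := (hf.sub hm2).integrable_sq
  have hcsq : Integrable (fun ω => c (V ω) * (f ω - m (V ω)) ^ 2) μ :=
    hsq.bdd_mul (hc.comp hV).aestronglyMeasurable (ae_of_all _ fun ω => hcC _)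
  have h3 := condExp_mul_of_stronglyMeasurable_left (μ := μ)
    (m := MeasurableSpace.comap V inferInstance) (f := fun ω => c (V ω))
    (g := fun ω => (f ω - m (V ω)) ^ 2)
    (hc.comp (comap_measurable V)).stronglyMeasurable hcsq hsq
  have h4 : (fun ω => c (V ω) * condVar (MeasurableSpace.comap V inferInstance) f μ ω) =ᵐ[μ]
      μ[fun ω => c (V ω) * (f ω - m (V ω)) ^ 2 | MeasurableSpace.comap V inferInstance] := by
    filter_upwards [h2, h3] with ω a b
    rw [a]
    exact b.symm
  refine ⟨integrable_condExp.congr h4.symm, ?_⟩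
  rw [integral_congr_ae h4, integral_condExp hV.comap_le]

end Centered

variable {𝒳 𝒮 : Type*} [MeasurableSpace 𝒳] [MeasurableSpace 𝒮]

theorem restrict_eq_smul_cond (P : Measure (Subject 𝒳 𝒮)) [IsFiniteMeasure P]
    (E : Set (Subject 𝒳 𝒮)) : P.restrict E = P E • P[|E] := by
  rw [cond_eq_smul, smul_smul]
  by_cases h : P E = 0
  · rw [Measure.restrict_eq_zero.2 h]; simp
  · rw [ENNReal.mul_inv_cancel h (measure_ne_top P E), one_smul]

/-- The regression of the outcome on labelled units of arm `t` is the regression of the potential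
outcome. -/
theorem IsRandomized.integral_mul_sub_regression {ε : ℝ} (hε : 0 < ε) {P : Measure (Subject 𝒳 𝒮)}
    [IsProbabilityMeasure P] {π η : Bool → 𝒳 → ℝ} (h : IsRandomized ε P π η) (t : Bool)
    (hY : MemLp (Ypot t) 2 P) {α : Type*} [MeasurableSpace α] {V : Subject 𝒳 𝒮 → α}
    (hV : Measurable V) {φ : 𝒳 × 𝒮 × ℝ → α} (hφ : Measurable φ) {ξ : α → 𝒳} (hξ : Measurable ξ)
    (hξφ : ∀ z, ξ (φ z) = z.1) (hVφ : ∀ ω ∈ labelled t, V ω = φ (armData t ω)) {m : α → ℝ}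
    (hm : Measurable m) (hmV : ∀ a, m a = ∫ y, y ∂condDistrib Y V (P[|labelled t]) a) :
    MemLp (fun ω => m (φ (armData t ω))) 2 P ∧ ∀ c : α → ℝ, Measurable c →
      ∫ ω, c (φ (armData t ω)) * (Ypot t ω - m (φ (armData t ω))) ∂P = 0 := by
  have mL := measurableSet_labelled (𝒳 := 𝒳) (𝒮 := 𝒮) t
  have mA := measurable_armData (𝒳 := 𝒳) (𝒮 := 𝒮) t
  have hYY : ∀ᵐ ω ∂P.restrict (labelled t), Ypot t ω = Y ω := by
    filter_upwards [ae_restrict_mem mL] with ω hω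
    have : T ω = t := hω.1
    rw [Y, this]
  have hYL : MemLp Y 2 (P.restrict (labelled t)) := (hY.restrict (labelled t)).ae_eq hYY
  -- Conditioning on a null event would give the zero measure and a meaningless regression;
  -- positivity of π and η rules this out.
  by_cases hL : P (labelled t) = 0
  · exfalso
    have h1 := (h.label t).ae_of_ae_restrict mA
      (((h.measurable_treat t).mul (h.measurable_label t)).comp measurable_fst).ennreal_ofReal
      (ae_of_all _ fun ω => ?_) (p := fun _ => False) MeasurableSet.empty
      (by rw [Measure.restrict_eq_zero.2 hL]; simp)
    · simp only [eventually_false_iff_eq_bot, ae_eq_bot] at h1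
      exact IsProbabilityMeasure.ne_zero P h1
    · have : 0 < π t (armData t ω).1 * η t (armData t ω).1 :=
        mul_pos (hε.trans_le (h.treat_mem _ _).1) (hε.trans_le (h.label_mem _ _).1)
      simpa using this
  have hYc : MemLp Y 2 (P[|labelled t]) := by
    rw [cond_eq_smul]
    exact hYL.smul_measure (ENNReal.inv_ne_top.2 hL)
  obtain ⟨h1, h2⟩ := integral_mul_sub_integral_condDistrib hV hYc
  simp_rw [← hmV] at h1 h2
  have hVL : ∀ᵐ ω ∂P.restrict (labelled t), V ω = φ (armData t ω) := by
    filter_upwards [ae_restrict_mem mL] with ω hω using hVφ ω hω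
  have mπη : Measurable fun x => π t x * η t x := (h.measurable_treat t).mul (h.measurable_label t)
  have hπη : ∀ x, ε ^ 2 ≤ π t x * η t x := fun x => (h.revealProb_mem hε false t x).1
  have hε2 : 0 < ε ^ 2 := by positivity
  have mmφ : Measurable fun z => m (φ z) := hm.comp hφ
  constructor
  · refine (memLp_two_iff_integrable_sq (mmφ.comp mA).aestronglyMeasurable).2 ?_
    refine (h.label t).integrable_of_restrict mA (mπη.comp measurable_fst) hε2
      (fun z => hπη z.1) (f := fun z => m (φ z) ^ 2) (mmφ.pow_const 2) ?_
    have h3 : MemLp (fun ω => m (V ω)) 2 (P.restrict (labelled t)) := by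
      rw [restrict_eq_smul_cond]
      exact h1.smul_measure (measure_ne_top P _)
    refine h3.integrable_sq.congr ?_
    filter_upwards [hVL] with ω hω
    rw [hω]
  · intro c hc
    -- Dividing the test function by πη undoes the selection of labelled units: integrating over
    -- them multiplies by πη again and leaves the integral over the whole population. The map ξ
    -- recovers the covariates, so that the weight is a function of V.
    have h3 := h2 (fun a => (π t (ξ a) * η t (ξ a))⁻¹ * c a) ((mπη.comp hξ).inv.mul hc)
    have h4 : ∫ ω in labelled t, (π t (ξ (V ω)) * η t (ξ (V ω)))⁻¹ * c (V ω) * (Y ω - m (V ω)) ∂P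
        = 0 := by
      rw [restrict_eq_smul_cond, integral_smul_measure, h3, smul_zero]
    have mF : Measurable fun z : 𝒳 × 𝒮 × ℝ =>
        (π t z.1 * η t z.1)⁻¹ * c (φ z) * (z.2.2 - m (φ z)) :=
      ((mπη.comp measurable_fst).inv.mul (hc.comp hφ)).mul
        ((measurable_snd.comp measurable_snd).sub mmφ)
    have h5 := (h.label t).integral mA (mπη.comp measurable_fst)
      (fun z => hε2.le.trans (hπη z.1)) mF
    have h6 : ∫ ω in labelled t, (π t (armData t ω).1 * η t (armData t ω).1)⁻¹
        * c (φ (armData t ω)) * ((armData t ω).2.2 - m (φ (armData t ω))) ∂P = 0 := by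
      rw [← h4]
      refine integral_congr_ae ?_
      filter_upwards [hVL, hYY] with ω a b
      rw [← b, a, hξφ]
      rfl
    rw [h6] at h5
    rw [h5]
    refine integral_congr_ae (ae_of_all _ fun ω => ?_)
    have h7 : π t (armData t ω).1 * η t (armData t ω).1 ≠ 0 :=
      ne_of_gt (hε2.trans_le (hπη _))
    change _ = π t (armData t ω).1 * η t (armData t ω).1 * ((π t (armData t ω).1
      * η t (armData t ω).1)⁻¹ * c (φ (armData t ω)) * ((armData t ω).2.2 - m (φ (armData t ω))))
    rw [← mul_assoc, ← mul_assoc, mul_inv_cancel₀ h7, one_mul]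
    rfl

theorem measurable_muS (P : Measure (Subject 𝒳 𝒮)) [IsFiniteMeasure P] (t : Bool) :
    Measurable fun v : 𝒳 × 𝒮 => muS P t v.1 v.2 :=
  (measurable_snd.stronglyMeasurable.integral_condDistrib (μ := P[|labelled t])
    (X := fun ω => (X ω, S ω)) (Y := Y) (f := Prod.snd)).measurable

theorem measurable_mu (P : Measure (Subject 𝒳 𝒮)) [IsFiniteMeasure P] (t : Bool) :
    Measurable (mu P t) :=
  (measurable_snd.stronglyMeasurable.integral_condDistrib (μ := P[|labelled t])
    (X := X) (Y := Y) (f := Prod.snd)).measurable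

theorem measurable_S : Measurable (S : Subject 𝒳 𝒮 → 𝒮) :=
  measurable_bool_apply (w := fun t (ω : Subject 𝒳 𝒮) => Spot t ω) measurable_Spot
      measurable_T measurable_id

namespace IsRandomized

variable {ε : ℝ} {P : Measure (Subject 𝒳 𝒮)} [IsProbabilityMeasure P] {π η : Bool → 𝒳 → ℝ}

theorem mu_spec (hε : 0 < ε) (h : IsRandomized ε P π η) {t : Bool} (hY : MemLp (Ypot t) 2 P) :
    MemLp (fun ω => mu P t (X ω)) 2 P ∧ ∀ c : 𝒳 → ℝ, Measurable c →
      ∫ ω, c (X ω) * (Ypot t ω - mu P t (X ω)) ∂P = 0 :=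
  h.integral_mul_sub_regression hε t hY measurable_X (φ := Prod.fst) measurable_fst (ξ := id)
    measurable_id (fun _ => rfl) (fun _ _ => rfl) (measurable_mu P t) fun _ => rfl

theorem muS_spec (hε : 0 < ε) (h : IsRandomized ε P π η) {t : Bool} (hY : MemLp (Ypot t) 2 P) :
    MemLp (fun ω => muS P t (X ω) (Spot t ω)) 2 P ∧ ∀ c : 𝒳 × 𝒮 → ℝ, Measurable c →
      ∫ ω, c (X ω, Spot t ω) * (Ypot t ω - muS P t (X ω) (Spot t ω)) ∂P = 0 :=
  h.integral_mul_sub_regression hε t hY (measurable_X.prodMk measurable_S)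
    (φ := fun z => (z.1, z.2.1)) (by fun_prop) (ξ := Prod.fst) measurable_fst (fun _ => rfl)
    (fun ω hω => by
      have : T ω = t := hω.1
      rw [S, this]; rfl)
    (m := fun v => muS P t v.1 v.2) (measurable_muS P t) fun _ => rfl

end IsRandomized

/-- The regressions that ignore the surrogate. -/
def covariateRegression (full : Bool) (P : Measure (Subject 𝒳 𝒮)) [IsFiniteMeasure P] :
    Regression 𝒳 𝒮 where
  full := full
  m t x _ := mu P t x
  μ := mu P
  measurable_m t := (measurable_mu P t).comp measurable_fst
  measurable_μ := measurable_mu P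

/-- The regressions that use the surrogate. -/
def surrogateRegression (P : Measure (Subject 𝒳 𝒮)) [IsFiniteMeasure P] : Regression 𝒳 𝒮 where
  full := false
  m := muS P
  μ := mu P
  measurable_m := measurable_muS P
  measurable_μ := measurable_mu P

namespace IsRandomized

variable {ε : ℝ} {P : Measure (Subject 𝒳 𝒮)} [IsProbabilityMeasure P] {π η : Bool → 𝒳 → ℝ}

theorem isCentered_covariateRegression (hε : 0 < ε) (h : IsRandomized ε P π η)
    (hY : ∀ t, MemLp (Ypot t) 2 P) (full : Bool) : (covariateRegression full P).IsCentered P where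
  memLp_out := hY
  memLp_m t := (h.mu_spec hε (hY t)).1
  memLp_μ t := (h.mu_spec hε (hY t)).1
  resid t := (h.mu_spec hε (hY t)).2
  devi _ _ _ := by simp [Regression.devi, covariateRegression]

/-- The deviation μ̃ − μ is the difference of the residuals Y(t) − μ and Y(t) − μ̃, both orthogonal
to functions of X. Bounded c come first, so that the two terms are integrable separately. -/
theorem integral_mul_muS_sub_mu (hε : 0 < ε) (h : IsRandomized ε P π η)
    (hY : ∀ t, MemLp (Ypot t) 2 P) (t : Bool) {c : 𝒳 → ℝ} (hc : Measurable c) :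
    ∫ ω, c (X ω) * (muS P t (X ω) (Spot t ω) - mu P t (X ω)) ∂P = 0 := by
  obtain ⟨l1, h1⟩ := h.mu_spec hε (hY t)
  obtain ⟨l2, h2⟩ := h.muS_spec hε (hY t)
  refine integral_comp_mul_eq_zero_of_bounded measurable_X (fun c M hc hM => ?_) hc
  have e1 : ∀ ω, c (X ω) * (muS P t (X ω) (Spot t ω) - mu P t (X ω))
      = c (X ω) * (Ypot t ω - mu P t (X ω))
        - c (X ω) * (Ypot t ω - muS P t (X ω) (Spot t ω)) := fun ω => by ring
  simp_rw [e1]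
  rw [integral_sub, h1 c hc, h2 (fun v => c v.1) (hc.comp measurable_fst), sub_zero]
  · exact (memLp_two_bdd_mul ((hY t).sub l1) (hc.comp measurable_X)
      fun ω => hM _).integrable (by norm_num)
  · exact (memLp_two_bdd_mul ((hY t).sub l2) (hc.comp measurable_X)
      fun ω => hM _).integrable (by norm_num)

theorem isCentered_surrogateRegression (hε : 0 < ε) (h : IsRandomized ε P π η)
    (hY : ∀ t, MemLp (Ypot t) 2 P) : (surrogateRegression P).IsCentered P where
  memLp_out := hY
  memLp_m t := (h.muS_spec hε (hY t)).1
  memLp_μ t := (h.mu_spec hε (hY t)).1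
  resid t c hc := (h.muS_spec hε (hY t)).2 (fun v => c v.1) (hc.comp measurable_fst)
  devi t _ hc := h.integral_mul_muS_sub_mu hε hY t hc

end IsRandomized

end Regressions

/-! ### Second moments and efficiency bounds -/

section Bounds

open scoped ENNReal

/-! ### Uniqueness of the efficient influence function. -/

section Unique

variable {Ω O : Type*} [MeasurableSpace Ω] [MeasurableSpace O] {𝓜 : Set (ProbabilityMeasure Ω)}
  {θ : ProbabilityMeasure Ω → ℝ} {obs : Ω → O} {P : ProbabilityMeasure Ω}

/-- Two influence functions give the same derivative along every submodel, so their difference is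
orthogonal to all scores. If both lie in the closed span, the difference is orthogonal to itself. -/
theorem IsEfficientInfluenceFunction.unique {h h' : Lp ℝ 2 (obsLaw obs P)}
    (hh : IsEfficientInfluenceFunction 𝓜 θ obs P h)
    (hh' : IsEfficientInfluenceFunction 𝓜 θ obs P h') : h = h' := by
  have h1 : h - h' ∈ (Submodule.span ℝ (tangentSet 𝓜 obs P)).topologicalClosure :=
    Submodule.sub_mem _ hh.2 hh'.2
  have h2 : h - h' ∈ (Submodule.span ℝ (tangentSet 𝓜 obs P))ᗮ := by
    rw [Submodule.mem_orthogonal']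
    intro g hg
    induction hg using Submodule.span_induction with
    | mem g hg =>
      obtain ⟨Q, hQ⟩ := hg
      rw [inner_sub_left, (hh.1 Q g hQ).unique (hh'.1 Q g hQ), sub_self]
    | zero => exact inner_zero_right _
    | add a b _ _ ha hb => rw [inner_add_right, ha, hb, add_zero]
    | smul c a _ ha => rw [inner_smul_right, ha, mul_zero]
  rw [← Submodule.orthogonal_orthogonal_eq_closure, Submodule.mem_orthogonal] at h1
  have h3 := h1 _ h2
  rwa [inner_self_eq_zero, sub_eq_zero] at h3

theorem IsEfficientInfluenceFunction.isEfficiencyBound_iff {h : Lp ℝ 2 (obsLaw obs P)}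
    (hh : IsEfficientInfluenceFunction 𝓜 θ obs P h) {v : ℝ} :
    IsEfficiencyBound 𝓜 θ obs P v ↔ v = ∫ o, h o ^ 2 ∂obsLaw obs P := by
  constructor
  · rintro ⟨h', hh', rfl⟩
    rw [hh.unique hh']
  · rintro rfl
    exact ⟨h, hh, rfl⟩

end Unique

variable {𝒳 𝒮 : Type*} [MeasurableSpace 𝒳] [MeasurableSpace 𝒮]

/-- The augmented function with the weights of P is an influence function and a tangent vector,
hence the efficient one. The hypothesis `hhid` is the only place where the observation scheme
restricts the choice of the regression m. -/
theorem Observes.isATEBound_iff {O : Type*} [MeasurableSpace O] [StandardBorelSpace 𝒳]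
    [StandardBorelSpace 𝒮] {ε : ℝ} (hε : 0 < ε) (hε' : ε < 1 / 2)
    {f : 𝒳 × Bool × Bool × 𝒮 × ℝ → O} (hf : Measurable f) {N : Regression 𝒳 𝒮}
    (B : Observes (fun ω : Subject 𝒳 𝒮 => f (actual ω)) N)
    {P : ProbabilityMeasure (Subject 𝒳 𝒮)} (hc : N.IsCentered (P : Measure (Subject 𝒳 𝒮)))
    {π η : Bool → 𝒳 → ℝ} (hP : IsRandomized ε (P : Measure (Subject 𝒳 𝒮)) π η)
    (hhid : N.full = false → ∀ (t : Bool) (K : O → ℝ) (c : 𝒳 → ℝ), Measurable K → Measurable c →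
      ∫ ω, c (X ω) * (K (f (act t false (armData t ω))) * N.resid t (armData t ω))
        ∂(P : Measure (Subject 𝒳 𝒮)) = 0) {v : ℝ} :
    IsATEBound ε (fun ω : Subject 𝒳 𝒮 => f (actual ω)) P v ↔
      v = ∫ ω, N.psi (fun t x => (revealProb N.full π η t x)⁻¹) (fun t x => (π t x)⁻¹)
        (ate (P : Measure (Subject 𝒳 𝒮))) ω ^ 2 ∂(P : Measure (Subject 𝒳 𝒮)) := by
  have hobs : Measurable fun ω : Subject 𝒳 𝒮 => f (actual ω) := hf.comp measurable_actual
  have hε2 : 0 < ε ^ 2 := by positivity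
  have mw : ∀ t, Measurable fun x => (revealProb N.full π η t x)⁻¹ := fun t =>
    (hP.measurable_revealProb N.full t).inv
  have mv : ∀ t, Measurable fun x => (π t x)⁻¹ := fun t => (hP.measurable_treat t).inv
  have wC : ∀ t x, |(revealProb N.full π η t x)⁻¹| ≤ (ε ^ 2)⁻¹ := fun t x =>
    Regression.abs_inv_le hε2 (hP.revealProb_mem hε N.full t x).1
  have vC : ∀ t x, |(π t x)⁻¹| ≤ (ε ^ 2)⁻¹ := fun t x =>
    Regression.abs_inv_le hε2 (hP.sq_le_treat hε t x)
  have hL := B.memLp_psi hobs hc mw mv wC vC (ate (P : Measure (Subject 𝒳 𝒮)))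
  obtain ⟨h, hh⟩ : ∃ h : Lp ℝ 2 (obsLaw (fun ω => f (actual ω)) P),
      h =ᵐ[obsLaw (fun ω => f (actual ω)) P] B.psi (fun t x => (revealProb N.full π η t x)⁻¹)
        (fun t x => (π t x)⁻¹) (ate (P : Measure (Subject 𝒳 𝒮))) := ⟨hL.toLp, hL.coeFn_toLp⟩
  have heff : IsEfficientInfluenceFunction (model 𝒳 𝒮 ε)
      (fun Q => ate (Q : Measure (Subject 𝒳 𝒮))) (fun ω => f (actual ω)) P h :=
    ⟨B.isInfluenceFunction hε hε' hobs hc hP hh,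
      B.mem_closure_span hε hf hc hP hhid mw mv wC vC hh⟩
  rw [IsATEBound, heff.isEfficiencyBound_iff]
  have h1 : ∫ o, h o ^ 2 ∂obsLaw (fun ω => f (actual ω)) P
      = ∫ ω, N.psi (fun t x => (revealProb N.full π η t x)⁻¹) (fun t x => (π t x)⁻¹)
        (ate (P : Measure (Subject 𝒳 𝒮))) ω ^ 2 ∂(P : Measure (Subject 𝒳 𝒮)) := by
    have h2 : ∫ o, h o ^ 2 ∂obsLaw (fun ω => f (actual ω)) P
        = ∫ o, B.psi (fun t x => (revealProb N.full π η t x)⁻¹) (fun t x => (π t x)⁻¹)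
          (ate (P : Measure (Subject 𝒳 𝒮))) o ^ 2 ∂obsLaw (fun ω => f (actual ω)) P := by
      refine integral_congr_ae ?_
      filter_upwards [hh] with o ho
      rw [ho]
    rw [h2, integral_map hobs.aemeasurable
      ((B.measurable_psi mw mv _).pow_const 2).aestronglyMeasurable]
    simp_rw [B.psi_obs]
  rw [h1]

namespace Regression

variable {N : Regression 𝒳 𝒮}

/-- The part of the square of `N.psi` contributed by units of arm `t` with revealed outcome. -/
def sqResid (N : Regression 𝒳 𝒮) (w v : Bool → 𝒳 → ℝ) (c : ℝ) (t : Bool) (z : 𝒳 × 𝒮 × ℝ) : ℝ :=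
  2 * sgn t * (N.μ true z.1 - N.μ false z.1 - c) * w t z.1 * N.resid t z
    + (w t z.1 ^ 2 * N.resid t z ^ 2 + 2 * w t z.1 * v t z.1 * (N.resid t z * N.devi t z))

/-- The part of the square of `N.psi` contributed by all units of arm `t`. -/
def sqDevi (N : Regression 𝒳 𝒮) (v : Bool → 𝒳 → ℝ) (c : ℝ) (t : Bool) (z : 𝒳 × 𝒮 × ℝ) : ℝ :=
  2 * sgn t * (N.μ true z.1 - N.μ false z.1 - c) * v t z.1 * N.devi t z
    + v t z.1 ^ 2 * N.devi t z ^ 2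

/-- The two arms are disjoint events, so products across arms vanish. -/
theorem psi_sq (w v : Bool → 𝒳 → ℝ) (c : ℝ) (ω : Subject 𝒳 𝒮) :
    N.psi w v c ω ^ 2 = (N.μ true (X ω) - N.μ false (X ω) - c) ^ 2
      + (((revealed N.full true).indicator (fun ω => N.sqResid w v c true (armData true ω)) ω
          + (T ⁻¹' {true}).indicator (fun ω => N.sqDevi v c true (armData true ω)) ω)
        + ((revealed N.full false).indicator (fun ω => N.sqResid w v c false (armData false ω)) ω
          + (T ⁻¹' {false}).indicator (fun ω => N.sqDevi v c false (armData false ω)) ω)) := by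
  have h3 : ∀ t, (armData t ω).1 = X ω := fun _ => rfl
  unfold psi sqResid sqDevi
  cases hT : T ω <;> cases hF : N.full <;> cases hR : R ω <;>
    simp [Set.indicator, revealed, hT, hR, sgn, ind, h3] <;> ring

/-- Taking means over treatment and labelling multiplies each term by the reciprocal of its weight,
which turns w² into w. Products with a function of X vanish by centering, and residual times
deviation vanishes by `hcross`. -/
theorem IsCentered.integral_psi_sq {ε : ℝ} (hε : 0 < ε) {P : Measure (Subject 𝒳 𝒮)}
    [IsProbabilityMeasure P] {π η : Bool → 𝒳 → ℝ} (hP : IsRandomized ε P π η)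
    (hc : N.IsCentered P) (hcross : ∀ t (a : 𝒳 → ℝ), Measurable a →
      ∫ ω, a (X ω) * (N.resid t (armData t ω) * N.devi t (armData t ω)) ∂P = 0) (c : ℝ) :
    ∫ ω, N.psi (fun t x => (revealProb N.full π η t x)⁻¹) (fun t x => (π t x)⁻¹) c ω ^ 2 ∂P
      = ∫ ω, (N.μ true (X ω) - N.μ false (X ω) - c) ^ 2 ∂P
        + ((∫ ω, (revealProb N.full π η true (X ω))⁻¹ * N.resid true (armData true ω) ^ 2 ∂P
            + ∫ ω, (π true (X ω))⁻¹ * N.devi true (armData true ω) ^ 2 ∂P)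
          + (∫ ω, (revealProb N.full π η false (X ω))⁻¹ * N.resid false (armData false ω) ^ 2 ∂P
            + ∫ ω, (π false (X ω))⁻¹ * N.devi false (armData false ω) ^ 2 ∂P)) := by
  set w : Bool → 𝒳 → ℝ := fun t x => (revealProb N.full π η t x)⁻¹ with hw
  set v : Bool → 𝒳 → ℝ := fun t x => (π t x)⁻¹ with hv
  have hε2 : 0 < ε ^ 2 := by positivity
  have mw : ∀ t, Measurable (w t) := fun t => (hP.measurable_revealProb N.full t).inv
  have mv : ∀ t, Measurable (v t) := fun t => (hP.measurable_treat t).inv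
  have wC : ∀ t x, |w t x| ≤ (ε ^ 2)⁻¹ := fun t x =>
    abs_inv_le hε2 (hP.revealProb_mem hε N.full t x).1
  have vC : ∀ t x, |v t x| ≤ (ε ^ 2)⁻¹ := fun t x => abs_inv_le hε2 (hP.sq_le_treat hε t x)
  have haw : ∀ t x, revealProb N.full π η t x * w t x = 1 := fun t x =>
    mul_inv_cancel₀ (ne_of_gt (hε2.trans_le (hP.revealProb_mem hε N.full t x).1))
  have hpv : ∀ t x, π t x * v t x = 1 := fun t x =>
    mul_inv_cancel₀ (ne_of_gt (hε.trans_le (hP.treat_mem t x).1))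
  have lA : MemLp (fun ω => N.μ true (X ω) - N.μ false (X ω) - c) 2 P :=
    ((hc.memLp_μ true).sub (hc.memLp_μ false)).sub (memLp_const c)
  have mA : Measurable fun x => N.μ true x - N.μ false x - c :=
    ((N.measurable_μ true).sub (N.measurable_μ false)).sub_const c
  have lr := fun t => hc.memLp_weighted_resid mw wC t
  have ld := fun t => hc.memLp_weighted_devi mv vC t
  have i1 : ∀ t, MeasureTheory.Integrable (fun ω => 2 * sgn t
      * (N.μ true (X ω) - N.μ false (X ω) - c) * w t (X ω) * N.resid t (armData t ω)) P := by
    intro t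
    refine ((lA.integrable_mul (lr t)).const_mul (2 * sgn t)).congr (ae_of_all _ fun ω => ?_)
    simp only [Pi.mul_apply]; ring
  have i2 : ∀ t, MeasureTheory.Integrable
      (fun ω => w t (X ω) ^ 2 * N.resid t (armData t ω) ^ 2) P := by
    intro t
    refine (lr t).integrable_sq.congr (ae_of_all _ fun ω => ?_)
    simp only [mul_pow]
  have i3 : ∀ t, MeasureTheory.Integrable (fun ω => 2 * w t (X ω) * v t (X ω)
      * (N.resid t (armData t ω) * N.devi t (armData t ω))) P := by
    intro t
    refine (((lr t).integrable_mul (ld t)).const_mul 2).congr (ae_of_all _ fun ω => ?_)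
    simp only [Pi.mul_apply]; ring
  have i4 : ∀ t, MeasureTheory.Integrable (fun ω => 2 * sgn t
      * (N.μ true (X ω) - N.μ false (X ω) - c) * v t (X ω) * N.devi t (armData t ω)) P := by
    intro t
    refine ((lA.integrable_mul (ld t)).const_mul (2 * sgn t)).congr (ae_of_all _ fun ω => ?_)
    simp only [Pi.mul_apply]; ring
  have i5 : ∀ t, MeasureTheory.Integrable
      (fun ω => v t (X ω) ^ 2 * N.devi t (armData t ω) ^ 2) P := by
    intro t
    refine (ld t).integrable_sq.congr (ae_of_all _ fun ω => ?_)
    simp only [mul_pow]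
  have iR : ∀ t, MeasureTheory.Integrable (fun ω => N.sqResid w v c t (armData t ω)) P := fun t =>
    (i1 t).add ((i2 t).add (i3 t))
  have iD : ∀ t, MeasureTheory.Integrable (fun ω => N.sqDevi v c t (armData t ω)) P := fun t =>
    (i4 t).add (i5 t)
  have mR : ∀ t, Measurable (N.sqResid w v c t) := fun t =>
    ((((measurable_const.mul (mA.comp measurable_fst)).mul ((mw t).comp measurable_fst)).mul
      (N.measurable_resid t)).add (((((mw t).comp measurable_fst).pow_const 2).mul
      ((N.measurable_resid t).pow_const 2)).add ((((measurable_const.mul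
        ((mw t).comp measurable_fst)).mul ((mv t).comp measurable_fst))).mul
        ((N.measurable_resid t).mul (N.measurable_devi t)))))
  have mD : ∀ t, Measurable (N.sqDevi v c t) := fun t =>
    ((((measurable_const.mul (mA.comp measurable_fst)).mul ((mv t).comp measurable_fst)).mul
      (N.measurable_devi t)).add ((((mv t).comp measurable_fst).pow_const 2).mul
      ((N.measurable_devi t).pow_const 2)))
  have hR : ∀ t, ∫ ω in revealed N.full t, N.sqResid w v c t (armData t ω) ∂P
      = ∫ ω, w t (X ω) * N.resid t (armData t ω) ^ 2 ∂P := by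
    intro t
    have ha := hP.measurable_revealProb N.full t
    have ha01 : ∀ x, revealProb N.full π η t x ∈ Set.Icc 0 1 := fun x =>
      ⟨hε2.le.trans (hP.revealProb_mem hε N.full t x).1, (hP.revealProb_mem hε N.full t x).2⟩
    rw [(hP.reveal N.full t).integral (measurable_armData t) (ha.comp measurable_fst)
      (fun z => (ha01 z.1).1) (mR t)]
    have e1 : ∀ ω, revealProb N.full π η t (armData t ω).1 * N.sqResid w v c t (armData t ω)
        = (2 * sgn t * (N.μ true (X ω) - N.μ false (X ω) - c)) * N.resid t (armData t ω)
          + (w t (X ω) * N.resid t (armData t ω) ^ 2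
          + 2 * v t (X ω) * (N.resid t (armData t ω) * N.devi t (armData t ω))) := by
      intro ω
      have h1 : (armData t ω).1 = X ω := rfl
      simp only [sqResid, h1]
      linear_combination (2 * sgn t * (N.μ true (X ω) - N.μ false (X ω) - c)
        * N.resid t (armData t ω) + w t (X ω) * N.resid t (armData t ω) ^ 2
        + 2 * v t (X ω) * (N.resid t (armData t ω) * N.devi t (armData t ω))) * haw t (X ω)
    have j1 : MeasureTheory.Integrable (fun ω =>
        (2 * sgn t * (N.μ true (X ω) - N.μ false (X ω) - c)) * N.resid t (armData t ω)) P := by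
      refine ((lA.integrable_mul (hc.memLp_resid t)).const_mul (2 * sgn t)).congr
        (ae_of_all _ fun ω => ?_)
      simp only [Pi.mul_apply]; ring
    have j2 : MeasureTheory.Integrable (fun ω => w t (X ω) * N.resid t (armData t ω) ^ 2) P :=
      (hc.memLp_resid t).integrable_sq.bdd_mul ((mw t).comp measurable_X).aestronglyMeasurable
        (ae_of_all _ fun ω => wC t _)
    have j3 : MeasureTheory.Integrable (fun ω => 2 * v t (X ω)
        * (N.resid t (armData t ω) * N.devi t (armData t ω))) P := by
      refine (((hc.memLp_resid t).integrable_mul (ld t)).const_mul 2).congr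
        (ae_of_all _ fun ω => ?_)
      simp only [Pi.mul_apply]; ring
    have j23 : MeasureTheory.Integrable (fun ω => w t (X ω) * N.resid t (armData t ω) ^ 2
        + 2 * v t (X ω) * (N.resid t (armData t ω) * N.devi t (armData t ω))) P := j2.add j3
    simp_rw [e1]
    rw [integral_add j1 j23, integral_add j2 j3,
      hc.resid t (fun x => 2 * sgn t * (N.μ true x - N.μ false x - c)) (mA.const_mul _),
      hcross t (fun x => 2 * v t x) ((mv t).const_mul 2), zero_add, add_zero]
  have hD : ∀ t, ∫ ω in T ⁻¹' {t}, N.sqDevi v c t (armData t ω) ∂P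
      = ∫ ω, v t (X ω) * N.devi t (armData t ω) ^ 2 ∂P := by
    intro t
    rw [(hP.treat t).integral (measurable_armData t) ((hP.measurable_treat t).comp measurable_fst)
      (fun z => hε.le.trans (hP.treat_mem t z.1).1) (mD t)]
    have e1 : ∀ ω, π t (armData t ω).1 * N.sqDevi v c t (armData t ω)
        = (2 * sgn t * (N.μ true (X ω) - N.μ false (X ω) - c)) * N.devi t (armData t ω)
          + v t (X ω) * N.devi t (armData t ω) ^ 2 := by
      intro ω
      have h1 : (armData t ω).1 = X ω := rfl
      simp only [sqDevi, h1]
      linear_combination (2 * sgn t * (N.μ true (X ω) - N.μ false (X ω) - c)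
        * N.devi t (armData t ω) + v t (X ω) * N.devi t (armData t ω) ^ 2) * hpv t (X ω)
    have j1 : MeasureTheory.Integrable (fun ω =>
        (2 * sgn t * (N.μ true (X ω) - N.μ false (X ω) - c)) * N.devi t (armData t ω)) P := by
      refine ((lA.integrable_mul (hc.memLp_devi t)).const_mul (2 * sgn t)).congr
        (ae_of_all _ fun ω => ?_)
      simp only [Pi.mul_apply]; ring
    have j2 : MeasureTheory.Integrable (fun ω => v t (X ω) * N.devi t (armData t ω) ^ 2) P :=
      (hc.memLp_devi t).integrable_sq.bdd_mul ((mv t).comp measurable_X).aestronglyMeasurable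
        (ae_of_all _ fun ω => vC t _)
    simp_rw [e1]
    rw [integral_add j1 j2,
      hc.devi t (fun x => 2 * sgn t * (N.μ true x - N.μ false x - c)) (mA.const_mul _), zero_add]
  have kR := fun t => (iR t).indicator (measurableSet_revealed N.full t)
  have kD := fun t => (iD t).indicator (measurableSet_arm (𝒳 := 𝒳) (𝒮 := 𝒮) t)
  have kS := fun t => (kR t).add (kD t)
  have hS : ∀ t, ∫ ω, ((revealed N.full t).indicator
      (fun ω => N.sqResid w v c t (armData t ω)) ω
        + (T ⁻¹' {t}).indicator (fun ω => N.sqDevi v c t (armData t ω)) ω) ∂P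
      = ∫ ω, w t (X ω) * N.resid t (armData t ω) ^ 2 ∂P
        + ∫ ω, v t (X ω) * N.devi t (armData t ω) ^ 2 ∂P := by
    intro t
    rw [integral_add (kR t) (kD t), integral_indicator (measurableSet_revealed N.full t),
      integral_indicator (measurableSet_arm t), hR, hD]
  simp_rw [psi_sq]
  refine (integral_add lA.integrable_sq ((kS true).add (kS false))).trans ?_
  congr 1
  refine (integral_add (kS true) (kS false)).trans ?_
  exact congrArg₂ (· + ·) (hS true) (hS false)

end Regression

end Bounds

/-! ### The three observation schemes -/

section Schemes

variable {𝒳 𝒮 : Type*} [MeasurableSpace 𝒳] [MeasurableSpace 𝒮]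

/-- The data observed without surrogates as a function of the actual data. -/
def schemeI (d : 𝒳 × Bool × Bool × 𝒮 × ℝ) : 𝒳 × Bool × Bool × ℝ :=
  (d.1, d.2.1, d.2.2.1, ind d.2.2.1 * d.2.2.2.2)

/-- The data observed with surrogates on all units as a function of the actual data. -/
def schemeIII (d : 𝒳 × Bool × Bool × 𝒮 × ℝ) : 𝒳 × Bool × 𝒮 × Bool × ℝ :=
  (d.1, d.2.1, d.2.2.2.1, d.2.2.1, ind d.2.2.1 * d.2.2.2.2)

/-- The fully labelled data as a function of the actual data. -/
def schemeIV (d : 𝒳 × Bool × Bool × 𝒮 × ℝ) : 𝒳 × Bool × 𝒮 × ℝ :=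
  (d.1, d.2.1, d.2.2.2.1, d.2.2.2.2)

theorem measurable_ind_comp {α : Type*} [MeasurableSpace α] {b : α → Bool} (hb : Measurable b) :
    Measurable fun a => ind (b a) :=
  Observes.measurable_ind.comp hb

theorem measurable_schemeI : Measurable (schemeI : 𝒳 × Bool × Bool × 𝒮 × ℝ → _) :=
  measurable_fst.prodMk ((by fun_prop : Measurable fun d : 𝒳 × Bool × Bool × 𝒮 × ℝ => d.2.1).prodMk
    ((by fun_prop : Measurable fun d : 𝒳 × Bool × Bool × 𝒮 × ℝ => d.2.2.1).prodMk
      ((measurable_ind_comp (by fun_prop)).mul (by fun_prop))))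

theorem measurable_schemeIII : Measurable (schemeIII : 𝒳 × Bool × Bool × 𝒮 × ℝ → _) :=
  measurable_fst.prodMk ((by fun_prop : Measurable fun d : 𝒳 × Bool × Bool × 𝒮 × ℝ => d.2.1).prodMk
    ((by fun_prop : Measurable fun d : 𝒳 × Bool × Bool × 𝒮 × ℝ => d.2.2.2.1).prodMk
      ((by fun_prop : Measurable fun d : 𝒳 × Bool × Bool × 𝒮 × ℝ => d.2.2.1).prodMk
        ((measurable_ind_comp (by fun_prop)).mul (by fun_prop)))))

theorem measurable_schemeIV : Measurable (schemeIV : 𝒳 × Bool × Bool × 𝒮 × ℝ → _) := by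
  unfold schemeIV; fun_prop

variable (P : Measure (Subject 𝒳 𝒮)) [IsFiniteMeasure P]

/-- Without surrogates, the regressions on covariates are observed. -/
def observesI : Observes (fun ω : Subject 𝒳 𝒮 => schemeI (actual ω))
    (covariateRegression false P) where
  cov o := o.1
  treat o := o.2.1
  reveal o := o.2.2.1
  out o := o.2.2.2
  reg o := mu P o.2.1 o.1
  measurable_cov := by fun_prop
  measurable_treat := by fun_prop
  measurable_reveal := by fun_prop
  measurable_out := by fun_prop
  measurable_reg := measurable_bool_apply (w := fun t (o : 𝒳 × Bool × Bool × ℝ) => mu P t o.1)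
    (fun t => (measurable_mu P t).comp measurable_fst) (by fun_prop) measurable_id
  cov_obs _ := rfl
  treat_obs _ := rfl
  reveal_obs _ := rfl
  out_obs _ := rfl
  reg_obs _ := rfl

/-- With surrogates on all units, the regressions on covariates and surrogates are observed. -/
def observesIII : Observes (fun ω : Subject 𝒳 𝒮 => schemeIII (actual ω))
    (surrogateRegression P) where
  cov o := o.1
  treat o := o.2.1
  reveal o := o.2.2.2.1
  out o := o.2.2.2.2
  reg o := muS P o.2.1 o.1 o.2.2.1
  measurable_cov := by fun_prop
  measurable_treat := by fun_prop
  measurable_reveal := by fun_prop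
  measurable_out := by fun_prop
  measurable_reg := measurable_bool_apply
    (w := fun t (o : 𝒳 × Bool × 𝒮 × Bool × ℝ) => muS P t o.1 o.2.2.1)
    (fun t => (measurable_muS P t).comp
      (f := fun o : 𝒳 × Bool × 𝒮 × Bool × ℝ => (o.1, o.2.2.1)) (by fun_prop))
    (by fun_prop) measurable_id
  cov_obs _ := rfl
  treat_obs _ := rfl
  reveal_obs _ := rfl
  out_obs _ := rfl
  reg_obs _ := rfl

/-- With fully labelled data, the regressions on covariates are observed. -/
def observesIV : Observes (fun ω : Subject 𝒳 𝒮 => schemeIV (actual ω))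
    (covariateRegression true P) where
  cov o := o.1
  treat o := o.2.1
  reveal _ := true
  out o := o.2.2.2
  reg o := mu P o.2.1 o.1
  measurable_cov := by fun_prop
  measurable_treat := by fun_prop
  measurable_reveal := by fun_prop
  measurable_out := by fun_prop
  measurable_reg := measurable_bool_apply (w := fun t (o : 𝒳 × Bool × 𝒮 × ℝ) => mu P t o.1)
    (fun t => (measurable_mu P t).comp measurable_fst) (by fun_prop) measurable_id
  cov_obs _ := rfl
  treat_obs _ := rfl
  reveal_obs _ := by simp [covariateRegression]
  out_obs ω := by simp [covariateRegression, ind, schemeIV, actual]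
  reg_obs _ := rfl

variable {P} {π η : Bool → 𝒳 → ℝ}

theorem psiI_ae_eq (he : ∀ᵐ ω ∂P, e P (X ω) = π true (X ω) ∧ 1 - e P (X ω) = π false (X ω))
    (hr : ∀ t, ∀ᵐ ω ∂P, r P t (X ω) = η t (X ω)) :
    psiI P =ᵐ[P] (covariateRegression false P).psi
      (fun t x => (revealProb (covariateRegression false P).full π η t x)⁻¹)
      (fun t x => (π t x)⁻¹) (ate P) := by
  filter_upwards [he, hr true, hr false] with ω h1 h2 h3
  rw [psiI, h1.2, h1.1, h2, h3]
  cases hT : T ω <;> cases hR : R ω <;>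
    (simp [Regression.psi, Regression.resid, Regression.devi, covariateRegression, revealProb,
      armData, sgn, ind, Y, hT, hR]
     try ring)

theorem psiIII_ae_eq (he : ∀ᵐ ω ∂P, e P (X ω) = π true (X ω) ∧ 1 - e P (X ω) = π false (X ω))
    (hr : ∀ t, ∀ᵐ ω ∂P, r P t (X ω) = η t (X ω)) :
    psiIII P =ᵐ[P] (surrogateRegression P).psi
      (fun t x => (revealProb (surrogateRegression P).full π η t x)⁻¹)
      (fun t x => (π t x)⁻¹) (ate P) := by
  filter_upwards [he, hr true, hr false] with ω h1 h2 h3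
  rw [psiIII, h1.2, h1.1, h2, h3]
  cases hT : T ω <;> cases hR : R ω <;>
    simp [Regression.psi, Regression.resid, Regression.devi, surrogateRegression, revealProb,
      armData, sgn, ind, Y, S, hT, hR] <;> ring

theorem psiIV_ae_eq (he : ∀ᵐ ω ∂P, e P (X ω) = π true (X ω) ∧ 1 - e P (X ω) = π false (X ω)) :
    psiIV P =ᵐ[P] (covariateRegression true P).psi
      (fun t x => (revealProb (covariateRegression true P).full π η t x)⁻¹)
      (fun t x => (π t x)⁻¹) (ate P) := by
  filter_upwards [he] with ω h1
  rw [psiIV, h1.2, h1.1]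
  cases hT : T ω
  · simp [Regression.psi, Regression.resid, Regression.devi, covariateRegression, revealProb,
      armData, sgn, ind, Y, hT]
    ring
  · simp [Regression.psi, Regression.resid, Regression.devi, covariateRegression, revealProb,
      armData, sgn, ind, Y, hT]

end Schemes

/-! ### Gaps between the bounds -/

section Gaps

variable {𝒳 𝒮 : Type*} [MeasurableSpace 𝒳] [MeasurableSpace 𝒮]

/-- The relative weight of a missing label. -/
def missWeight (π η : Bool → 𝒳 → ℝ) (t : Bool) (x : 𝒳) : ℝ := 1 / π t x * ((1 - η t x) / η t x)

namespace IsWeights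

variable {ε : ℝ} {π η : Bool → 𝒳 → ℝ}

theorem measurable_missWeight (h : IsWeights ε π η) (t : Bool) : Measurable (missWeight π η t) :=
  (measurable_const.div (h.measurable_treat t)).mul
    ((measurable_const.sub (h.measurable_label t)).div (h.measurable_label t))

/-- The inverse weight of a labelled unit is that of a treated unit plus a surcharge for missing
labels. The surcharge is the weight in both gaps. -/
theorem inv_mul_eq (h : IsWeights ε π η) (hε : 0 < ε) (t : Bool) (x : 𝒳) :
    (π t x * η t x)⁻¹ = (π t x)⁻¹ + missWeight π η t x := by
  have h1 := hε.trans_le (h.treat_mem t x).1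
  have h2 := hε.trans_le (h.label_mem t x).1
  unfold missWeight
  field_simp
  ring

theorem abs_inv_treat_le (h : IsWeights ε π η) (hε : 0 < ε) (t : Bool) (x : 𝒳) :
    |(π t x)⁻¹| ≤ (ε ^ 2)⁻¹ :=
  Regression.abs_inv_le (by positivity) (h.sq_le_treat hε t x)

theorem abs_inv_mul_le (h : IsWeights ε π η) (hε : 0 < ε) (t : Bool) (x : 𝒳) :
    |(π t x * η t x)⁻¹| ≤ (ε ^ 2)⁻¹ :=
  Regression.abs_inv_le (by positivity) (h.revealProb_mem hε false t x).1

theorem abs_missWeight_le (h : IsWeights ε π η) (hε : 0 < ε) (t : Bool) (x : 𝒳) :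
    |missWeight π η t x| ≤ 2 * (ε ^ 2)⁻¹ := by
  have h1 : missWeight π η t x = (π t x * η t x)⁻¹ - (π t x)⁻¹ := by
    rw [h.inv_mul_eq hε]; ring
  rw [h1, two_mul]
  exact (abs_sub _ _).trans (add_le_add (h.abs_inv_mul_le hε t x) (h.abs_inv_treat_le hε t x))

theorem integral_inv_mul (h : IsWeights ε π η) (hε : 0 < ε) {P : Measure (Subject 𝒳 𝒮)} (t : Bool)
    {g : Subject 𝒳 𝒮 → ℝ} (hg : MemLp g 2 P) :
    ∫ ω, (π t (X ω) * η t (X ω))⁻¹ * g ω ^ 2 ∂P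
      = ∫ ω, (π t (X ω))⁻¹ * g ω ^ 2 ∂P + ∫ ω, missWeight π η t (X ω) * g ω ^ 2 ∂P := by
  simp_rw [h.inv_mul_eq hε, add_mul]
  refine integral_add ?_ ?_
  · exact hg.integrable_sq.bdd_mul
      ((h.measurable_treat t).inv.comp measurable_X).aestronglyMeasurable
      (ae_of_all _ fun ω => h.abs_inv_treat_le hε t _)
  · exact hg.integrable_sq.bdd_mul
      ((h.measurable_missWeight t).comp measurable_X).aestronglyMeasurable
      (ae_of_all _ fun ω => h.abs_missWeight_le hε t _)

end IsWeights

namespace IsRandomized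

variable {ε : ℝ} {P : Measure (Subject 𝒳 𝒮)} [IsProbabilityMeasure P] {π η : Bool → 𝒳 → ℝ}

theorem integral_mul_resid_mul_devi (hε : 0 < ε) (h : IsRandomized ε P π η)
    (hY : ∀ t, MemLp (Ypot t) 2 P) (t : Bool) {c : 𝒳 → ℝ} (hc : Measurable c) :
    ∫ ω, c (X ω) * ((Ypot t ω - muS P t (X ω) (Spot t ω))
      * (muS P t (X ω) (Spot t ω) - mu P t (X ω))) ∂P = 0 := by
  rw [← (h.muS_spec hε (hY t)).2 (fun v => c v.1 * (muS P t v.1 v.2 - mu P t v.1))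
    ((hc.comp measurable_fst).mul ((measurable_muS P t).sub
      ((measurable_mu P t).comp measurable_fst)))]
  refine integral_congr_ae (ae_of_all _ fun ω => ?_)
  ring

/-- Pythagoras: Y(t) − μ is the sum of Y(t) − μ̃ and μ̃ − μ, which are orthogonal even after
weighting by a function of X. -/
theorem integral_mul_sq_add (hε : 0 < ε) (h : IsRandomized ε P π η)
    (hY : ∀ t, MemLp (Ypot t) 2 P) (t : Bool) {c : 𝒳 → ℝ} (hc : Measurable c) {C : ℝ}
    (hC : ∀ x, |c x| ≤ C) :
    ∫ ω, c (X ω) * (Ypot t ω - mu P t (X ω)) ^ 2 ∂P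
      = ∫ ω, c (X ω) * (Ypot t ω - muS P t (X ω) (Spot t ω)) ^ 2 ∂P
        + ∫ ω, c (X ω) * (muS P t (X ω) (Spot t ω) - mu P t (X ω)) ^ 2 ∂P := by
  have l1 := (hY t).sub (h.muS_spec hε (hY t)).1
  have l2 := (h.muS_spec hε (hY t)).1.sub (h.mu_spec hε (hY t)).1
  have hb : ∀ {g : Subject 𝒳 𝒮 → ℝ}, Integrable g P → Integrable (fun ω => c (X ω) * g ω) P :=
    fun hg => hg.bdd_mul (hc.comp measurable_X).aestronglyMeasurable (ae_of_all _ fun ω => hC _)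
  have i1 : Integrable (fun ω => c (X ω) * (Ypot t ω - muS P t (X ω) (Spot t ω)) ^ 2) P :=
    hb l1.integrable_sq
  have i2 : Integrable (fun ω => c (X ω) * (muS P t (X ω) (Spot t ω) - mu P t (X ω)) ^ 2) P :=
    hb l2.integrable_sq
  have i3 : Integrable (fun ω => 2 * (c (X ω) * ((Ypot t ω - muS P t (X ω) (Spot t ω))
      * (muS P t (X ω) (Spot t ω) - mu P t (X ω))))) P := (hb (l1.integrable_mul l2)).const_mul 2
  have i12 : Integrable (fun ω => c (X ω) * (Ypot t ω - muS P t (X ω) (Spot t ω)) ^ 2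
    + c (X ω) * (muS P t (X ω) (Spot t ω) - mu P t (X ω)) ^ 2) P := i1.add i2
  have z : ∫ ω, 2 * (c (X ω) * ((Ypot t ω - muS P t (X ω) (Spot t ω))
      * (muS P t (X ω) (Spot t ω) - mu P t (X ω)))) ∂P = 0 := by
    rw [integral_const_mul, h.integral_mul_resid_mul_devi hε hY t hc, mul_zero]
  have e1 := integral_add i12 i3
  rw [z, add_zero, integral_add i1 i2] at e1
  rw [← e1]
  refine integral_congr_ae (ae_of_all _ fun ω => ?_)
  ring

/-- The conditional mean of μ̃(t, X, S(t)) given X is μ(t, X), so the conditional variance is the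
conditional mean of the squared deviation. -/
theorem integral_mul_condVar_muS (hε : 0 < ε) (h : IsRandomized ε P π η)
    (hY : ∀ t, MemLp (Ypot t) 2 P) (t : Bool) :
    Integrable (fun ω => missWeight π η t (X ω) * condVar (MeasurableSpace.comap X inferInstance)
        (fun ω => muS P t (X ω) (Spot t ω)) P ω) P ∧
      ∫ ω, missWeight π η t (X ω) * condVar (MeasurableSpace.comap X inferInstance)
        (fun ω => muS P t (X ω) (Spot t ω)) P ω ∂P
      = ∫ ω, missWeight π η t (X ω) * (muS P t (X ω) (Spot t ω) - mu P t (X ω)) ^ 2 ∂P :=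
  integral_mul_condVar measurable_X (h.muS_spec hε (hY t)).1 (measurable_mu P t)
    (h.mu_spec hε (hY t)).1 (fun _ hc => h.integral_mul_muS_sub_mu hε hY t hc)
    (h.measurable_missWeight t) (h.abs_missWeight_le hε t)

theorem integral_mul_condVar_out (hε : 0 < ε) (h : IsRandomized ε P π η)
    (hY : ∀ t, MemLp (Ypot t) 2 P) (t : Bool) :
    Integrable (fun ω => missWeight π η t (X ω)
        * condVar (MeasurableSpace.comap (fun ω => (X ω, Spot t ω)) inferInstance)
          (Ypot t) P ω) P ∧
      ∫ ω, missWeight π η t (X ω)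
        * condVar (MeasurableSpace.comap (fun ω => (X ω, Spot t ω)) inferInstance)
          (Ypot t) P ω ∂P
      = ∫ ω, missWeight π η t (X ω) * (Ypot t ω - muS P t (X ω) (Spot t ω)) ^ 2 ∂P :=
  integral_mul_condVar (measurable_X.prodMk (measurable_Spot t)) (hY t)
    (m := fun v => muS P t v.1 v.2) (measurable_muS P t)
    (h.muS_spec hε (hY t)).1 (h.muS_spec hε (hY t)).2
    (c := fun v => missWeight π η t v.1) ((h.measurable_missWeight t).comp measurable_fst)
    (fun v => h.abs_missWeight_le hε t v.1)

theorem gainIntegrand_spec (hε : 0 < ε) (h : IsRandomized ε P π η) (hY : ∀ t, MemLp (Ypot t) 2 P)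
    (he : ∀ᵐ ω ∂P, e P (X ω) = π true (X ω) ∧ 1 - e P (X ω) = π false (X ω))
    (hr : ∀ t, ∀ᵐ ω ∂P, r P t (X ω) = η t (X ω)) :
    Integrable (gainIntegrand P) P ∧ ∫ ω, gainIntegrand P ω ∂P
      = ∫ ω, missWeight π η true (X ω) * (muS P true (X ω) (Spot true ω) - mu P true (X ω)) ^ 2 ∂P
        + ∫ ω, missWeight π η false (X ω)
          * (muS P false (X ω) (Spot false ω) - mu P false (X ω)) ^ 2 ∂P := by
  have h1 := h.integral_mul_condVar_muS hε hY true
  have h2 := h.integral_mul_condVar_muS hε hY false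
  have e1 : gainIntegrand P =ᵐ[P] fun ω => missWeight π η true (X ω)
        * condVar (MeasurableSpace.comap X inferInstance)
          (fun ω => muS P true (X ω) (Spot true ω)) P ω
      + missWeight π η false (X ω) * condVar (MeasurableSpace.comap X inferInstance)
          (fun ω => muS P false (X ω) (Spot false ω)) P ω := by
    filter_upwards [he, hr true, hr false] with ω a b c
    rw [gainIntegrand, a.2, a.1, b, c]
    rfl
  refine ⟨(h1.1.add h2.1).congr e1.symm, ?_⟩
  rw [integral_congr_ae e1, integral_add h1.1 h2.1, h1.2, h2.2]

theorem lossIntegrand_spec (hε : 0 < ε) (h : IsRandomized ε P π η) (hY : ∀ t, MemLp (Ypot t) 2 P)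
    (he : ∀ᵐ ω ∂P, e P (X ω) = π true (X ω) ∧ 1 - e P (X ω) = π false (X ω))
    (hr : ∀ t, ∀ᵐ ω ∂P, r P t (X ω) = η t (X ω)) :
    Integrable (lossIntegrand P) P ∧ ∫ ω, lossIntegrand P ω ∂P
      = ∫ ω, missWeight π η true (X ω) * (Ypot true ω - muS P true (X ω) (Spot true ω)) ^ 2 ∂P
        + ∫ ω, missWeight π η false (X ω)
          * (Ypot false ω - muS P false (X ω) (Spot false ω)) ^ 2 ∂P := by
  have h1 := h.integral_mul_condVar_out hε hY true
  have h2 := h.integral_mul_condVar_out hε hY false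
  have e1 : lossIntegrand P =ᵐ[P] fun ω => missWeight π η true (X ω)
        * condVar (MeasurableSpace.comap (fun ω => (X ω, Spot true ω)) inferInstance)
          (Ypot true) P ω
      + missWeight π η false (X ω)
        * condVar (MeasurableSpace.comap (fun ω => (X ω, Spot false ω)) inferInstance)
          (Ypot false) P ω := by
    filter_upwards [he, hr true, hr false] with ω a b c
    rw [lossIntegrand, a.2, a.1, b, c]
    rfl
  refine ⟨(h1.1.add h2.1).congr e1.symm, ?_⟩
  rw [integral_congr_ae e1, integral_add h1.1 h2.1, h1.2, h2.2]

theorem integral_psi_sq_covariateRegression (hε : 0 < ε) (h : IsRandomized ε P π η)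
    (hY : ∀ t, MemLp (Ypot t) 2 P) (full : Bool) (c : ℝ) :
    ∫ ω, (covariateRegression full P).psi
        (fun t x => (revealProb (covariateRegression full P).full π η t x)⁻¹)
        (fun t x => (π t x)⁻¹) c ω ^ 2 ∂P
      = ∫ ω, (mu P true (X ω) - mu P false (X ω) - c) ^ 2 ∂P
        + (∫ ω, (revealProb full π η true (X ω))⁻¹ * (Ypot true ω - mu P true (X ω)) ^ 2 ∂P
          + ∫ ω, (revealProb full π η false (X ω))⁻¹
            * (Ypot false ω - mu P false (X ω)) ^ 2 ∂P) := by
  have hd : ∀ t z, (covariateRegression full P).devi t z = 0 := fun t z => sub_self _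
  rw [(h.isCentered_covariateRegression hε hY full).integral_psi_sq hε h
    (fun t a _ => by simp [hd])]
  simp only [hd]
  simp [Regression.resid, covariateRegression, armData]

theorem integral_psi_sq_surrogateRegression (hε : 0 < ε) (h : IsRandomized ε P π η)
    (hY : ∀ t, MemLp (Ypot t) 2 P) (c : ℝ) :
    ∫ ω, (surrogateRegression P).psi
        (fun t x => (revealProb (surrogateRegression P).full π η t x)⁻¹)
        (fun t x => (π t x)⁻¹) c ω ^ 2 ∂P
      = ∫ ω, (mu P true (X ω) - mu P false (X ω) - c) ^ 2 ∂P
        + ((∫ ω, (π true (X ω) * η true (X ω))⁻¹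
              * (Ypot true ω - muS P true (X ω) (Spot true ω)) ^ 2 ∂P
            + ∫ ω, (π true (X ω))⁻¹
              * (muS P true (X ω) (Spot true ω) - mu P true (X ω)) ^ 2 ∂P)
          + (∫ ω, (π false (X ω) * η false (X ω))⁻¹
              * (Ypot false ω - muS P false (X ω) (Spot false ω)) ^ 2 ∂P
            + ∫ ω, (π false (X ω))⁻¹
              * (muS P false (X ω) (Spot false ω) - mu P false (X ω)) ^ 2 ∂P)) :=
  (h.isCentered_surrogateRegression hε hY).integral_psi_sq hε h
    (fun t _ hc => h.integral_mul_resid_mul_devi hε hY t hc) c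

end IsRandomized

end Gaps

end SurrogateATE

end

/-! ### Assembly of the three bounds and the two gaps. -/

theorem corollary1 {𝒳 𝒮 : Type*} [MeasurableSpace 𝒳] [StandardBorelSpace 𝒳]
    [MeasurableSpace 𝒮] [StandardBorelSpace 𝒮]
    (ε : ℝ) (hε : 0 < ε) (hε' : ε < 1 / 2)
    (P : ProbabilityMeasure (SurrogateATE.Subject 𝒳 𝒮)) (hP : P ∈ SurrogateATE.model 𝒳 𝒮 ε) :
    ((∀ v : ℝ, SurrogateATE.IsATEBound ε SurrogateATE.obsI P v ↔
        v = SurrogateATE.VI (P : Measure (SurrogateATE.Subject 𝒳 𝒮))) ∧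
      (∀ v : ℝ, SurrogateATE.IsATEBound ε SurrogateATE.obsIII P v ↔
        v = SurrogateATE.VIII (P : Measure (SurrogateATE.Subject 𝒳 𝒮))) ∧
      (∀ v : ℝ, SurrogateATE.IsATEBound ε SurrogateATE.obsIV P v ↔
        v = SurrogateATE.VIV (P : Measure (SurrogateATE.Subject 𝒳 𝒮)))) ∧
    (Integrable (SurrogateATE.gainIntegrand (P : Measure (SurrogateATE.Subject 𝒳 𝒮)))
        (P : Measure (SurrogateATE.Subject 𝒳 𝒮)) ∧
      SurrogateATE.VI (P : Measure (SurrogateATE.Subject 𝒳 𝒮))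
          - SurrogateATE.VIII (P : Measure (SurrogateATE.Subject 𝒳 𝒮))
        = ∫ ω, SurrogateATE.gainIntegrand (P : Measure (SurrogateATE.Subject 𝒳 𝒮)) ω ∂P) ∧
    (Integrable (SurrogateATE.lossIntegrand (P : Measure (SurrogateATE.Subject 𝒳 𝒮)))
        (P : Measure (SurrogateATE.Subject 𝒳 𝒮)) ∧
      SurrogateATE.VIII (P : Measure (SurrogateATE.Subject 𝒳 𝒮))
          - SurrogateATE.VIV (P : Measure (SurrogateATE.Subject 𝒳 𝒮))
        = ∫ ω, SurrogateATE.lossIntegrand (P : Measure (SurrogateATE.Subject 𝒳 𝒮)) ω ∂P) := by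
  obtain ⟨π, η, h, he, hr⟩ := SurrogateATE.Assumptions.exists_isRandomized hε hε' hP
  have hY := SurrogateATE.Assumptions.square_integrable hP
  have eI : SurrogateATE.VI (P : Measure (SurrogateATE.Subject 𝒳 𝒮)) = _ :=
    integral_congr_ae ((SurrogateATE.psiI_ae_eq he hr).pow_const 2)
  have eIII : SurrogateATE.VIII (P : Measure (SurrogateATE.Subject 𝒳 𝒮)) = _ :=
    integral_congr_ae ((SurrogateATE.psiIII_ae_eq he hr).pow_const 2)
  have eIV : SurrogateATE.VIV (P : Measure (SurrogateATE.Subject 𝒳 𝒮)) = _ :=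
    integral_congr_ae ((SurrogateATE.psiIV_ae_eq (η := η) he).pow_const 2)
  have hcI := h.isCentered_covariateRegression hε hY false
  have hcIII := h.isCentered_surrogateRegression hε hY
  have hcIV := h.isCentered_covariateRegression hε hY true
  refine ⟨⟨fun v => ?_, fun v => ?_, fun v => ?_⟩, ?_⟩
  · rw [eI]
    refine (SurrogateATE.observesI (P : Measure (SurrogateATE.Subject 𝒳 𝒮))).isATEBound_iff hε hε'
      SurrogateATE.measurable_schemeI hcI h fun _ t K c mK mc => ?_
    -- Without surrogates an unlabelled unit of arm t shows only X, its outcome being coded as 0.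
    -- Centering of Y(t) − μ given X is therefore enough.
    rw [← hcI.resid t (fun x => c x * K (x, t, false, SurrogateATE.ind false * 0))
      (mc.mul (mK.comp (by fun_prop)))]
    refine integral_congr_ae (ae_of_all _ fun ω => ?_)
    simp [SurrogateATE.schemeI, SurrogateATE.act, SurrogateATE.armData, SurrogateATE.ind, mul_assoc]
  · rw [eIII]
    refine (SurrogateATE.observesIII (P : Measure (SurrogateATE.Subject 𝒳 𝒮))).isATEBound_iff hε hε'
      SurrogateATE.measurable_schemeIII hcIII h fun _ t K c mK mc => ?_
    -- With surrogates an unlabelled unit shows X and S(t), so the residual has to be orthogonal to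
    -- functions of both. This is why the regression must be μ̃ and not μ.
    rw [← (h.muS_spec hε (hY t)).2
      (fun v => c v.1 * K (v.1, t, v.2, false, SurrogateATE.ind false * 0))
      ((mc.comp measurable_fst).mul (mK.comp (by fun_prop)))]
    refine integral_congr_ae (ae_of_all _ fun ω => ?_)
    simp [SurrogateATE.schemeIII, SurrogateATE.act, SurrogateATE.armData, SurrogateATE.ind,
      SurrogateATE.surrogateRegression, SurrogateATE.Regression.resid, mul_assoc]
  · rw [eIV]
    -- All outcomes are revealed, so there is nothing to check about hidden residuals.
    exact (SurrogateATE.observesIV (P : Measure (SurrogateATE.Subject 𝒳 𝒮))).isATEBound_iff hε hε'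
      SurrogateATE.measurable_schemeIV hcIV h fun hfull => absurd hfull (by
        simp [SurrogateATE.covariateRegression])
  obtain ⟨hgi, hg⟩ := h.gainIntegrand_spec hε hY he hr
  obtain ⟨hli, hl⟩ := h.lossIntegrand_spec hε hY he hr
  have vI := eI.trans (h.integral_psi_sq_covariateRegression hε hY false _)
  have vIII := eIII.trans (h.integral_psi_sq_surrogateRegression hε hY _)
  have vIV := eIV.trans (h.integral_psi_sq_covariateRegression hε hY true _)
  simp only [SurrogateATE.revealProb, Bool.false_eq_true, if_false, if_true] at vI vIV
  have s1 := fun t => h.integral_mul_sq_add hε hY t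
    (c := fun x => (π t x * η t x)⁻¹) ((h.measurable_treat t).mul (h.measurable_label t)).inv
    (h.abs_inv_mul_le hε t)
  have s2 := fun t => h.integral_mul_sq_add hε hY t (c := fun x => (π t x)⁻¹)
    (h.measurable_treat t).inv (h.abs_inv_treat_le hε t)
  have s3 := fun t => h.integral_inv_mul hε t ((hY t).sub (h.muS_spec hε (hY t)).1)
  have s4 := fun t => h.integral_inv_mul hε t
    ((h.muS_spec hε (hY t)).1.sub (h.mu_spec hε (hY t)).1)
  simp only [Pi.sub_apply] at s3 s4
  refine ⟨⟨hgi, ?_⟩, ⟨hli, ?_⟩⟩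
  -- In setting I the whole of Y(t) − μ carries weight 1/(πη); in setting III its part μ̃ − μ
  -- carries only 1/π. The gap is the surcharge on that part.
  · linarith [s1 true, s1 false, s4 true, s4 false]
  -- In setting IV both parts of Y(t) − μ carry weight 1/π; in setting III the part Y(t) − μ̃
  -- carries 1/(πη). The gap is the surcharge on that part.
  · linarith [s2 true, s2 false, s3 true, s3 false]
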